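/- Fix $\ell_0>0$ and $\alpha\in(0,1/2)$; put $J=[-\ell_0/2,\ell_0/2]$. *Spaces.* $C^{h,k}$ denotes functions of two variables having continuous pure partial derivatives up to order $h$ in the first and up to order $k$ in the second variable. $C_\sharp^{6+\alpha}$ is the space of $\phi\in C^{6+\alpha}(J)$ with $\phi^{(j)}(-\ell_0/2)=\phi^{(j)}(\ell_0/2)$ for $j=0,\dots,6$. For $T>0$, $\mathscr Y_T$ is the space of $\zeta\in C^{1,4}([0,T]\times J)$ with $\zeta_\tau\in C^{0,2+\alpha}([0,T]\times J)$ (that is, $\zeta_\tau\in C^{0,2}$ and $\zeta_{\tau\eta\eta}$ is $\alpha$-Hölder in $\eta$ uniformly in $\tau$) and $D^{j}_\eta\zeta(\cdot,-\ell_0/2)=D^{j}_\eta\zeta(\cdot,\ell_0/2)$ for $j=0,1,2,3$. *The operator $R(0,L_\varepsilon)$.* Let $I_-=(-\infty,0]\times J$, $I_+=[0,\infty)\times J$, and let $\mathscr X$ be the Banach space of pairs $\mathbf f=(f_1,f_2)\in C(I_-)\times C(I_+)$ with $e^{-x/2}f_1$, $e^{-x/2}f_2$ bounded, with the weighted sup-norm.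 Put $\mathscr L\mathbf u=(D_{xx}u_1-D_xu_1+e^xu_1(0,\cdot),\;D_{xx}u_2-D_xu_2)$. For $\varepsilon>0$ let $L+\varepsilon A$ be the operator $\mathbf u\mapsto\mathscr L\mathbf u+\varepsilon\mathbf u_{\eta\eta}$ on the set of all $\mathbf u$ with $u_1\in C^{2,0}(I_-)\cap C^{0,2}(I_-)$, $u_2\in C^{2,0}(I_+)\cap C^{0,2}(I_+)$, $\mathbf u,\mathbf u_{\eta\eta},\mathscr L\mathbf u\in\mathscr X$, $D_x^{j}u_1(0,\cdot)=D_x^{j}u_2(0,\cdot)$ and $D_\eta^{j}u_i(\cdot,-\ell_0/2)=D_\eta^{j}u_i(\cdot,\ell_0/2)$ for $j=0,1$, $i=1,2$; let $L_\varepsilon$ be its closure in $\mathscr X$. Let $\mathbf T=(e^x,1)$, $\mathbf T'=(e^x,0)$, $\mathbf U=(\tfrac{1-x}{3}e^x,\tfrac13)$, $\mathbf V=((1-\tfrac23x+\tfrac{x^2}{6})e^x,\,1+\tfrac x3)$, and $\mathscr P\mathbf f=Q(\mathbf f)\mathbf U$ with $Q(\mathbf f)=\int_{-\infty}^0f_1(x,\cdot)\,dx+\int_0^\infty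 e^{-x}f_2(x,\cdot)\,dx$. For $\mathbf f\in(I-\mathscr P)(\mathscr X)$, $R(0,L_\varepsilon)\mathbf f$ is the unique $\mathbf z\in(I-\mathscr P)(\mathscr X)\cap D(L_\varepsilon)$ with $-L_\varepsilon\mathbf z=\mathbf f$. Put $\mathbf a=\mathbf T'-\mathbf U$, $\mathbf b=\mathbf V-\mathbf T-\tfrac43\mathbf U$, and write $M_\varepsilon\mathbf f=(D_{\eta\eta}R(0,L_\varepsilon)\mathbf f)_1(0,\cdot)$. *The remainder equation.* Let $\Phi_0\in C_\sharp^{6+\alpha}$ and let $\Phi\in C^{1,4}([0,\infty)\times J)$ solve $$\Phi_\tau=-3\Phi_{\eta\eta\eta\eta}-\Phi_{\eta\eta}-\tfrac12(\Phi_\eta)^2,\qquad \Phi(0,\cdot)=\Phi_0,\qquad D_\eta^k\Phi(\cdot,-\ell_0/2)=D_\eta^k\Phi(\cdot,\ell_0/2)\ (k=0,1,2,3).$$ Set $$\mathscr B_\varepsilon\psi=\psi-\tfrac{13\varepsilon}{3}\psi_{\eta\eta}+3\varepsilon^2M_\varepsilon[\psi_{\eta\eta}\mathbf b],\qquad \mathscr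 S_\varepsilon\psi=-3(1-\varepsilon)\psi_{\eta\eta\eta\eta}-\psi_{\eta\eta}+3\varepsilon M_\varepsilon[\psi_{\eta\eta}\mathbf a],$$ $$\mathscr G_\varepsilon(\xi)=\tfrac{17}{6}\xi_{\eta\eta}-3M_\varepsilon[\tfrac12\xi\mathbf a+\varepsilon\xi_{\eta\eta}\mathbf b],\qquad \mathscr H_\varepsilon(\Phi)=3\Phi_{\eta\eta\eta\eta}+3M_\varepsilon[\Phi_{\eta\eta}\mathbf a]+\tfrac{13}{3}\Phi_{\tau\eta\eta}-3\varepsilon M_\varepsilon[\Phi_{\tau\eta\eta}\mathbf b].$$ **Theorem.** For every $T>0$ there exist $\varepsilon_0\in(0,1/2)$ and $K>0$ (depending on $T$ and on the data $\ell_0,\alpha,\Phi$, but not on $\varepsilon$) such that, whenever $0<\varepsilon\le\varepsilon_0$ and $\rho\in\mathscr Y_T$ satisfies $\rho(0,\cdot)=0$ and $$\frac{\partial}{\partial\tau}\mathscr B_\varepsilon(\rho)=\mathscr S_\varepsilon(\rho)-\Phi_\eta\rho_\eta-\frac{\varepsilon}{2}(\rho_\eta)^2+\mathscr G_\varepsilon((\Phi_\eta+\varepsilon\rho_\eta)^2)+\mathscr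 H_\varepsilon(\Phi)\quad\text{on }[0,T]\times J,$$ then $$\sup_{\tau\in(0,T],\,\eta\in J}|\rho_\eta(\tau,\eta)|+\sup_{\tau\in(0,T]}\int_J(\rho_{\eta\eta}(\tau,\eta))^2d\eta+\int_0^T\!\!\int_J(\rho_\tau)^2d\eta\,d\tau+\int_0^T\!\!\int_J(\rho_{\tau\eta})^2d\eta\,d\tau\le K.$$ -/

import Mathlib

open Set MeasureTheory

namespace FrontKS

noncomputable section

/-! ### Function spaces on products of intervals -/

/-- The space interval `[-ℓ/2, ℓ/2]`. -/
def cell (ℓ : ℝ) : Set ℝ := Icc (-(ℓ / 2)) (ℓ / 2)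

/-- `D_η^{(j)} φ` on `[-ℓ/2, ℓ/2]` (one-sided at the end points). -/
def dEta (ℓ : ℝ) (j : ℕ) (φ : ℝ → ℝ) : ℝ → ℝ := iteratedDerivWithin j φ (cell ℓ)

/-- The partial derivative in the first variable, ranging over `J`. -/
def dFst (J : Set ℝ) (f : ℝ → ℝ → ℝ) : ℝ → ℝ → ℝ :=
  fun s z => derivWithin (fun s' => f s' z) J s

/-- `f ∈ C^{h,k}(J × K)`: the function `f` is `h` times continuously differentiable in the first
variable and `k` times in the second one, all these (pure) derivatives being continuous
on `J × K`. -/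
def MemC (h k : ℕ) (J K : Set ℝ) (f : ℝ → ℝ → ℝ) : Prop :=
  (∀ z ∈ K, ContDiffOn ℝ h (fun s => f s z) J) ∧
  (∀ s ∈ J, ContDiffOn ℝ k (f s) K) ∧
  (∀ j ≤ h, ContinuousOn
    (fun p : ℝ × ℝ => iteratedDerivWithin j (fun s => f s p.2) J p.1) (J ×ˢ K)) ∧
  (∀ j ≤ k, ContinuousOn
    (fun p : ℝ × ℝ => iteratedDerivWithin j (f p.1) K p.2) (J ×ˢ K))

/-- `C_♯^{m+α}`: functions on `[-ℓ/2, ℓ/2]` of class `C^m` whose `m`-th derivative is `α`-Hölder and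
whose derivatives of order `0, …, m` agree at the two end points (`0 < α < 1`). -/
def MemCSharp (ℓ : ℝ) (m : ℕ) (α : ℝ) (φ : ℝ → ℝ) : Prop :=
  ContDiffOn ℝ m φ (cell ℓ) ∧
  (∃ C : ℝ, ∀ η ∈ cell ℓ, ∀ η' ∈ cell ℓ, |dEta ℓ m φ η - dEta ℓ m φ η'| ≤ C * |η - η'| ^ α) ∧
  (∀ j ≤ m, dEta ℓ j φ (-(ℓ / 2)) = dEta ℓ j φ (ℓ / 2))

/-- `f ∈ C^{0,m+α}([0,T] × [-ℓ/2, ℓ/2])`: `f ∈ C^{0,m}`, and the `m`-th space derivative is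
`α`-Hölder in space, uniformly in time. -/
def MemCHolder (ℓ T : ℝ) (m : ℕ) (α : ℝ) (f : ℝ → ℝ → ℝ) : Prop :=
  MemC 0 m (Icc 0 T) (cell ℓ) f ∧
  (∃ C : ℝ, ∀ τ ∈ Icc 0 T, ∀ η ∈ cell ℓ, ∀ η' ∈ cell ℓ,
    |dEta ℓ m (f τ) η - dEta ℓ m (f τ) η'| ≤ C * |η - η'| ^ α)

/-- The space `𝒴_T`. -/
def MemY (ℓ α T : ℝ) (ζ : ℝ → ℝ → ℝ) : Prop :=
  MemC 1 4 (Icc 0 T) (cell ℓ) ζ ∧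
  MemCHolder ℓ T 2 α (dFst (Icc 0 T) ζ) ∧
  (∀ τ ∈ Icc 0 T, ∀ j ≤ 3, dEta ℓ j (ζ τ) (-(ℓ / 2)) = dEta ℓ j (ζ τ) (ℓ / 2))

/-- `Φ ∈ C^{1,4}([0,∞) × [-ℓ/2, ℓ/2])` is a solution of the periodic Cauchy problem for the
Kuramoto–Sivashinsky equation `Φ_τ = -3 Φ_ηηηη - Φ_ηη - (Φ_η)² / 2`, `Φ(0,·) = Φ₀`. -/
structure SolvesKS (ℓ : ℝ) (Φ₀ : ℝ → ℝ) (Φ : ℝ → ℝ → ℝ) : Prop where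
  regular : MemC 1 4 (Ici 0) (cell ℓ) Φ
  equation : ∀ τ ∈ Ici (0 : ℝ), ∀ η ∈ cell ℓ,
    dFst (Ici 0) Φ τ η
      = -3 * dEta ℓ 4 (Φ τ) η - dEta ℓ 2 (Φ τ) η - (1 / 2) * (dEta ℓ 1 (Φ τ) η) ^ 2
  periodic : ∀ τ ∈ Ici (0 : ℝ), ∀ k ≤ 3, dEta ℓ k (Φ τ) (-(ℓ / 2)) = dEta ℓ k (Φ τ) (ℓ / 2)
  initial : ∀ η ∈ cell ℓ, Φ 0 η = Φ₀ η

/-! ### Generalized functions on the strip: pairs `(u₁, u₂)`, where `u₁` is considered on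
`I₋ = (-∞,0] × [-ℓ/2, ℓ/2]` and `u₂` on `I₊ = [0,∞) × [-ℓ/2, ℓ/2]` only -/

abbrev StripFun : Type := (ℝ → ℝ → ℝ) × (ℝ → ℝ → ℝ)

/-- The weighted sup-norm distance of `u` and `v` is at most `δ` in each component. -/
def XClose (ℓ δ : ℝ) (u v : StripFun) : Prop :=
  (∀ x ≤ 0, ∀ η ∈ cell ℓ, Real.exp (-(x / 2)) * |u.1 x η - v.1 x η| ≤ δ) ∧
  (∀ x ≥ 0, ∀ η ∈ cell ℓ, Real.exp (-(x / 2)) * |u.2 x η - v.2 x η| ≤ δ)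

/-- The space `𝒳`: both components are continuous and bounded after multiplication by
`e^{-x/2}`. -/
def MemX (ℓ : ℝ) (f : StripFun) : Prop :=
  ContinuousOn (fun p : ℝ × ℝ => f.1 p.1 p.2) (Iic 0 ×ˢ cell ℓ) ∧
  ContinuousOn (fun p : ℝ × ℝ => f.2 p.1 p.2) (Ici 0 ×ˢ cell ℓ) ∧
  ∃ C : ℝ, XClose ℓ C f 0

/-- `D_x^{(j)} u`. -/
def dX (j : ℕ) (u : StripFun) : StripFun :=
  (fun x η => iteratedDerivWithin j (fun x' => u.1 x' η) (Iic 0) x,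
   fun x η => iteratedDerivWithin j (fun x' => u.2 x' η) (Ici 0) x)

/-- `D_η^{(j)} u`. -/
def dY (ℓ : ℝ) (j : ℕ) (u : StripFun) : StripFun :=
  (fun x => dEta ℓ j (u.1 x), fun x => dEta ℓ j (u.2 x))

/-- The differential operator `𝓛 u = (D_xx u₁ - D_x u₁ + e^x u₁(0,·), D_xx u₂ - D_x u₂)`. -/
def opL (u : StripFun) : StripFun :=
  (fun x η => (dX 2 u).1 x η - (dX 1 u).1 x η + Real.exp x * u.1 0 η,
   fun x η => (dX 2 u).2 x η - (dX 1 u).2 x η)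

/-- The domain `D(L + εA)`, where `A = D_ηη` (it does not depend on `ε > 0`). -/
structure DomLA (ℓ : ℝ) (u : StripFun) : Prop where
  regular₁ : MemC 2 2 (Iic 0) (cell ℓ) u.1
  regular₂ : MemC 2 2 (Ici 0) (cell ℓ) u.2
  memX : MemX ℓ u
  memX_dYY : MemX ℓ (dY ℓ 2 u)
  memX_opL : MemX ℓ (opL u)
  interface : ∀ j ≤ 1, ∀ η ∈ cell ℓ, (dX j u).1 0 η = (dX j u).2 0 η
  periodic₁ : ∀ j ≤ 1, ∀ x ≤ 0, (dY ℓ j u).1 x (-(ℓ / 2)) = (dY ℓ j u).1 x (ℓ / 2)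
  periodic₂ : ∀ j ≤ 1, ∀ x ≥ 0, (dY ℓ j u).2 x (-(ℓ / 2)) = (dY ℓ j u).2 x (ℓ / 2)

/-- `(L + εA) u`. -/
def opLA (ℓ ε : ℝ) (u : StripFun) : StripFun := opL u + ε • dY ℓ 2 u

/-- `u ∈ D(L_ε)` and `L_ε u = f`, where `L_ε` is the closure of `L + εA` in `𝒳`: the pair `(u, f)`
lies in the closure of the graph of `L + εA` in `𝒳 × 𝒳`. -/
def GraphLeps (ℓ ε : ℝ) (u f : StripFun) : Prop :=
  MemX ℓ u ∧ MemX ℓ f ∧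
  ∀ δ > 0, ∃ v : StripFun, DomLA ℓ v ∧ XClose ℓ δ u v ∧ XClose ℓ δ f (opLA ℓ ε v)

/-- The functional `Q`. -/
def opQ (f : StripFun) (η : ℝ) : ℝ :=
  (∫ x in Iic (0 : ℝ), f.1 x η) + ∫ x in Ioi (0 : ℝ), Real.exp (-x) * f.2 x η

/-- A function of `x` alone on the strip, given by its two components. -/
abbrev LineFun : Type := (ℝ → ℝ) × (ℝ → ℝ)

def funT : LineFun := (fun x => Real.exp x, fun _ => 1)

def funT' : LineFun := (fun x => Real.exp x, fun _ => 0)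

def funU : LineFun := (fun x => (1 - x) / 3 * Real.exp x, fun _ => 1 / 3)

def funV : LineFun :=
  (fun x => (1 - 2 / 3 * x + x ^ 2 / 6) * Real.exp x, fun x => 1 + x / 3)

/-- The product `φ(η) h(x)`. -/
def tensor (φ : ℝ → ℝ) (h : LineFun) : StripFun :=
  (fun x η => φ η * h.1 x, fun x η => φ η * h.2 x)

/-- The spectral projection `𝒫 f = Q(f) U` on the kernel of `L`. -/
def projP (f : StripFun) : StripFun := tensor (opQ f) funU

/-- `z ∈ (I - 𝒫)(𝒳)`, that is, `z ∈ 𝒳` and `𝒫 z = 0` on the strip. -/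
def MemRangeIP (ℓ : ℝ) (z : StripFun) : Prop := MemX ℓ z ∧ XClose ℓ 0 (projP z) 0

/-- `z = R(0, L_ε) f`, for the restriction of `L_ε` to `(I - 𝒫)(𝒳)`: `z ∈ (I - 𝒫)(𝒳) ∩ D(L_ε)`
and `-L_ε z = f`. -/
def IsResolvent (ℓ ε : ℝ) (f z : StripFun) : Prop := MemRangeIP ℓ z ∧ GraphLeps ℓ ε z (-f)

open Classical in
/-- `R(0, L_ε) f`, unique as a function on the strip (with value `0` in case that `f` is not in the
range). -/
def resolvent (ℓ ε : ℝ) (f : StripFun) : StripFun :=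
  if h : ∃ z, IsResolvent ℓ ε f z then h.choose else 0

/-- `(D_ηη R(0, L_ε) f)(0, ·)`. -/
def traceDR (ℓ ε : ℝ) (f : StripFun) : ℝ → ℝ := (dY ℓ 2 (resolvent ℓ ε f)).1 0

/-- `T' - U`. -/
def vecA : LineFun := funT' - funU

/-- `V - T - (4/3) U`. -/
def vecB : LineFun := funV - funT - (4 / 3 : ℝ) • funU

/-! ### The operators in the equation for the remainder -/

def opB (ℓ ε : ℝ) (ψ : ℝ → ℝ) (η : ℝ) : ℝ :=
  ψ η - 13 * ε / 3 * dEta ℓ 2 ψ η + 3 * ε ^ 2 * traceDR ℓ ε (tensor (dEta ℓ 2 ψ) vecB) η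

def opS (ℓ ε : ℝ) (ψ : ℝ → ℝ) (η : ℝ) : ℝ :=
  -3 * (1 - ε) * dEta ℓ 4 ψ η - dEta ℓ 2 ψ η
    + 3 * ε * traceDR ℓ ε (tensor (dEta ℓ 2 ψ) vecA) η

def opG (ℓ ε : ℝ) (ξ : ℝ → ℝ) (η : ℝ) : ℝ :=
  17 / 6 * dEta ℓ 2 ξ η
    - 3 * traceDR ℓ ε ((1 / 2 : ℝ) • tensor ξ vecA + ε • tensor (dEta ℓ 2 ξ) vecB) η

/-- `ℋ_ε(Φ)` at a fixed time, as a function of `φ = Φ(τ,·)` and `φ' = Φ_τ(τ,·)`. -/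
def opH (ℓ ε : ℝ) (φ φ' : ℝ → ℝ) (η : ℝ) : ℝ :=
  3 * dEta ℓ 4 φ η + 3 * traceDR ℓ ε (tensor (dEta ℓ 2 φ) vecA) η
    + 13 / 3 * dEta ℓ 2 φ' η
    - 3 * ε * traceDR ℓ ε (tensor (dEta ℓ 2 φ') vecB) η

/-- `ρ` solves, on `[0,T] × [-ℓ/2, ℓ/2]`, the equation
`∂_τ ℬ_ε(ρ) = 𝒮_ε(ρ) - Φ_η ρ_η - (ε/2) (ρ_η)² + 𝒢_ε((Φ_η + ε ρ_η)²) + ℋ_ε(Φ)`. -/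
def SolvesRemainder (ℓ ε T : ℝ) (Φ ρ : ℝ → ℝ → ℝ) : Prop :=
  ∀ τ ∈ Icc 0 T, ∀ η ∈ cell ℓ,
    HasDerivWithinAt (fun s => opB ℓ ε (ρ s) η)
      (opS ℓ ε (ρ τ) η - dEta ℓ 1 (Φ τ) η * dEta ℓ 1 (ρ τ) η
        - ε / 2 * (dEta ℓ 1 (ρ τ) η) ^ 2
        + opG ℓ ε (fun η' => (dEta ℓ 1 (Φ τ) η' + ε * dEta ℓ 1 (ρ τ) η') ^ 2) η
        + opH ℓ ε (Φ τ) (dFst (Ici 0) Φ τ) η)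
      (Icc 0 T) τ

end

end FrontKS

open Set MeasureTheory


namespace FrontKS

/-! The whole problem is diagonal in the Hartley basis `cas ℓ k = cos + sin`, a real substitute for
the exponentials: with periodic boundary conditions `D_ηη` multiplies the `k`-th coefficient by
`-λ_k`, where `λ_k = lam ℓ k`, and `M_ε` becomes a Fourier multiplier. Let `s ≥ 1` solve `s (s - 1)
= ε λ_k`. For the source `φ a + χ b` the resolvent equation in `x` is solved by polynomials and
exponentials (`exists_isMode`), and the value at the interface, `traceSymbol`, is a rational
function of `s`. Summing the modes gives one resolvent (`exists_resolvent`). Conversely, pairing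
with the adjoint solution `e^{(s-1)x}`, `e^{-sx}` survives the closure defining `L_ε` and determines
the trace in every mode `k ≠ 0` (`trace_of_graphLeps`). The remaining constant is killed by `D_ηη`,
so `traceDR_sourceAB` computes `M_ε` without needing uniqueness of the resolvent itself.

Written in `s`, the operators have symbols with bounds uniform in `ε ≤ 1/2`: `B ≥ 1 + ε λ`, `|G| ≤ 3
λ` and `λ - S ≥ λ²` (`symB_ge`, `abs_symG_le`, `neg_symS_ge`). The equation for the `k`-th
coefficient `y` of `ρ` is multiplied by `λ y'`. The critical term comes from the part `ε x₁` of the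
squared slope that involves `ρ`: estimated against `λ y'²` it would cost `λ³ x₁²`, hence four
derivatives of `ρ`, while the energy `Σ λ³ y²` controls three. The surplus `ε λ² y'²` in `B` absorbs
it at the price of `λ² x₁²` only (`mode_inequality`). Summation shows that the mean square `E` of
`ρ_ηηη` satisfies `E(t) ≤ A + C ∫ (E + ε² E²)`, and `gronwall_quadratic` closes the estimate once
`ε` is small depending on `T`.

Two points of regularity intervene. The forcing `ℋ_ε(Φ)` needs a square integrable third space
derivative of `Φ_τ`, more than `C^{1,4}` gives. `SolvesKS.energy` obtains it by parabolic smoothing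
from the regularity of `Φ₀`, for almost every time, which suffices because the energy inequality is
integrated in time. Also, the equation for `ρ` holds pointwise in `η`, and its time derivative falls
on the nonlocal `ℬ_ε(ρ)`. It passes to coefficients because the difference quotients of the
coefficients converge in weighted square mean (`MemY.diffQuot`, `coef_of_tendsto`).

Finally, Rolle's theorem and Cauchy–Schwarz bound `ρ_η` and `ρ_ηη` by `E`, the dissipated part of
the energy bounds `ρ_τη`, and Poincaré's inequality bounds `ρ_τ` up to its mean, on which only the
convective terms act. -/

/-! ### The Hartley basis `cos (ω k η) + sin (ω k η)` on the cell -/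

/-- The frequency `2 π k / ℓ`. -/
noncomputable def freq (ℓ : ℝ) (k : ℤ) : ℝ := 2 * Real.pi / ℓ * k

/-- The eigenvalues of `-D_ηη` with periodic boundary conditions. -/
noncomputable def lam (ℓ : ℝ) (k : ℤ) : ℝ := freq ℓ k ^ 2

/-- The Hartley basis functions. -/
noncomputable def cas (ℓ : ℝ) (k : ℤ) (η : ℝ) : ℝ :=
  Real.cos (freq ℓ k * η) + Real.sin (freq ℓ k * η)

/-- The Hartley coefficients of a function on the cell. -/
noncomputable def coef (ℓ : ℝ) (f : ℝ → ℝ) (k : ℤ) : ℝ :=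
  ℓ⁻¹ * ∫ η in (-(ℓ / 2))..(ℓ / 2), f η * cas ℓ k η

lemma freq_neg (ℓ : ℝ) (k : ℤ) : freq ℓ (-k) = -freq ℓ k := by simp [freq]

lemma lam_neg (ℓ : ℝ) (k : ℤ) : lam ℓ (-k) = lam ℓ k := by simp [lam, freq_neg]

lemma lam_nonneg (ℓ : ℝ) (k : ℤ) : 0 ≤ lam ℓ k := sq_nonneg _

lemma lam_zero (ℓ : ℝ) : lam ℓ 0 = 0 := by simp [lam, freq]

lemma lam_one_le {ℓ : ℝ} {k : ℤ} (hk : k ≠ 0) : lam ℓ 1 ≤ lam ℓ k := by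
  have h : (1 : ℝ) ≤ (k : ℝ) ^ 2 := by
    have : (1 : ℤ) ≤ k ^ 2 := by nlinarith [Int.one_le_abs hk, sq_abs k]
    exact_mod_cast this
  unfold lam freq
  rw [mul_pow, mul_pow]
  simp only [Int.cast_one, one_pow, mul_one]
  nlinarith [sq_nonneg (2 * Real.pi / ℓ)]

lemma lam_one_pos {ℓ : ℝ} (hℓ : 0 < ℓ) : 0 < lam ℓ 1 := by
  unfold lam freq; have := Real.pi_pos; simp only [Int.cast_one, mul_one]; positivity

lemma lam_pos {ℓ : ℝ} (hℓ : 0 < ℓ) {k : ℤ} (hk : k ≠ 0) : 0 < lam ℓ k :=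
  (lam_one_pos hℓ).trans_le (lam_one_le hk)

lemma abs_freq_le (ℓ : ℝ) (k : ℤ) : |freq ℓ k| ≤ 1 + lam ℓ k := by
  unfold lam; rw [← sq_abs]; nlinarith [sq_nonneg (|freq ℓ k| - 1)]

lemma summable_inv_lam {ℓ : ℝ} : Summable fun k : ℤ => (lam ℓ k)⁻¹ := by
  have h : Summable fun k : ℤ => 1 / (k : ℝ) ^ 2 := Real.summable_one_div_int_pow.mpr one_lt_two
  refine (h.mul_left (((2 * Real.pi / ℓ) ^ 2)⁻¹)).congr fun k => ?_
  unfold lam freq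
  rw [mul_pow, mul_inv, one_div]

@[fun_prop]
lemma continuous_cas (ℓ : ℝ) (k : ℤ) : Continuous (cas ℓ k) := by unfold cas; fun_prop

lemma contDiff_cas (ℓ : ℝ) (k : ℤ) (n : WithTop ℕ∞) : ContDiff ℝ n (cas ℓ k) := by
  unfold cas; fun_prop

/-- Differentiation turns `cos + sin` into a multiple of `cos - sin`, the basis function of index
`-k`. This is why indices change sign in every odd number of integrations by parts. -/
lemma hasDerivAt_cas (ℓ : ℝ) (k : ℤ) (η : ℝ) :
    HasDerivAt (cas ℓ k) (freq ℓ k * cas ℓ (-k) η) η := by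
  have h : HasDerivAt (fun x : ℝ => freq ℓ k * x) (freq ℓ k) η := by
    simpa using (hasDerivAt_id η).const_mul (freq ℓ k)
  have e : freq ℓ k * cas ℓ (-k) η
      = -Real.sin (freq ℓ k * η) * freq ℓ k + Real.cos (freq ℓ k * η) * freq ℓ k := by
    simp only [cas, freq_neg, neg_mul, Real.cos_neg, Real.sin_neg]
    ring
  rw [e]
  exact h.cos.add h.sin

lemma hasDerivAt_cas_neg (ℓ : ℝ) (k : ℤ) (η : ℝ) :
    HasDerivAt (fun x => freq ℓ k * cas ℓ (-k) x) (-(lam ℓ k * cas ℓ k η)) η := by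
  have e : -(lam ℓ k * cas ℓ k η) = freq ℓ k * (freq ℓ (-k) * cas ℓ (- -k) η) := by
    simp only [freq_neg, neg_neg, lam]; ring
  rw [e]
  exact (hasDerivAt_cas ℓ (-k) η).const_mul (freq ℓ k)

lemma abs_cas_le (ℓ : ℝ) (k : ℤ) (η : ℝ) : |cas ℓ k η| ≤ 2 := by
  unfold cas
  refine (abs_add_le _ _).trans ?_
  linarith [Real.abs_cos_le_one (freq ℓ k * η), Real.abs_sin_le_one (freq ℓ k * η)]

lemma cas_sq_add (ℓ : ℝ) (k : ℤ) (η : ℝ) : cas ℓ k η ^ 2 + cas ℓ (-k) η ^ 2 = 2 := by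
  simp only [cas, freq_neg, neg_mul, Real.cos_neg, Real.sin_neg]
  nlinarith [Real.sin_sq_add_cos_sq (freq ℓ k * η)]

lemma cas_zero (ℓ : ℝ) (η : ℝ) : cas ℓ 0 η = 1 := by simp [cas, freq]

lemma cas_endpoints {ℓ : ℝ} (hℓ : 0 < ℓ) (k : ℤ) : cas ℓ k (-(ℓ / 2)) = cas ℓ k (ℓ / 2) := by
  have h : freq ℓ k * (ℓ / 2) = k * Real.pi := by unfold freq; field_simp
  simp only [cas, mul_neg, Real.cos_neg, Real.sin_neg, h, Real.sin_int_mul_pi, neg_zero]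

lemma uIcc_cell {ℓ : ℝ} (hℓ : 0 < ℓ) : uIcc (-(ℓ / 2)) (ℓ / 2) = cell ℓ :=
  uIcc_of_le (by linarith)

lemma uniqueDiffOn_cell {ℓ : ℝ} (hℓ : 0 < ℓ) : UniqueDiffOn ℝ (cell ℓ) :=
  uniqueDiffOn_Icc (by linarith)

lemma left_mem_cell {ℓ : ℝ} (hℓ : 0 < ℓ) : -(ℓ / 2) ∈ cell ℓ := left_mem_Icc.2 (by linarith)

lemma right_mem_cell {ℓ : ℝ} (hℓ : 0 < ℓ) : ℓ / 2 ∈ cell ℓ := right_mem_Icc.2 (by linarith)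

lemma intervalIntegrable_of_cell {ℓ : ℝ} (hℓ : 0 < ℓ) {f : ℝ → ℝ} (hf : ContinuousOn f (cell ℓ)) :
    IntervalIntegrable f volume (-(ℓ / 2)) (ℓ / 2) :=
  ContinuousOn.intervalIntegrable (by rwa [uIcc_cell hℓ])

lemma intervalIntegrable_of_cell_complex {ℓ : ℝ} (hℓ : 0 < ℓ) {f : ℝ → ℝ}
    (hf : ContinuousOn f (cell ℓ)) :
    IntervalIntegrable (fun x => (f x : ℂ)) volume (-(ℓ / 2)) (ℓ / 2) :=
  ContinuousOn.intervalIntegrable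
    (by rw [uIcc_cell hℓ]; exact Complex.continuous_ofReal.comp_continuousOn hf)

lemma coef_congr {ℓ : ℝ} (hℓ : 0 < ℓ) {f g : ℝ → ℝ} (h : EqOn f g (cell ℓ)) :
    coef ℓ f = coef ℓ g := by
  funext k
  unfold coef
  congr 1
  refine intervalIntegral.integral_congr fun η hη => ?_
  rw [uIcc_cell hℓ] at hη
  simp only [h hη]

lemma coef_add {ℓ : ℝ} (hℓ : 0 < ℓ) {f g : ℝ → ℝ} (hf : ContinuousOn f (cell ℓ))
    (hg : ContinuousOn g (cell ℓ)) (k : ℤ) :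
    coef ℓ (fun η => f η + g η) k = coef ℓ f k + coef ℓ g k := by
  have h := intervalIntegral.integral_add
    (intervalIntegrable_of_cell hℓ (hf.mul (continuous_cas ℓ k).continuousOn))
    (intervalIntegrable_of_cell hℓ (hg.mul (continuous_cas ℓ k).continuousOn))
  simp only [Pi.mul_apply] at h
  unfold coef
  simp only [add_mul]
  rw [h, mul_add]

lemma coef_const_mul (ℓ : ℝ) (c : ℝ) (f : ℝ → ℝ) (k : ℤ) :
    coef ℓ (fun η => c * f η) k = c * coef ℓ f k := by
  unfold coef
  simp only [mul_assoc, intervalIntegral.integral_const_mul]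
  ring

lemma coef_sub {ℓ : ℝ} (hℓ : 0 < ℓ) {f g : ℝ → ℝ} (hf : ContinuousOn f (cell ℓ))
    (hg : ContinuousOn g (cell ℓ)) (k : ℤ) :
    coef ℓ (fun η => f η - g η) k = coef ℓ f k - coef ℓ g k := by
  have h := coef_add hℓ hf (hg.const_mul (-1)) k
  rw [coef_const_mul] at h
  simpa [sub_eq_add_neg] using h

/-- Integration by parts. -/
lemma coef_deriv {ℓ : ℝ} (hℓ : 0 < ℓ) {f f' : ℝ → ℝ}
    (hf : ∀ η ∈ cell ℓ, HasDerivWithinAt f (f' η) (cell ℓ) η)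
    (hf' : ContinuousOn f' (cell ℓ)) (hp : f (-(ℓ / 2)) = f (ℓ / 2)) (k : ℤ) :
    coef ℓ f' k = -(freq ℓ k * coef ℓ f (-k)) := by
  have hle : -(ℓ / 2) ≤ ℓ / 2 := by linarith
  have h := intervalIntegral.integral_mul_deriv_eq_deriv_mul_of_hasDerivWithinAt
    (u := cas ℓ k) (u' := fun η => freq ℓ k * cas ℓ (-k) η) (v := f) (v' := f')
    (a := -(ℓ / 2)) (b := ℓ / 2)
    (fun x _ => (hasDerivAt_cas ℓ k x).hasDerivWithinAt)
    (by rw [uIcc_cell hℓ]; exact hf)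
    (Continuous.intervalIntegrable (by fun_prop) _ _) (intervalIntegrable_of_cell hℓ hf')
  rw [cas_endpoints hℓ, hp, sub_self, zero_sub] at h
  have h2 : ∫ η in (-(ℓ / 2))..(ℓ / 2), f' η * cas ℓ k η
      = ∫ η in (-(ℓ / 2))..(ℓ / 2), cas ℓ k η * f' η := by simp only [mul_comm]
  have h3 : ∫ η in (-(ℓ / 2))..(ℓ / 2), freq ℓ k * cas ℓ (-k) η * f η
      = freq ℓ k * ∫ η in (-(ℓ / 2))..(ℓ / 2), f η * cas ℓ (-k) η := by
    rw [← intervalIntegral.integral_const_mul]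
    congr 1; ext η; ring
  unfold coef
  rw [h2, h, h3]; ring

lemma coef_deriv_sq {ℓ : ℝ} (hℓ : 0 < ℓ) {f f' : ℝ → ℝ}
    (hf : ∀ η ∈ cell ℓ, HasDerivWithinAt f (f' η) (cell ℓ) η)
    (hf' : ContinuousOn f' (cell ℓ)) (hp : f (-(ℓ / 2)) = f (ℓ / 2)) (k : ℤ) :
    coef ℓ f' k ^ 2 = lam ℓ k * coef ℓ f (-k) ^ 2 := by
  rw [coef_deriv hℓ hf hf' hp, lam]; ring

lemma coef_deriv_deriv {ℓ : ℝ} (hℓ : 0 < ℓ) {f f' f'' : ℝ → ℝ}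
    (hf : ∀ η ∈ cell ℓ, HasDerivWithinAt f (f' η) (cell ℓ) η)
    (hf' : ∀ η ∈ cell ℓ, HasDerivWithinAt f' (f'' η) (cell ℓ) η)
    (hf'' : ContinuousOn f'' (cell ℓ))
    (hp : f (-(ℓ / 2)) = f (ℓ / 2)) (hp' : f' (-(ℓ / 2)) = f' (ℓ / 2)) (k : ℤ) :
    coef ℓ f'' k = -(lam ℓ k * coef ℓ f k) := by
  rw [coef_deriv hℓ hf' hf'' hp',
    coef_deriv hℓ hf (fun η hη => (hf' η hη).continuousWithinAt) hp, freq_neg, neg_neg, lam]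
  ring

/-- Parseval's identity for the Hartley basis. -/
lemma hasSum_coef_sq {ℓ : ℝ} (hℓ : 0 < ℓ) {f : ℝ → ℝ} (hf : ContinuousOn f (cell ℓ)) :
    HasSum (fun k => coef ℓ f k ^ 2) (ℓ⁻¹ * ∫ η in (-(ℓ / 2))..(ℓ / 2), f η ^ 2) := by
  have hab : -(ℓ / 2) < ℓ / 2 := by linarith
  have hba : ℓ / 2 - -(ℓ / 2) = ℓ := by ring
  have hL2 : MemLp (fun x => (f x : ℂ)) 2 (volume.restrict (Ioc (-(ℓ / 2)) (ℓ / 2))) := by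
    have hc : ContinuousOn (fun x => (f x : ℂ)) (cell ℓ) :=
      Complex.continuous_ofReal.comp_continuousOn hf
    obtain ⟨B, hB⟩ := isCompact_Icc.exists_bound_of_continuousOn hc
    have : IsFiniteMeasure (volume.restrict (cell ℓ)) :=
      isFiniteMeasure_restrict.2 isCompact_Icc.measure_lt_top.ne
    have hm : MemLp (fun x => (f x : ℂ)) 2 (volume.restrict (cell ℓ)) :=
      MemLp.of_bound (hc.aestronglyMeasurable measurableSet_Icc) B
        (ae_restrict_of_forall_mem measurableSet_Icc hB)
    exact hm.mono_measure (Measure.restrict_mono Ioc_subset_Icc_self le_rfl)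
  have h := hasSum_sq_fourierCoeffOn hab hL2
  set C : ℤ → ℝ := fun k => ∫ η in (-(ℓ / 2))..(ℓ / 2), f η * Real.cos (freq ℓ k * η) with hC
  set S : ℤ → ℝ := fun k => ∫ η in (-(ℓ / 2))..(ℓ / 2), f η * Real.sin (freq ℓ k * η) with hS
  have hic : ∀ k, IntervalIntegrable (fun η => f η * Real.cos (freq ℓ k * η)) volume
      (-(ℓ / 2)) (ℓ / 2) := fun k =>
    intervalIntegrable_of_cell hℓ (hf.mul (by fun_prop))
  have his : ∀ k, IntervalIntegrable (fun η => f η * Real.sin (freq ℓ k * η)) volume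
      (-(ℓ / 2)) (ℓ / 2) := fun k =>
    intervalIntegrable_of_cell hℓ (hf.mul (by fun_prop))
  have hcoef : ∀ k, coef ℓ f k = ℓ⁻¹ * (C k + S k) := fun k => by
    rw [hC, hS]; unfold coef cas
    simp only [mul_add]
    rw [intervalIntegral.integral_add (hic k) (his k), mul_add]
  have hCn : ∀ k, C (-k) = C k := fun k => by simp [hC, freq_neg]
  have hSn : ∀ k, S (-k) = -S k := fun k => by simp [hS, freq_neg]
  have hF : ∀ k, ‖fourierCoeffOn hab (fun x => (f x : ℂ)) k‖ ^ 2
      = (ℓ⁻¹) ^ 2 * (C k ^ 2 + S k ^ 2) := fun k => by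
    have e : ∫ x in (-(ℓ / 2))..(ℓ / 2), fourier (-k) (x : AddCircle (ℓ / 2 - -(ℓ / 2))) • (f x : ℂ)
        = (C k : ℂ) - (S k : ℂ) * Complex.I := by
      have e1 : ∀ x : ℝ, fourier (-k) (x : AddCircle (ℓ / 2 - -(ℓ / 2))) • (f x : ℂ)
          = ((f x * Real.cos (freq ℓ k * x) : ℝ) : ℂ)
            - ((f x * Real.sin (freq ℓ k * x) : ℝ) : ℂ) * Complex.I := fun x => by
        rw [fourier_coe_apply, hba]
        have : 2 * (Real.pi : ℂ) * Complex.I * ((-k : ℤ) : ℂ) * (x : ℂ) / (ℓ : ℂ)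
            = ((-(freq ℓ k * x) : ℝ) : ℂ) * Complex.I := by
          unfold freq; push_cast; ring
        rw [this, Complex.exp_mul_I, ← Complex.ofReal_cos, ← Complex.ofReal_sin, Real.cos_neg,
          Real.sin_neg, smul_eq_mul]
        push_cast; ring
      simp only [e1]
      rw [intervalIntegral.integral_sub, intervalIntegral.integral_mul_const,
        intervalIntegral.integral_ofReal, intervalIntegral.integral_ofReal]
      · exact intervalIntegrable_of_cell_complex hℓ (hf.mul (by fun_prop))
      · exact (intervalIntegrable_of_cell_complex hℓ (hf.mul (by fun_prop))).mul_const _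
    rw [fourierCoeffOn_eq_integral, e, hba, norm_smul, mul_pow, ← Complex.normSq_eq_norm_sq,
      Complex.normSq_apply]
    rw [one_div, Real.norm_eq_abs, sq_abs]
    simp
    left; ring
  simp only [hF, hba] at h
  have hval : (ℓ⁻¹ • ∫ x in (-(ℓ / 2))..(ℓ / 2), ‖(f x : ℂ)‖ ^ 2)
      = ℓ⁻¹ * ∫ η in (-(ℓ / 2))..(ℓ / 2), f η ^ 2 := by
    simp [Complex.norm_real, sq_abs]
  rw [hval] at h
  have hs : Summable fun k => coef ℓ f k ^ 2 := by
    refine Summable.of_nonneg_of_le (fun k => sq_nonneg _) (fun k => ?_) (h.summable.mul_left 2)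
    rw [hcoef, mul_pow]
    nlinarith [sq_nonneg (ℓ⁻¹ * (C k - S k))]
  -- The cross term `C k * S k` is odd in `k`, so adding the series over `k` and over `-k` leaves
  -- the Parseval sum of the complex Fourier coefficients.
  have hs' : HasSum (fun k => coef ℓ f (-k) ^ 2) (∑' k, coef ℓ f k ^ 2) :=
    (Equiv.hasSum_iff (Equiv.neg ℤ) (f := fun k => coef ℓ f k ^ 2)).2 hs.hasSum
  have h2 := (hs.hasSum.add hs').unique ((h.mul_left 2).congr_fun fun k => by
    rw [hcoef, hcoef, hCn, hSn]; ring)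
  have h3 : ∑' k, coef ℓ f k ^ 2 = ℓ⁻¹ * ∫ η in (-(ℓ / 2))..(ℓ / 2), f η ^ 2 := by linarith
  rw [← h3]; exact hs.hasSum

lemma sum_coef_sq_le {ℓ : ℝ} (hℓ : 0 < ℓ) {f : ℝ → ℝ} (hf : ContinuousOn f (cell ℓ))
    (N : Finset ℤ) :
    ∑ k ∈ N, coef ℓ f k ^ 2 ≤ ℓ⁻¹ * ∫ η in (-(ℓ / 2))..(ℓ / 2), f η ^ 2 :=
  sum_le_hasSum N (fun _ _ => sq_nonneg _) (hasSum_coef_sq hℓ hf)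

lemma coef_sq_le {ℓ : ℝ} (hℓ : 0 < ℓ) {f : ℝ → ℝ} (hf : ContinuousOn f (cell ℓ)) (k : ℤ) :
    coef ℓ f k ^ 2 ≤ ℓ⁻¹ * ∫ η in (-(ℓ / 2))..(ℓ / 2), f η ^ 2 := by
  simpa using sum_coef_sq_le hℓ hf {k}

lemma hasSum_lam_coef_sq {ℓ : ℝ} (hℓ : 0 < ℓ) {f f' : ℝ → ℝ}
    (hf : ∀ η ∈ cell ℓ, HasDerivWithinAt f (f' η) (cell ℓ) η)
    (hf' : ContinuousOn f' (cell ℓ)) (hp : f (-(ℓ / 2)) = f (ℓ / 2)) :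
    HasSum (fun k => lam ℓ k * coef ℓ f k ^ 2)
      (ℓ⁻¹ * ∫ η in (-(ℓ / 2))..(ℓ / 2), f' η ^ 2) := by
  have h := (Equiv.hasSum_iff (Equiv.neg ℤ)).2 (hasSum_coef_sq hℓ hf')
  refine h.congr_fun fun k => ?_
  simp only [Function.comp, Equiv.neg_apply]
  rw [coef_deriv_sq hℓ hf hf' hp, neg_neg, lam_neg]

/-- A continuous function on the cell all of whose coefficients vanish is zero. -/
lemma eq_zero_of_coef_eq_zero {ℓ : ℝ} (hℓ : 0 < ℓ) {f : ℝ → ℝ} (hf : ContinuousOn f (cell ℓ))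
    (h : ∀ k, coef ℓ f k = 0) : ∀ η ∈ cell ℓ, f η = 0 := by
  have h0 : ∫ η in (-(ℓ / 2))..(ℓ / 2), f η ^ 2 = 0 := by
    have h1 := hasSum_coef_sq hℓ hf
    simp only [h, ne_eq, OfNat.ofNat_ne_zero, not_false_eq_true, zero_pow] at h1
    have := h1.unique hasSum_zero
    have hl : ℓ⁻¹ ≠ 0 := inv_ne_zero hℓ.ne'
    simpa [hl] using this
  have hab : -(ℓ / 2) < ℓ / 2 := by linarith
  intro η hη
  by_contra hne
  have hpos : 0 < ∫ η in (-(ℓ / 2))..(ℓ / 2), f η ^ 2 :=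
    intervalIntegral.integral_pos hab (hf.pow 2) (fun x _ => sq_nonneg _)
      ⟨η, hη, by positivity⟩
  linarith

/-- Eigenfunctions of `D_ηη` with different eigenvalues are orthogonal. The pair `k`, `-k` shares
its eigenvalue and is separated by one integration by parts of `cas ℓ k` against its own derivative.
On the diagonal, reflection gives `k` and `-k` the same norm, and their squares add up to `2`. -/
lemma coef_cas {ℓ : ℝ} (hℓ : 0 < ℓ) (j k : ℤ) :
    coef ℓ (cas ℓ j) k = if j = k then 1 else 0 := by
  have hsymm : ∀ i m, coef ℓ (cas ℓ i) m = coef ℓ (cas ℓ m) i := fun i m => by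
    unfold coef; simp only [mul_comm]
  have hself : ∀ m, coef ℓ (cas ℓ m) m = 1 := fun m => by
    have hrefl : coef ℓ (cas ℓ (-m)) (-m) = coef ℓ (cas ℓ m) m := by
      unfold coef
      congr 1
      have h := intervalIntegral.integral_comp_neg (fun x => cas ℓ m x * cas ℓ m x)
        (a := -(ℓ / 2)) (b := ℓ / 2)
      rw [neg_neg] at h
      rw [← h]
      simp [cas, freq_neg]
    have hsum : coef ℓ (cas ℓ m) m + coef ℓ (cas ℓ (-m)) (-m) = 2 := by
      unfold coef
      rw [← mul_add, ← intervalIntegral.integral_add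
        (Continuous.intervalIntegrable (by fun_prop) _ _)
        (Continuous.intervalIntegrable (by fun_prop) _ _)]
      have : ∀ x, cas ℓ m x * cas ℓ m x + cas ℓ (-m) x * cas ℓ (-m) x = 2 := fun x => by
        nlinarith [cas_sq_add ℓ m x]
      simp only [this, intervalIntegral.integral_const, smul_eq_mul]
      field_simp
      ring
    linarith
  split_ifs with h
  · rw [h, hself]
  · have h1 := coef_deriv_deriv hℓ (f := cas ℓ j)
      (fun η _ => (hasDerivAt_cas ℓ j η).hasDerivWithinAt)
      (fun η _ => (hasDerivAt_cas_neg ℓ j η).hasDerivWithinAt)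
      (by fun_prop) (cas_endpoints hℓ j) (by simp only [cas_endpoints hℓ]) k
    have h2 : coef ℓ (fun η => -(lam ℓ j * cas ℓ j η)) k = -(lam ℓ j * coef ℓ (cas ℓ j) k) := by
      simpa using coef_const_mul ℓ (-lam ℓ j) (cas ℓ j) k
    rw [h2] at h1
    by_cases hj : j = -k
    · subst hj
      have hk : k ≠ 0 := fun h0 => h (by simp [h0])
      have h3 := coef_deriv hℓ (f := cas ℓ k)
        (fun η _ => (hasDerivAt_cas ℓ k η).hasDerivWithinAt) (by fun_prop)
        (cas_endpoints hℓ k) k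
      rw [coef_const_mul, hsymm k (-k)] at h3
      have h4 : freq ℓ k ≠ 0 := by
        have := (lam_pos hℓ hk).ne'
        intro h0; simp [lam, h0] at this
      have : freq ℓ k * coef ℓ (cas ℓ (-k)) k = 0 := by linarith
      exact (mul_eq_zero.1 this).resolve_left h4
    · have hne : lam ℓ j ≠ lam ℓ k := by
        unfold lam
        intro h0
        have hc : 2 * Real.pi / ℓ ≠ 0 := by have := Real.pi_pos; positivity
        rcases sq_eq_sq_iff_eq_or_eq_neg.1 h0 with h5 | h5
        · exact h (by exact_mod_cast mul_left_cancel₀ hc h5)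
        · rw [← freq_neg] at h5
          exact hj (by exact_mod_cast mul_left_cancel₀ hc h5)
      have : (lam ℓ j - lam ℓ k) * coef ℓ (cas ℓ j) k = 0 := by linarith
      exact (mul_eq_zero.1 this).resolve_left (sub_ne_zero.2 hne)

/-! ### Absolutely convergent Hartley series -/

/-- The Hartley series with coefficients `a`. -/
noncomputable def casSum (ℓ : ℝ) (a : ℤ → ℝ) (η : ℝ) : ℝ := ∑' k, a k * cas ℓ k η

lemma abs_mul_cas_le (ℓ : ℝ) (a : ℤ → ℝ) (k : ℤ) (η : ℝ) : |a k * cas ℓ k η| ≤ 2 * |a k| := by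
  rw [abs_mul, mul_comm 2]
  exact mul_le_mul_of_nonneg_left (abs_cas_le ℓ k η) (abs_nonneg _)

lemma hasSum_casSum (ℓ : ℝ) {a : ℤ → ℝ} (ha : Summable fun k => |a k|) (η : ℝ) :
    HasSum (fun k => a k * cas ℓ k η) (casSum ℓ a η) :=
  (Summable.of_norm_bounded (ha.mul_left 2) fun k => abs_mul_cas_le ℓ a k η).hasSum

lemma continuous_casSum (ℓ : ℝ) {a : ℤ → ℝ} (ha : Summable fun k => |a k|) :
    Continuous (casSum ℓ a) :=
  continuous_tsum (fun k => by fun_prop) (ha.mul_left 2) fun k η => abs_mul_cas_le ℓ a k η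

lemma coef_casSum {ℓ : ℝ} (hℓ : 0 < ℓ) {a : ℤ → ℝ} (ha : Summable fun k => |a k|) (k : ℤ) :
    coef ℓ (casSum ℓ a) k = a k := by
  have h := intervalIntegral.hasSum_integral_of_dominated_convergence (μ := volume)
    (a := -(ℓ / 2)) (b := ℓ / 2) (F := fun j η => a j * cas ℓ j η * cas ℓ k η)
    (f := fun η => casSum ℓ a η * cas ℓ k η)
    (fun j _ => 4 * |a j|) (fun j => Continuous.aestronglyMeasurable (by fun_prop))
    (fun j => ae_of_all _ fun η _ => by
      rw [Real.norm_eq_abs, abs_mul]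
      nlinarith [abs_mul_cas_le ℓ a j η, abs_cas_le ℓ k η, abs_nonneg (a j * cas ℓ j η),
        abs_nonneg (cas ℓ k η), abs_nonneg (a j)])
    (ae_of_all _ fun η _ => ha.mul_left 4)
    (by simp)
    (ae_of_all _ fun η _ => (hasSum_casSum ℓ ha η).mul_right _)
  have h2 := h.mul_left ℓ⁻¹
  have h3 : ∀ j, ℓ⁻¹ * ∫ η in (-(ℓ / 2))..(ℓ / 2), a j * cas ℓ j η * cas ℓ k η
      = if j = k then a k else 0 := fun j => by
    have := coef_const_mul ℓ (a j) (cas ℓ j) k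
    rw [coef_cas hℓ] at this
    unfold coef at this
    rw [this]
    split_ifs with hjk
    · rw [hjk, mul_one]
    · rw [mul_zero]
  simp only [h3] at h2
  exact h2.unique (hasSum_ite_eq k (a k))

/-- A continuous function with absolutely summable coefficients is the sum of its series. -/
lemma eq_casSum_coef {ℓ : ℝ} (hℓ : 0 < ℓ) {f : ℝ → ℝ} (hf : ContinuousOn f (cell ℓ))
    (hs : Summable fun k => |coef ℓ f k|) : EqOn f (casSum ℓ (coef ℓ f)) (cell ℓ) := by
  intro η hη
  have hc := (continuous_casSum ℓ hs).continuousOn (s := cell ℓ)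
  have := eq_zero_of_coef_eq_zero hℓ (hf.sub hc) (fun k => by
    have := coef_sub hℓ hf hc k
    rw [coef_casSum hℓ hs, sub_self] at this
    exact this) η hη
  simpa [sub_eq_zero] using this

/-- The frequency satisfies `|freq| ≤ 1 + lam`, so the two summability hypotheses already dominate
the termwise derivative. -/
lemma hasDerivAt_casSum {ℓ : ℝ} {a : ℤ → ℝ}
    (ha : Summable fun k => |a k|) (ha' : Summable fun k => |lam ℓ k * a k|) (η : ℝ) :
    HasDerivAt (casSum ℓ a) (∑' k, a k * (freq ℓ k * cas ℓ (-k) η)) η := by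
  have hs := (ha.add ha').mul_left 2
  refine hasDerivAt_tsum (g := fun k η => a k * cas ℓ k η)
    (g' := fun k η => a k * (freq ℓ k * cas ℓ (-k) η)) hs
    (fun k y => (hasDerivAt_cas ℓ k y).const_mul (a k)) (fun k y => ?_)
    (y₀ := 0) (hasSum_casSum ℓ ha 0).summable η
  rw [Real.norm_eq_abs, abs_mul, abs_mul, abs_mul (lam ℓ k), abs_of_nonneg (lam_nonneg ℓ k)]
  have h1 := abs_freq_le ℓ k
  have h2 := abs_cas_le ℓ (-k) y
  have h3 : |freq ℓ k| * |cas ℓ (-k) y| ≤ (1 + lam ℓ k) * 2 :=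
    mul_le_mul h1 h2 (abs_nonneg _) (by have := lam_nonneg ℓ k; linarith)
  nlinarith [mul_le_mul_of_nonneg_left h3 (abs_nonneg (a k))]

lemma hasDerivAt_casSum_deriv {ℓ : ℝ} {a : ℤ → ℝ}
    (ha : Summable fun k => |a k|) (ha' : Summable fun k => |lam ℓ k * a k|) (η : ℝ) :
    HasDerivAt (fun η => ∑' k, a k * (freq ℓ k * cas ℓ (-k) η))
      (casSum ℓ (fun k => -(lam ℓ k * a k)) η) η := by
  have h0 : Summable fun k => a k * (freq ℓ k * cas ℓ (-k) 0) := by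
    refine Summable.of_norm_bounded ((ha.add ha').mul_left 2) fun k => ?_
    rw [Real.norm_eq_abs, abs_mul, abs_mul, abs_mul (lam ℓ k), abs_of_nonneg (lam_nonneg ℓ k)]
    have h3 : |freq ℓ k| * |cas ℓ (-k) 0| ≤ (1 + lam ℓ k) * 2 :=
      mul_le_mul (abs_freq_le ℓ k) (abs_cas_le ℓ (-k) 0) (abs_nonneg _)
        (by have := lam_nonneg ℓ k; linarith)
    nlinarith [mul_le_mul_of_nonneg_left h3 (abs_nonneg (a k))]
  refine hasDerivAt_tsum (g := fun k η => a k * (freq ℓ k * cas ℓ (-k) η))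
    (g' := fun k η => -(lam ℓ k * a k) * cas ℓ k η) (ha'.mul_left 2)
    (fun k y => ?_) (fun k y => ?_) (y₀ := 0) h0 η
  · have e : -(lam ℓ k * a k) * cas ℓ k y = a k * -(lam ℓ k * cas ℓ k y) := by ring
    rw [e]
    exact (hasDerivAt_cas_neg ℓ k y).const_mul (a k)
  · simpa using abs_mul_cas_le ℓ (fun k => -(lam ℓ k * a k)) k y

/-! ### Derivatives on the cell -/

lemma dEta_zero (ℓ : ℝ) (φ : ℝ → ℝ) : dEta ℓ 0 φ = φ := iteratedDerivWithin_zero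

lemma dEta_congr {ℓ : ℝ} {φ ψ : ℝ → ℝ} (h : EqOn φ ψ (cell ℓ)) (j : ℕ) :
    EqOn (dEta ℓ j φ) (dEta ℓ j ψ) (cell ℓ) := fun _ hη => iteratedDerivWithin_congr h hη

lemma hasDerivWithinAt_dEta {ℓ : ℝ} (hℓ : 0 < ℓ) {n j : ℕ} {φ : ℝ → ℝ}
    (hφ : ContDiffOn ℝ n φ (cell ℓ)) (hj : j < n) :
    ∀ η ∈ cell ℓ, HasDerivWithinAt (dEta ℓ j φ) (dEta ℓ (j + 1) φ η) (cell ℓ) η := by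
  intro η hη
  have h := (hφ.differentiableOn_iteratedDerivWithin (by exact_mod_cast hj)
    (uniqueDiffOn_cell hℓ)) η hη
  have h2 := h.hasDerivWithinAt
  rwa [← iteratedDerivWithin_succ] at h2

lemma continuousOn_dEta {ℓ : ℝ} (hℓ : 0 < ℓ) {n j : ℕ} {φ : ℝ → ℝ}
    (hφ : ContDiffOn ℝ n φ (cell ℓ)) (hj : j ≤ n) : ContinuousOn (dEta ℓ j φ) (cell ℓ) :=
  hφ.continuousOn_iteratedDerivWithin (by exact_mod_cast hj) (uniqueDiffOn_cell hℓ)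

lemma dEta_one_eq {ℓ : ℝ} (hℓ : 0 < ℓ) {φ φ' : ℝ → ℝ}
    (h : ∀ η ∈ cell ℓ, HasDerivWithinAt φ (φ' η) (cell ℓ) η) : EqOn (dEta ℓ 1 φ) φ' (cell ℓ) := by
  intro η hη
  unfold dEta
  rw [iteratedDerivWithin_one]
  exact (h η hη).derivWithin (uniqueDiffOn_cell hℓ η hη)

lemma dEta_two_eq {ℓ : ℝ} (hℓ : 0 < ℓ) {φ φ' φ'' : ℝ → ℝ}
    (h : ∀ η ∈ cell ℓ, HasDerivWithinAt φ (φ' η) (cell ℓ) η)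
    (h' : ∀ η ∈ cell ℓ, HasDerivWithinAt φ' (φ'' η) (cell ℓ) η) :
    EqOn (dEta ℓ 2 φ) φ'' (cell ℓ) := by
  intro η hη
  have h1 := dEta_one_eq hℓ h
  unfold dEta at h1 ⊢
  rw [iteratedDerivWithin_succ, derivWithin_congr h1 (h1 hη)]
  exact (h' η hη).derivWithin (uniqueDiffOn_cell hℓ η hη)

lemma dEta_two_casSum {ℓ : ℝ} (hℓ : 0 < ℓ) {a : ℤ → ℝ}
    (ha : Summable fun k => |a k|) (ha' : Summable fun k => |lam ℓ k * a k|) :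
    EqOn (dEta ℓ 2 (casSum ℓ a)) (casSum ℓ fun k => -(lam ℓ k * a k)) (cell ℓ) :=
  dEta_two_eq hℓ (fun η _ => (hasDerivAt_casSum ha ha' η).hasDerivWithinAt)
    (fun η _ => (hasDerivAt_casSum_deriv ha ha' η).hasDerivWithinAt)

/-- Coefficients decaying like those of a function with one square integrable derivative are
absolutely summable. -/
lemma summable_abs_of_lam_sq {ℓ : ℝ} (hℓ : 0 < ℓ) {a : ℤ → ℝ}
    (h : Summable fun k => lam ℓ k * a k ^ 2) : Summable fun k => |a k| := by
  refine Summable.of_nonneg_of_le (fun k => abs_nonneg _) (fun k => ?_)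
    ((h.add (summable_inv_lam (ℓ := ℓ))).add (hasSum_ite_eq (0 : ℤ) |a 0|).summable)
  split_ifs with hk
  · subst hk; simp [lam_zero]
  · have hl := lam_pos hℓ hk
    have h1 : lam ℓ k * (lam ℓ k)⁻¹ = 1 := mul_inv_cancel₀ hl.ne'
    have h2 : 0 < (lam ℓ k)⁻¹ := inv_pos.2 hl
    rw [add_zero, ← sq_abs (a k)]
    -- Weighted arithmetic–geometric mean: `2 |a| ≤ λ a² + λ⁻¹`. The second series converges since
    -- `λ` grows quadratically in the index.
    nlinarith [mul_nonneg h2.le (sq_nonneg (lam ℓ k * |a k| - 1)), abs_nonneg (a k),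
      mul_nonneg hl.le (sq_nonneg |a k|)]

/-! ### Integrals of exponentially decaying functions on half lines -/

lemma integrableOn_exp_mul_Iic_zero {r : ℝ} (hr : 0 < r) :
    IntegrableOn (fun x => Real.exp (r * x)) (Iic 0) := integrableOn_exp_mul_Iic hr 0

lemma integrableOn_exp_neg_mul_Ioi_zero {r : ℝ} (hr : 0 < r) :
    IntegrableOn (fun x => Real.exp (-(r * x))) (Ioi 0) := by
  simpa only [neg_mul] using integrableOn_exp_mul_Ioi (neg_lt_zero.2 hr) 0

lemma tendsto_exp_mul_atBot {r : ℝ} (hr : 0 < r) (K : ℝ) :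
    Filter.Tendsto (fun x => K * Real.exp (r * x)) Filter.atBot (nhds 0) := by
  simpa using (Real.tendsto_exp_atBot.comp
    (Filter.tendsto_id.const_mul_atBot hr)).const_mul K

lemma tendsto_exp_neg_mul_atTop {r : ℝ} (hr : 0 < r) (K : ℝ) :
    Filter.Tendsto (fun x => K * Real.exp (-(r * x))) Filter.atTop (nhds 0) := by
  simpa using (Real.tendsto_exp_neg_atTop_nhds_zero.comp
    (Filter.tendsto_id.const_mul_atTop hr)).const_mul K

lemma integrableOn_Iic_of_exp_bound {r K : ℝ} (hr : 0 < r) {f : ℝ → ℝ}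
    (hf : ContinuousOn f (Iic 0)) (bf : ∀ x ≤ 0, |f x| ≤ K * Real.exp (r * x)) :
    IntegrableOn f (Iic 0) :=
  Integrable.mono' ((integrableOn_exp_mul_Iic_zero hr).const_mul K)
    (hf.aestronglyMeasurable measurableSet_Iic) (ae_restrict_of_forall_mem measurableSet_Iic bf)

lemma integrableOn_Ioi_of_exp_bound {r K : ℝ} (hr : 0 < r) {f : ℝ → ℝ}
    (hf : ContinuousOn f (Ici 0)) (bf : ∀ x ≥ 0, |f x| ≤ K * Real.exp (-(r * x))) :
    IntegrableOn f (Ioi 0) :=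
  Integrable.mono' ((integrableOn_exp_neg_mul_Ioi_zero hr).const_mul K)
    ((hf.mono Ioi_subset_Ici_self).aestronglyMeasurable measurableSet_Ioi)
    (ae_restrict_of_forall_mem measurableSet_Ioi fun x hx => bf x (le_of_lt hx))

lemma integral_Iic_of_exp_bound {r K : ℝ} (hr : 0 < r) {F f : ℝ → ℝ}
    (hF : ∀ x < 0, HasDerivAt F (f x) x) (hF0 : ContinuousWithinAt F (Iic 0) 0)
    (hf : ContinuousOn f (Iic 0)) (bF : ∀ x ≤ 0, |F x| ≤ K * Real.exp (r * x))
    (bf : ∀ x ≤ 0, |f x| ≤ K * Real.exp (r * x)) : ∫ x in Iic 0, f x = F 0 := by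
  have hlim : Filter.Tendsto F Filter.atBot (nhds 0) :=
    squeeze_zero_norm' (by filter_upwards [Filter.eventually_le_atBot 0] with x hx using bF x hx)
      (tendsto_exp_mul_atBot hr K)
  have h := integral_Iic_of_hasDerivAt_of_tendsto hF0 (fun x hx => hF x hx)
    (integrableOn_Iic_of_exp_bound hr hf bf) hlim
  rw [h, sub_zero]

lemma integral_Ioi_of_exp_bound {r K : ℝ} (hr : 0 < r) {F f : ℝ → ℝ}
    (hF : ∀ x > 0, HasDerivAt F (f x) x) (hF0 : ContinuousWithinAt F (Ici 0) 0)
    (hf : ContinuousOn f (Ici 0)) (bF : ∀ x ≥ 0, |F x| ≤ K * Real.exp (-(r * x)))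
    (bf : ∀ x ≥ 0, |f x| ≤ K * Real.exp (-(r * x))) : ∫ x in Ioi 0, f x = -F 0 := by
  have hlim : Filter.Tendsto F Filter.atTop (nhds 0) :=
    squeeze_zero_norm' (by filter_upwards [Filter.eventually_ge_atTop 0] with x hx using bF x hx)
      (tendsto_exp_neg_mul_atTop hr K)
  have h := integral_Ioi_of_hasDerivAt_of_tendsto hF0 (fun x hx => hF x hx)
    (integrableOn_Ioi_of_exp_bound hr hf bf) hlim
  rw [h, zero_sub]

/-! ### The resolvent equation for a single mode in `η` -/

/-- `u` is the solution, of size at most `K`, of the equation `L u - p u = -h` on the line in the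
kernel of `Q`. -/
structure IsMode (p K : ℝ) (h u : LineFun) : Prop where
  smooth₁ : ContDiff ℝ 2 u.1
  smooth₂ : ContDiff ℝ 2 u.2
  eq₁ : ∀ x ≤ 0, iteratedDeriv 2 u.1 x - iteratedDeriv 1 u.1 x + Real.exp x * u.1 0
    = p * u.1 x - h.1 x
  eq₂ : ∀ x ≥ 0, iteratedDeriv 2 u.2 x - iteratedDeriv 1 u.2 x = p * u.2 x - h.2 x
  interface₀ : u.1 0 = u.2 0
  interface₁ : iteratedDeriv 1 u.1 0 = iteratedDeriv 1 u.2 0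
  integral : (∫ x in Iic (0 : ℝ), u.1 x) + ∫ x in Ioi (0 : ℝ), Real.exp (-x) * u.2 x = 0
  bound₁ : ∀ x ≤ 0, |u.1 x| ≤ K * Real.exp (x / 2)
  bound₂ : ∀ x ≥ 0, |u.2 x| ≤ K * Real.exp (x / 2)

lemma IsMode.mono {p K K' : ℝ} {h u : LineFun} (hu : IsMode p K h u) (hK : K ≤ K') :
    IsMode p K' h u :=
  { hu with
    bound₁ := fun x hx => (hu.bound₁ x hx).trans (by gcongr)
    bound₂ := fun x hx => (hu.bound₂ x hx).trans (by gcongr) }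

/-- The exponential series gives `(x/2)^n / n! ≤ e^{x/2}`. The constant `48 = 2³ · 3!` is the worst
of the cases `n ≤ 3`. -/
lemma poly_exp_bound {x : ℝ} (hx : 0 ≤ x) (c₀ c₁ c₂ c₃ : ℝ) :
    |c₀ + c₁ * x + c₂ * x ^ 2 + c₃ * x ^ 3|
      ≤ 48 * (|c₀| + |c₁| + |c₂| + |c₃|) * Real.exp (x / 2) := by
  have h0 : 1 ≤ Real.exp (x / 2) := Real.one_le_exp (by linarith)
  have h1 := Real.pow_div_factorial_le_exp (x / 2) (by linarith) 1
  have h2 := Real.pow_div_factorial_le_exp (x / 2) (by linarith) 2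
  have h3 := Real.pow_div_factorial_le_exp (x / 2) (by linarith) 3
  norm_num [Nat.factorial, div_pow] at h1 h2 h3
  set e := Real.exp (x / 2)
  have t : |c₀ + c₁ * x + c₂ * x ^ 2 + c₃ * x ^ 3|
      ≤ |c₀| + |c₁| * x + |c₂| * x ^ 2 + |c₃| * x ^ 3 := by
    refine (abs_add_le _ _).trans (add_le_add ((abs_add_le _ _).trans (add_le_add
      ((abs_add_le _ _).trans (add_le_add le_rfl ?_)) ?_)) ?_)
    · rw [abs_mul, abs_of_nonneg hx]
    · rw [abs_mul, abs_of_nonneg (pow_nonneg hx 2)]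
    · rw [abs_mul, abs_of_nonneg (pow_nonneg hx 3)]
  have e0 := mul_le_mul_of_nonneg_left h0 (abs_nonneg c₀)
  have e1 : |c₁| * x ≤ |c₁| * (48 * e) :=
    mul_le_mul_of_nonneg_left (by linarith) (abs_nonneg c₁)
  have e2 : |c₂| * x ^ 2 ≤ |c₂| * (48 * e) :=
    mul_le_mul_of_nonneg_left (by linarith) (abs_nonneg c₂)
  have e3 : |c₃| * x ^ 3 ≤ |c₃| * (48 * e) :=
    mul_le_mul_of_nonneg_left (by linarith) (abs_nonneg c₃)
  nlinarith [abs_nonneg c₀, mul_nonneg (abs_nonneg c₀) (by linarith : 0 ≤ e)]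

lemma poly_exp_bound_neg {x : ℝ} (hx : x ≤ 0) (c₀ c₁ c₂ c₃ : ℝ) :
    |(c₀ + c₁ * x + c₂ * x ^ 2 + c₃ * x ^ 3) * Real.exp x|
      ≤ 48 * (|c₀| + |c₁| + |c₂| + |c₃|) * Real.exp (x / 2) := by
  have h := poly_exp_bound (x := -x) (by linarith) c₀ (-c₁) c₂ (-c₃)
  have e1 : c₀ + -c₁ * -x + c₂ * (-x) ^ 2 + -c₃ * (-x) ^ 3
      = c₀ + c₁ * x + c₂ * x ^ 2 + c₃ * x ^ 3 := by ring
  rw [e1, abs_neg, abs_neg] at h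
  rw [abs_mul, abs_of_pos (Real.exp_pos x)]
  have e2 : Real.exp (-x / 2) * Real.exp x = Real.exp (x / 2) := by
    rw [← Real.exp_add]; congr 1; ring
  calc _ ≤ _ := mul_le_mul_of_nonneg_right h (Real.exp_pos x).le
    _ = _ := by rw [mul_assoc, e2]

/-! ### Explicit solutions of the mode equation -/

/-- Polynomials times exponentials, left of the interface. -/
noncomputable def modeL (c₀ c₁ c₂ c₃ C s x : ℝ) : ℝ :=
  (c₀ + c₁ * x + c₂ * x ^ 2 + c₃ * x ^ 3) * Real.exp x + C * Real.exp (s * x)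

/-- Polynomials and exponentials, right of the interface. -/
noncomputable def modeR (d₀ d₁ d₂ E s x : ℝ) : ℝ :=
  d₀ + d₁ * x + d₂ * x ^ 2 + E * Real.exp ((1 - s) * x)

lemma hasDerivAt_modeL (c₀ c₁ c₂ c₃ C s x : ℝ) :
    HasDerivAt (modeL c₀ c₁ c₂ c₃ C s)
      (modeL (c₀ + c₁) (c₁ + 2 * c₂) (c₂ + 3 * c₃) c₃ (s * C) s x) x := by
  have h1 : HasDerivAt (fun x : ℝ => c₀ + c₁ * x + c₂ * x ^ 2 + c₃ * x ^ 3)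
      (c₁ + 2 * c₂ * x + 3 * c₃ * x ^ 2) x := by
    have := (((hasDerivAt_id x).const_mul c₁).const_add c₀).add
      (((hasDerivAt_pow 2 x).const_mul c₂)) |>.add ((hasDerivAt_pow 3 x).const_mul c₃)
    exact this.congr_deriv (by simp; ring)
  have h2 : HasDerivAt (fun x : ℝ => Real.exp (s * x)) (Real.exp (s * x) * s) x := by
    have : HasDerivAt (fun x : ℝ => s * x) s x := by simpa using (hasDerivAt_id x).const_mul s
    exact this.exp
  have h := (h1.mul (Real.hasDerivAt_exp x)).add (h2.const_mul C)
  exact h.congr_deriv (by unfold modeL; ring)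

lemma hasDerivAt_modeR (d₀ d₁ d₂ E s x : ℝ) :
    HasDerivAt (modeR d₀ d₁ d₂ E s) (modeR d₁ (2 * d₂) 0 ((1 - s) * E) s x) x := by
  have h1 : HasDerivAt (fun x : ℝ => d₀ + d₁ * x + d₂ * x ^ 2) (d₁ + 2 * d₂ * x) x := by
    have := (((hasDerivAt_id x).const_mul d₁).const_add d₀).add
      (((hasDerivAt_pow 2 x).const_mul d₂))
    exact this.congr_deriv (by simp; ring)
  have h2 : HasDerivAt (fun x : ℝ => Real.exp ((1 - s) * x)) (Real.exp ((1 - s) * x) * (1 - s)) x := by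
    have : HasDerivAt (fun x : ℝ => (1 - s) * x) (1 - s) x := by
      simpa using (hasDerivAt_id x).const_mul (1 - s)
    exact this.exp
  have h := h1.add (h2.const_mul E)
  exact h.congr_deriv (by unfold modeR; ring)

lemma contDiff_modeL (c₀ c₁ c₂ c₃ C s : ℝ) (n : WithTop ℕ∞) :
    ContDiff ℝ n (modeL c₀ c₁ c₂ c₃ C s) := by unfold modeL; fun_prop

lemma contDiff_modeR (d₀ d₁ d₂ E s : ℝ) (n : WithTop ℕ∞) :
    ContDiff ℝ n (modeR d₀ d₁ d₂ E s) := by unfold modeR; fun_prop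

lemma iteratedDeriv_one_modeL (c₀ c₁ c₂ c₃ C s : ℝ) :
    iteratedDeriv 1 (modeL c₀ c₁ c₂ c₃ C s)
      = modeL (c₀ + c₁) (c₁ + 2 * c₂) (c₂ + 3 * c₃) c₃ (s * C) s := by
  rw [iteratedDeriv_one]; ext x; exact (hasDerivAt_modeL ..).deriv

lemma iteratedDeriv_two_modeL (c₀ c₁ c₂ c₃ C s : ℝ) :
    iteratedDeriv 2 (modeL c₀ c₁ c₂ c₃ C s)
      = modeL (c₀ + c₁ + (c₁ + 2 * c₂)) (c₁ + 2 * c₂ + 2 * (c₂ + 3 * c₃)) (c₂ + 3 * c₃ + 3 * c₃) c₃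
        (s * (s * C)) s := by
  rw [iteratedDeriv_succ, iteratedDeriv_one_modeL]; ext x; exact (hasDerivAt_modeL ..).deriv

lemma iteratedDeriv_one_modeR (d₀ d₁ d₂ E s : ℝ) :
    iteratedDeriv 1 (modeR d₀ d₁ d₂ E s) = modeR d₁ (2 * d₂) 0 ((1 - s) * E) s := by
  rw [iteratedDeriv_one]; ext x; exact (hasDerivAt_modeR ..).deriv

lemma iteratedDeriv_two_modeR (d₀ d₁ d₂ E s : ℝ) :
    iteratedDeriv 2 (modeR d₀ d₁ d₂ E s)
      = modeR (2 * d₂) (2 * 0) 0 ((1 - s) * ((1 - s) * E)) s := by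
  rw [iteratedDeriv_succ, iteratedDeriv_one_modeR]; ext x; exact (hasDerivAt_modeR ..).deriv

lemma abs_modeL_le {s : ℝ} (hs : 1 ≤ s) (c₀ c₁ c₂ c₃ C : ℝ) {x : ℝ} (hx : x ≤ 0) :
    |modeL c₀ c₁ c₂ c₃ C s x| ≤ 48 * (|c₀| + |c₁| + |c₂| + |c₃| + |C|) * Real.exp (x / 2) := by
  unfold modeL
  refine (abs_add_le _ _).trans ?_
  have h1 := poly_exp_bound_neg hx c₀ c₁ c₂ c₃
  have h2 : Real.exp (s * x) ≤ Real.exp (x / 2) := Real.exp_le_exp.2 (by nlinarith)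
  rw [abs_mul C, abs_of_pos (Real.exp_pos _)]
  nlinarith [mul_le_mul_of_nonneg_left h2 (abs_nonneg C), Real.exp_pos (x / 2),
    mul_nonneg (abs_nonneg C) (Real.exp_pos (x / 2)).le]

lemma abs_modeR_le {s : ℝ} (hs : 1 ≤ s) (d₀ d₁ d₂ E : ℝ) {x : ℝ} (hx : 0 ≤ x) :
    |modeR d₀ d₁ d₂ E s x| ≤ 48 * (|d₀| + |d₁| + |d₂| + |E|) * Real.exp (x / 2) := by
  unfold modeR
  refine (abs_add_le _ _).trans ?_
  have h1 := poly_exp_bound hx d₀ d₁ d₂ 0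
  simp only [zero_mul, add_zero, abs_zero] at h1
  have h2 : Real.exp ((1 - s) * x) ≤ Real.exp (x / 2) := Real.exp_le_exp.2 (by nlinarith)
  rw [abs_mul E, abs_of_pos (Real.exp_pos _)]
  nlinarith [mul_le_mul_of_nonneg_left h2 (abs_nonneg E), Real.exp_pos (x / 2),
    mul_nonneg (abs_nonneg E) (Real.exp_pos (x / 2)).le]

lemma integral_modeL {s : ℝ} (hs : 1 ≤ s) (c₀ c₁ c₂ c₃ C : ℝ) :
    ∫ x in Iic (0 : ℝ), modeL c₀ c₁ c₂ c₃ C s x = c₀ - c₁ + 2 * c₂ - 6 * c₃ + C / s := by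
  have hs0 : s ≠ 0 := by linarith
  -- The family `modeL` is closed under antidifferentiation; these are the coefficients of the
  -- primitive decaying at `-∞`, found from the highest power downwards.
  set b₀ := c₀ - c₁ + 2 * c₂ - 6 * c₃
  set b₁ := c₁ - 2 * c₂ + 6 * c₃
  set b₂ := c₂ - 3 * c₃
  set K := 48 * (|b₀| + |b₁| + |b₂| + |c₃| + |C / s|) + 48 * (|c₀| + |c₁| + |c₂| + |c₃| + |C|)
  have key : ∀ x, HasDerivAt (modeL b₀ b₁ b₂ c₃ (C / s) s) (modeL c₀ c₁ c₂ c₃ C s x) x := by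
    intro x
    refine (hasDerivAt_modeL b₀ b₁ b₂ c₃ (C / s) s x).congr_deriv ?_
    unfold modeL
    rw [mul_div_cancel₀ _ hs0]
    simp only [b₀, b₁, b₂]; ring
  have h := integral_Iic_of_exp_bound (r := 1 / 2) (K := K) (by norm_num)
    (F := modeL b₀ b₁ b₂ c₃ (C / s) s) (f := modeL c₀ c₁ c₂ c₃ C s)
    (fun x _ => key x) (contDiff_modeL _ _ _ _ _ _ 0).continuous.continuousWithinAt
    (contDiff_modeL _ _ _ _ _ _ 0).continuous.continuousOn
    (fun x hx => by
      have := abs_modeL_le hs b₀ b₁ b₂ c₃ (C / s) hx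
      rw [one_div_mul_eq_div]
      refine this.trans (mul_le_mul_of_nonneg_right ?_ (Real.exp_pos _).le)
      have : 0 ≤ 48 * (|c₀| + |c₁| + |c₂| + |c₃| + |C|) := by positivity
      linarith)
    (fun x hx => by
      have := abs_modeL_le hs c₀ c₁ c₂ c₃ C hx
      rw [one_div_mul_eq_div]
      refine this.trans (mul_le_mul_of_nonneg_right ?_ (Real.exp_pos _).le)
      have : 0 ≤ 48 * (|b₀| + |b₁| + |b₂| + |c₃| + |C / s|) := by positivity
      linarith)
  rw [h]; simp [modeL]

lemma integral_modeR {s : ℝ} (hs : 1 ≤ s) (d₀ d₁ d₂ E : ℝ) :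
    ∫ x in Ioi (0 : ℝ), Real.exp (-x) * modeR d₀ d₁ d₂ E s x = d₀ + d₁ + 2 * d₂ + E / s := by
  have hs0 : s ≠ 0 := by linarith
  -- The weight `e^{-x}` and the reflection `x ↦ -x` turn `modeR` into `modeL`, so the integral on
  -- the left half line can be reused.
  have e : ∀ x, ∀ a b c d : ℝ, Real.exp (-x) * modeR a b c d s x
      = (fun y => modeL a (-b) c 0 d s y) (-x) := by
    intro x a b c d
    simp only [modeL, modeR]
    have : Real.exp (s * -x) = Real.exp (-x) * Real.exp ((1 - s) * x) := by
      rw [← Real.exp_add]; congr 1; ring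
    rw [this]; ring
  simp only [e]
  have h := integral_comp_neg_Ioi (0 : ℝ) (fun y => modeL d₀ (-d₁) d₂ 0 E s y)
  rw [neg_zero] at h
  rw [h, integral_modeL hs]
  ring

/-- The exponentials `e^{sx}` and `e^{(1-s)x}` solve the homogeneous equation `u'' - u' = p u` and
are the ones compatible with the weight on their half line. What remains is a comparison of the
coefficients of `x^j e^x` on the left (`e₀`–`e₃`) and of `x^j` on the right (`f₀`–`f₂`), two
matching conditions at the interface, and the vanishing of `Q`. -/
lemma isMode_of_coefficients {p s c₀ c₁ c₂ c₃ C d₀ d₁ d₂ E h₀ h₁ h₂ g₀ g₁ : ℝ} {h : LineFun}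
    (hs : 1 ≤ s) (hp : p = s * (s - 1))
    (hh₁ : ∀ x, h.1 x = (h₀ + h₁ * x + h₂ * x ^ 2) * Real.exp x)
    (hh₂ : ∀ x, h.2 x = g₀ + g₁ * x)
    (e₀ : 2 * c₂ + c₁ - p * c₀ + (c₀ + C) + h₀ = 0) (e₁ : 6 * c₃ + 2 * c₂ - p * c₁ + h₁ = 0)
    (e₂ : 3 * c₃ - p * c₂ + h₂ = 0) (e₃ : p * c₃ = 0)
    (f₀ : 2 * d₂ - d₁ - p * d₀ + g₀ = 0) (f₁ : -2 * d₂ - p * d₁ + g₁ = 0) (f₂ : p * d₂ = 0)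
    (i₀ : c₀ + C = d₀ + E) (i₁ : c₀ + c₁ + s * C = d₁ + (1 - s) * E)
    (q : c₀ - c₁ + 2 * c₂ - 6 * c₃ + C / s + (d₀ + d₁ + 2 * d₂ + E / s) = 0) :
    IsMode p (48 * (|c₀| + |c₁| + |c₂| + |c₃| + |C| + (|d₀| + |d₁| + |d₂| + |E|))) h
      (modeL c₀ c₁ c₂ c₃ C s, modeR d₀ d₁ d₂ E s) where
  smooth₁ := contDiff_modeL ..
  smooth₂ := contDiff_modeR ..
  eq₁ x _ := by
    simp only [iteratedDeriv_one_modeL, iteratedDeriv_two_modeL, hh₁]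
    simp only [modeL, mul_zero, Real.exp_zero]
    subst hp
    linear_combination (Real.exp x) * e₀ + x * Real.exp x * e₁ + x ^ 2 * Real.exp x * e₂
      - x ^ 3 * Real.exp x * e₃
  eq₂ x _ := by
    simp only [iteratedDeriv_one_modeR, iteratedDeriv_two_modeR, hh₂]
    simp only [modeR]
    subst hp
    linear_combination f₀ + x * f₁ - x ^ 2 * f₂
  interface₀ := by simpa [modeL, modeR] using i₀
  interface₁ := by
    simp only [iteratedDeriv_one_modeL, iteratedDeriv_one_modeR]
    simpa [modeL, modeR] using i₁
  integral := by simp only [integral_modeL hs, integral_modeR hs, q]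
  bound₁ x hx := (abs_modeL_le hs c₀ c₁ c₂ c₃ C hx).trans (by
    refine mul_le_mul_of_nonneg_right ?_ (Real.exp_pos _).le
    have : 0 ≤ |d₀| + |d₁| + |d₂| + |E| := by positivity
    linarith)
  bound₂ x hx := (abs_modeR_le hs d₀ d₁ d₂ E hx).trans (by
    refine mul_le_mul_of_nonneg_right ?_ (Real.exp_pos _).le
    have : 0 ≤ |c₀| + |c₁| + |c₂| + |c₃| + |C| := by positivity
    linarith)

/-- The value at the interface of the solution for the right-hand side `φ a + χ b`, where
`p = s (s - 1)`. -/
noncomputable def traceSymbol (s φ χ : ℝ) : ℝ :=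
  φ / (3 * s * (2 * s + 1)) - χ * (8 * s + 3) / (9 * s ^ 2 * (2 * s + 1))

lemma abs_traceSymbol_le {s : ℝ} (hs : 1 ≤ s) (φ χ : ℝ) : |traceSymbol s φ χ| ≤ |φ| + |χ| := by
  unfold traceSymbol
  refine (abs_sub _ _).trans (add_le_add ?_ ?_)
  · rw [abs_div, abs_of_pos (a := 3 * s * (2 * s + 1)) (by nlinarith)]
    exact div_le_self (abs_nonneg _) (by nlinarith)
  · have h1 : 0 < 9 * s ^ 2 * (2 * s + 1) := by positivity
    rw [abs_div, abs_of_pos h1, abs_mul, abs_of_pos (a := 8 * s + 3) (by linarith), div_le_iff₀ h1]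
    have h2 : 8 * s + 3 ≤ 9 * s ^ 2 * (2 * s + 1) := by
      have := one_le_pow₀ hs (n := 2)
      nlinarith
    exact mul_le_mul_of_nonneg_left h2 (abs_nonneg χ)

/-- Here the trace symbol is computed. The constant `K` degenerates as `p₀ → 0`, hence as `ε → 0`;
it only serves the convergence of the series for a fixed `ε`, while bounds uniform in `ε` come from
the symbols. -/
lemma exists_isMode {p₀ : ℝ} (hp₀ : 0 < p₀) : ∃ K : ℝ, 0 ≤ K ∧ ∀ s : ℝ, 1 ≤ s →
    (s = 1 ∨ p₀ ≤ s * (s - 1)) → ∀ φ χ : ℝ, ∃ u : LineFun,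
      IsMode (s * (s - 1)) (K * (|φ| + |χ|)) (φ • vecA + χ • vecB) u ∧
        u.1 0 = traceSymbol s φ χ := by
  set R := 1 + 1 / p₀ with hR
  have hR1 : 1 ≤ R := by have : 0 < 1 / p₀ := by positivity
                         linarith
  refine ⟨48 * (100 * R ^ 3), by positivity, fun s hs hsp φ χ => ?_⟩
  have hs0 : 0 < s := by linarith
  set n := |φ| + |χ| with hn
  have hφ : |φ| ≤ n := by have := abs_nonneg χ; linarith
  have hχ : |χ| ≤ n := by have := abs_nonneg φ; linarith
  have hn0 : 0 ≤ n := by positivity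
  have hh₁ : ∀ x, (φ • vecA + χ • vecB).1 x
      = ((2 / 3 * φ - 4 / 9 * χ) + (1 / 3 * φ - 2 / 9 * χ) * x + χ / 6 * x ^ 2) * Real.exp x := by
    intro x; simp [vecA, vecB, funT, funT', funU, funV]; ring
  have hh₂ : ∀ x, (φ • vecA + χ • vecB).2 x = (-φ / 3 - 4 / 9 * χ) + χ / 3 * x := by
    intro x; simp [vecA, vecB, funT, funT', funU, funV]; ring
  have hu₀ := abs_traceSymbol_le hs φ χ
  rcases hsp with rfl | hp
  -- Zero frequency is resonant: `p = 0`, so the polynomials gain one degree and the free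
  -- exponentials coincide with terms already present (`C = E = 0`). The operator has a kernel, and
  -- the condition on `Q` selects the solution.
  · refine ⟨_, (isMode_of_coefficients (c₀ := φ / 9 - 11 / 27 * χ)
      (c₁ := -φ / 3 - χ / 9 - (φ / 9 - 11 / 27 * χ)) (c₂ := -φ / 6 + 5 / 18 * χ) (c₃ := -χ / 18)
      (C := 0) (d₀ := φ / 9 - 11 / 27 * χ) (d₁ := -φ / 3 - χ / 9) (d₂ := χ / 6) (E := 0)
      le_rfl rfl hh₁ hh₂ (by ring) (by ring) (by ring) (by ring) (by ring) (by ring) (by ring)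
      (by ring) (by ring) (by ring)).mono ?_, ?_⟩
    · rw [mul_assoc]
      refine mul_le_mul_of_nonneg_left ?_ (by norm_num)
      have hlin : ∀ a b : ℝ, |a| ≤ 1 → |b| ≤ 1 → |a * φ + b * χ| ≤ n := fun a b ha hb => by
        refine (abs_add_le _ _).trans ?_
        rw [abs_mul, abs_mul]
        nlinarith [abs_nonneg φ, abs_nonneg χ]
      have a0 := hlin (1 / 9) (-11 / 27) (by norm_num [abs_le]) (by norm_num [abs_le])
      have a1 := hlin (-4 / 9) (8 / 27) (by norm_num [abs_le]) (by norm_num [abs_le])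
      have a2 := hlin (-1 / 6) (5 / 18) (by norm_num [abs_le]) (by norm_num [abs_le])
      have a3 := hlin 0 (-1 / 18) (by norm_num [abs_le]) (by norm_num [abs_le])
      have b1 := hlin (-1 / 3) (-1 / 9) (by norm_num [abs_le]) (by norm_num [abs_le])
      have b2 := hlin 0 (1 / 6) (by norm_num [abs_le]) (by norm_num [abs_le])
      rw [show 1 / 9 * φ + -11 / 27 * χ = φ / 9 - 11 / 27 * χ by ring] at a0
      rw [show -4 / 9 * φ + 8 / 27 * χ = -φ / 3 - χ / 9 - (φ / 9 - 11 / 27 * χ) by ring] at a1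
      rw [show -1 / 6 * φ + 5 / 18 * χ = -φ / 6 + 5 / 18 * χ by ring] at a2
      rw [show 0 * φ + -1 / 18 * χ = -χ / 18 by ring] at a3
      rw [show -1 / 3 * φ + -1 / 9 * χ = -φ / 3 - χ / 9 by ring] at b1
      rw [show 0 * φ + 1 / 6 * χ = χ / 6 by ring] at b2
      have hR3 : 1 ≤ R ^ 3 := one_le_pow₀ hR1
      rw [abs_zero]
      nlinarith
    · simp only [modeL, traceSymbol, mul_zero, Real.exp_zero]
      ring
  · set p := s * (s - 1) with hpdef
    have hp0 : 0 < p := hp₀.trans_le hp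
    have hs1 : s - 1 ≠ 0 := fun h => by rw [hpdef, h, mul_zero] at hp0; exact lt_irrefl _ hp0
    have hdiv : ∀ a b : ℝ, |a| ≤ b → |a / p| ≤ R * b := fun a b hab => by
      rw [abs_div, abs_of_pos hp0, div_eq_mul_one_div, mul_comm]
      have h1 : 1 / p ≤ R := (one_div_le_one_div_of_le hp₀ hp).trans (by linarith)
      exact mul_le_mul h1 hab (abs_nonneg _) (by linarith)
    -- For `p > 0` the polynomial coefficients are solved for from the top degree down, each step
    -- dividing by `p`. Continuity at the interface fixes the amplitudes `u₀ - A` and `u₀ - F` of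
    -- the exponentials; this value of `u₀` makes the derivatives match and satisfies the integral
    -- condition as well.
    set u₀ := traceSymbol s φ χ with hu
    set D := χ / 6 / p with hD
    set B := (1 / 3 * φ - 2 / 9 * χ + 2 * D) / p with hB
    set A := (2 / 3 * φ - 4 / 9 * χ + 2 * D + B + u₀) / p with hA
    set G := χ / 3 / p with hG
    set F := (-φ / 3 - 4 / 9 * χ - G) / p with hF
    have pD : p * D = χ / 6 := mul_div_cancel₀ _ hp0.ne'
    have pB : p * B = 1 / 3 * φ - 2 / 9 * χ + 2 * D := mul_div_cancel₀ _ hp0.ne'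
    have pA : p * A = 2 / 3 * φ - 4 / 9 * χ + 2 * D + B + u₀ := mul_div_cancel₀ _ hp0.ne'
    have pG : p * G = χ / 3 := mul_div_cancel₀ _ hp0.ne'
    have pF : p * F = -φ / 3 - 4 / 9 * χ - G := mul_div_cancel₀ _ hp0.ne'
    refine ⟨_, (isMode_of_coefficients (c₀ := A) (c₁ := B) (c₂ := D) (c₃ := 0) (C := u₀ - A)
      (d₀ := F) (d₁ := G) (d₂ := 0) (E := u₀ - F) hs hpdef hh₁ hh₂
      (by linear_combination -pA) (by linear_combination -pB) (by linear_combination -pD) (by ring)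
      (by linear_combination -pF) (by linear_combination -pG) (by ring) (by ring)
      ?_ ?_).mono ?_, ?_⟩
    · simp only [hA, hB, hD, hF, hG, hu, traceSymbol, hpdef]
      field_simp
      ring
    · simp only [hA, hB, hD, hF, hG, hu, traceSymbol, hpdef]
      field_simp
      ring
    · rw [mul_assoc]
      refine mul_le_mul_of_nonneg_left ?_ (by norm_num)
      have hlin : ∀ a b : ℝ, |a| ≤ 1 → |b| ≤ 1 → |a * φ + b * χ| ≤ n := fun a b ha hb => by
        refine (abs_add_le _ _).trans ?_
        rw [abs_mul, abs_mul]
        nlinarith [abs_nonneg φ, abs_nonneg χ]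
      have a0 := hlin (2 / 3) (-4 / 9) (by norm_num [abs_le]) (by norm_num [abs_le])
      have a1 := hlin (1 / 3) (-2 / 9) (by norm_num [abs_le]) (by norm_num [abs_le])
      have a2 := hlin 0 (1 / 6) (by norm_num [abs_le]) (by norm_num [abs_le])
      have b0 := hlin (-1 / 3) (-4 / 9) (by norm_num [abs_le]) (by norm_num [abs_le])
      have b1 := hlin 0 (1 / 3) (by norm_num [abs_le]) (by norm_num [abs_le])
      rw [show 2 / 3 * φ + -4 / 9 * χ = 2 / 3 * φ - 4 / 9 * χ by ring] at a0
      rw [show 1 / 3 * φ + -2 / 9 * χ = 1 / 3 * φ - 2 / 9 * χ by ring] at a1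
      rw [show 0 * φ + 1 / 6 * χ = χ / 6 by ring] at a2
      rw [show -1 / 3 * φ + -4 / 9 * χ = -φ / 3 - 4 / 9 * χ by ring] at b0
      rw [show 0 * φ + 1 / 3 * χ = χ / 3 by ring] at b1
      have r1 : n ≤ R * n := le_mul_of_one_le_left hn0 hR1
      have r2 : R * n ≤ R * (R * n) := mul_le_mul_of_nonneg_left r1 (by linarith)
      have r3 : R * (R * n) ≤ R * (R * (R * n)) := mul_le_mul_of_nonneg_left r2 (by linarith)
      have bD : |D| ≤ R * n := hdiv _ _ a2
      have bG : |G| ≤ R * n := hdiv _ _ b1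
      have bB : |B| ≤ R * (3 * (R * n)) := hdiv _ _ (by
        refine (abs_add_le _ _).trans ?_
        rw [abs_mul, abs_of_pos (by norm_num : (0 : ℝ) < 2)]
        linarith)
      have bA : |A| ≤ R * (7 * (R * (R * n))) := hdiv _ _ (by
        refine (abs_add_le _ _).trans (add_le_add (abs_add_le _ _) le_rfl |>.trans ?_)
        have := abs_add_le (2 / 3 * φ - 4 / 9 * χ) (2 * D)
        rw [abs_mul 2, abs_of_pos (by norm_num : (0 : ℝ) < 2)] at this
        linarith)
      have bF : |F| ≤ R * (2 * (R * n)) := hdiv _ _ (by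
        refine (abs_sub _ _).trans ?_
        linarith)
      have bC := abs_sub u₀ A
      have bE := abs_sub u₀ F
      rw [abs_zero]
      have : 100 * R ^ 3 * n = 100 * (R * (R * (R * n))) := by ring
      rw [this]
      linarith
    · simp only [modeL, mul_zero, Real.exp_zero]
      ring

/-! ### Finite sums of products -/

lemma iteratedDerivWithin_sum_mul {J : Set ℝ} (hJ : UniqueDiffOn ℝ J) {x : ℝ} (hx : x ∈ J)
    (N : Finset ℤ) {a : ℤ → ℝ → ℝ} (ha : ∀ k, ContDiff ℝ 2 (a k)) (b : ℤ → ℝ) {j : ℕ}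
    (hj : j ≤ 2) :
    iteratedDerivWithin j (fun x => ∑ k ∈ N, a k x * b k) J x
      = ∑ k ∈ N, iteratedDeriv j (a k) x * b k := by
  have hj' : (j : WithTop ℕ∞) ≤ 2 := by exact_mod_cast hj
  rw [iteratedDerivWithin_fun_sum hx hJ
    (fun k _ => (((ha k).of_le hj').mul contDiff_const).contDiffWithinAt)]
  refine Finset.sum_congr rfl fun k _ => ?_
  rw [iteratedDerivWithin_mul_const_field,
    iteratedDerivWithin_eq_iteratedDeriv hJ ((ha k).of_le hj').contDiffAt hx]

lemma iteratedDerivWithin_sum_mul' {J : Set ℝ} (hJ : UniqueDiffOn ℝ J) {x : ℝ} (hx : x ∈ J)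
    (N : Finset ℤ) {a : ℤ → ℝ → ℝ} (ha : ∀ k, ContDiff ℝ 2 (a k)) (b : ℤ → ℝ) {j : ℕ}
    (hj : j ≤ 2) :
    iteratedDerivWithin j (fun x => ∑ k ∈ N, b k * a k x) J x
      = ∑ k ∈ N, b k * iteratedDeriv j (a k) x := by
  simpa only [mul_comm] using iteratedDerivWithin_sum_mul hJ hx N ha b hj

lemma memC_sum_mul {J K : Set ℝ} (hJ : UniqueDiffOn ℝ J) (hK : UniqueDiffOn ℝ K)
    (N : Finset ℤ) {a b : ℤ → ℝ → ℝ} (ha : ∀ k, ContDiff ℝ 2 (a k)) (hb : ∀ k, ContDiff ℝ 2 (b k)) :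
    MemC 2 2 J K (fun x η => ∑ k ∈ N, a k x * b k η) := by
  have hc : ∀ {c : ℤ → ℝ → ℝ}, (∀ k, ContDiff ℝ 2 (c k)) → ∀ j ≤ 2, ∀ k,
      Continuous (iteratedDeriv j (c k)) := fun hc j hj k =>
    (hc k).continuous_iteratedDeriv j (by exact_mod_cast hj)
  refine ⟨fun z _ => ?_, fun s _ => ?_, fun j hj => ?_, fun j hj => ?_⟩
  · exact (ContDiff.sum fun k _ => (ha k).mul contDiff_const).contDiffOn
  · exact (ContDiff.sum fun k _ => contDiff_const.mul (hb k)).contDiffOn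
  · refine ContinuousOn.congr (f := fun p : ℝ × ℝ =>
      ∑ k ∈ N, iteratedDeriv j (a k) p.1 * b k p.2) ?_ fun p hp =>
        iteratedDerivWithin_sum_mul hJ hp.1 N ha (fun k => b k p.2) hj
    refine (continuous_finsetSum _ fun k _ => ?_).continuousOn
    exact ((hc ha j hj k).comp continuous_fst).mul ((hb k).continuous.comp continuous_snd)
  · refine ContinuousOn.congr (f := fun p : ℝ × ℝ =>
      ∑ k ∈ N, a k p.1 * iteratedDeriv j (b k) p.2) ?_ fun p hp =>
        iteratedDerivWithin_sum_mul' hK hp.2 N hb (fun k => a k p.1) hj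
    refine (continuous_finsetSum _ fun k _ => ?_).continuousOn
    exact ((ha k).continuous.comp continuous_fst).mul ((hc hb j hj k).comp continuous_snd)

lemma iteratedDeriv_one_cas (ℓ : ℝ) (k : ℤ) :
    iteratedDeriv 1 (cas ℓ k) = fun η => freq ℓ k * cas ℓ (-k) η := by
  rw [iteratedDeriv_one]; ext η; exact (hasDerivAt_cas ℓ k η).deriv

lemma iteratedDeriv_two_cas (ℓ : ℝ) (k : ℤ) :
    iteratedDeriv 2 (cas ℓ k) = fun η => -(lam ℓ k * cas ℓ k η) := by
  rw [iteratedDeriv_succ, iteratedDeriv_one_cas]; ext η; exact (hasDerivAt_cas_neg ℓ k η).deriv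

/-- Tails of series dominated by a summable sequence. -/
lemma abs_tsum_sub_sum_le {F b : ℤ → ℝ} (hb : Summable b) (h : ∀ k, |F k| ≤ b k) (N : Finset ℤ) :
    |∑' k, F k - ∑ k ∈ N, F k| ≤ ∑' k, b k - ∑ k ∈ N, b k := by
  have hF : Summable fun k => ‖F k‖ := hb.of_nonneg_of_le (fun _ => norm_nonneg _) h
  rw [← hF.of_norm.sum_add_tsum_subtype_compl N, ← hb.sum_add_tsum_subtype_compl N,
    add_sub_cancel_left, add_sub_cancel_left]
  exact (norm_tsum_le_tsum_norm (hF.subtype _)).trans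
    ((hF.subtype _).tsum_le_tsum (fun k => h k) (hb.subtype _))

lemma exists_sum_gt {b : ℤ → ℝ} (hb : Summable b) {δ : ℝ} (hδ : 0 < δ) :
    ∃ N : Finset ℤ, ∑' k, b k - ∑ k ∈ N, b k ≤ δ := by
  have h := hb.hasSum
  rw [HasSum, SummationFilter.unconditional_filter] at h
  obtain ⟨N, hN⟩ := (h.eventually_const_lt (sub_lt_self _ hδ)).exists
  exact ⟨N, by linarith⟩

/-! ### Existence of the resolvent -/

/-- The root `s ≥ 1` of `s (s - 1) = p`. -/
noncomputable def rootS (p : ℝ) : ℝ := (1 + √(1 + 4 * p)) / 2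

lemma one_le_rootS {p : ℝ} (hp : 0 ≤ p) : 1 ≤ rootS p := by
  have : 1 ≤ √(1 + 4 * p) := Real.one_le_sqrt.2 (by linarith)
  unfold rootS; linarith

lemma rootS_mul {p : ℝ} (hp : 0 ≤ p) : rootS p * (rootS p - 1) = p := by
  have := Real.sq_sqrt (by linarith : 0 ≤ 1 + 4 * p)
  unfold rootS; nlinarith

lemma rootS_zero : rootS 0 = 1 := by simp [rootS]

/-- The right-hand side `φ a + χ b`. -/
noncomputable def sourceAB (φ χ : ℝ → ℝ) : StripFun := tensor φ vecA + tensor χ vecB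

/-- The symbol of the trace at the interface of the resolvent applied to `φ a + χ b`. -/
noncomputable def traceCoef (ℓ ε : ℝ) (φ χ : ℝ → ℝ) (k : ℤ) : ℝ :=
  traceSymbol (rootS (ε * lam ℓ k)) (coef ℓ φ k) (coef ℓ χ k)

lemma vec_bound : ∃ K : ℝ, 0 ≤ K ∧ (∀ x ≤ 0, ∀ a b : ℝ,
      |a * vecA.1 x + b * vecB.1 x| ≤ K * (|a| + |b|) * Real.exp (x / 2)) ∧
    (∀ x ≥ 0, ∀ a b : ℝ, |a * vecA.2 x + b * vecB.2 x| ≤ K * (|a| + |b|) * Real.exp (x / 2)) := by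
  refine ⟨48 * 5, by norm_num, fun x hx a b => ?_, fun x hx a b => ?_⟩
  · have h := poly_exp_bound_neg hx (2 / 3 * a - 4 / 9 * b) (1 / 3 * a - 2 / 9 * b) (b / 6) 0
    have e : a * vecA.1 x + b * vecB.1 x = ((2 / 3 * a - 4 / 9 * b)
        + (1 / 3 * a - 2 / 9 * b) * x + b / 6 * x ^ 2 + 0 * x ^ 3) * Real.exp x := by
      simp [vecA, vecB, funT, funT', funU, funV]; ring
    rw [e]
    refine h.trans (mul_le_mul_of_nonneg_right ?_ (Real.exp_pos _).le)
    have h1 := abs_sub (2 / 3 * a) (4 / 9 * b)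
    have h2 := abs_sub (1 / 3 * a) (2 / 9 * b)
    simp only [abs_mul, abs_div, abs_zero] at h1 h2 ⊢
    norm_num at h1 h2 ⊢
    nlinarith [abs_nonneg a, abs_nonneg b]
  · have h := poly_exp_bound hx (-1 / 3 * a - 4 / 9 * b) (b / 3) 0 0
    have e : a * vecA.2 x + b * vecB.2 x = (-1 / 3 * a - 4 / 9 * b)
        + b / 3 * x + 0 * x ^ 2 + 0 * x ^ 3 := by
      simp [vecA, vecB, funT, funT', funU, funV]; ring
    rw [e]
    refine h.trans (mul_le_mul_of_nonneg_right ?_ (Real.exp_pos _).le)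
    have h1 := abs_sub (-1 / 3 * a) (4 / 9 * b)
    simp only [abs_mul, abs_div, abs_zero] at h1 ⊢
    norm_num at h1 ⊢
    nlinarith [abs_nonneg a, abs_nonneg b]

lemma continuous_vecA₁ : Continuous vecA.1 := by
  unfold vecA funT' funU; simp only [Prod.fst_sub]; fun_prop
lemma continuous_vecA₂ : Continuous vecA.2 := by
  unfold vecA funT' funU; simp only [Prod.snd_sub]; fun_prop
lemma continuous_vecB₁ : Continuous vecB.1 := by
  unfold vecB funT funV funU; simp only [Prod.fst_sub, Prod.smul_fst]
  exact ((by fun_prop : Continuous _).sub (by fun_prop)).sub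
    (Continuous.const_smul (by fun_prop) _)
lemma continuous_vecB₂ : Continuous vecB.2 := by
  unfold vecB funT funV funU; simp only [Prod.snd_sub, Prod.smul_snd]
  exact ((by fun_prop : Continuous _).sub (by fun_prop)).sub
    (Continuous.const_smul (by fun_prop) _)

lemma exp_neg_mul_le_iff {x y K : ℝ} :
    Real.exp (-(x / 2)) * y ≤ K ↔ y ≤ K * Real.exp (x / 2) := by
  rw [Real.exp_neg, inv_mul_le_iff₀ (Real.exp_pos _), mul_comm]

lemma memX_sourceAB {ℓ : ℝ} {φ χ : ℝ → ℝ} (hφ : ContinuousOn φ (cell ℓ))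
    (hχ : ContinuousOn χ (cell ℓ)) : MemX ℓ (sourceAB φ χ) := by
  obtain ⟨K, hK, h₁, h₂⟩ := vec_bound
  obtain ⟨B, hB⟩ := isCompact_Icc.exists_bound_of_continuousOn hφ
  obtain ⟨C, hC⟩ := isCompact_Icc.exists_bound_of_continuousOn hχ
  have hm : ∀ (J : Set ℝ), MapsTo Prod.snd (J ×ˢ cell ℓ) (cell ℓ) := fun J p hp => hp.2
  have hcont : ∀ (J : Set ℝ) (a b : ℝ → ℝ), Continuous a → Continuous b →
      ContinuousOn (fun p : ℝ × ℝ => φ p.2 * a p.1 + χ p.2 * b p.1) (J ×ˢ cell ℓ) :=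
    fun J a b ha hb => ((hφ.comp continuousOn_snd (hm J)).mul (ha.comp continuous_fst).continuousOn).add
      ((hχ.comp continuousOn_snd (hm J)).mul (hb.comp continuous_fst).continuousOn)
  refine ⟨hcont _ _ _ continuous_vecA₁ continuous_vecB₁,
    hcont _ _ _ continuous_vecA₂ continuous_vecB₂, K * (B + C), fun x hx η hη => ?_,
    fun x hx η hη => ?_⟩
  · rw [exp_neg_mul_le_iff]
    simp only [sourceAB, tensor, Prod.fst_add, Pi.add_apply, Prod.fst_zero, Pi.zero_apply, sub_zero]
    refine (h₁ x hx _ _).trans ?_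
    have := hB η hη; have := hC η hη
    rw [Real.norm_eq_abs] at *
    gcongr
  · rw [exp_neg_mul_le_iff]
    simp only [sourceAB, tensor, Prod.snd_add, Pi.add_apply, Prod.snd_zero, Pi.zero_apply, sub_zero]
    refine (h₂ x hx _ _).trans ?_
    have := hB η hη; have := hC η hη
    rw [Real.norm_eq_abs] at *
    gcongr

/-- The finite sum of the functions `u k` times the basis functions. -/
noncomputable def modeSum (ℓ : ℝ) (u : ℤ → LineFun) (N : Finset ℤ) : StripFun :=
  (fun x η => ∑ k ∈ N, (u k).1 x * cas ℓ k η, fun x η => ∑ k ∈ N, (u k).2 x * cas ℓ k η)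

lemma opL_modeSum {ℓ : ℝ} {p K : ℤ → ℝ} {h u : ℤ → LineFun}
    (hu : ∀ k, IsMode (p k) (K k) (h k) (u k)) (N : Finset ℤ) :
    (∀ x ≤ 0, ∀ η, (opL (modeSum ℓ u N)).1 x η
      = ∑ k ∈ N, (p k * (u k).1 x - (h k).1 x) * cas ℓ k η) ∧
    (∀ x ≥ 0, ∀ η, (opL (modeSum ℓ u N)).2 x η
      = ∑ k ∈ N, (p k * (u k).2 x - (h k).2 x) * cas ℓ k η) := by
  constructor
  · intro x hx η
    simp only [opL, dX, modeSum]
    rw [iteratedDerivWithin_sum_mul (uniqueDiffOn_Iic 0) hx N (fun k => (hu k).smooth₁) _ le_rfl,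
      iteratedDerivWithin_sum_mul (uniqueDiffOn_Iic 0) hx N (fun k => (hu k).smooth₁) _ one_le_two,
      Finset.mul_sum, ← Finset.sum_sub_distrib, ← Finset.sum_add_distrib]
    refine Finset.sum_congr rfl fun k _ => ?_
    rw [← (hu k).eq₁ x hx]; ring
  · intro x hx η
    simp only [opL, dX, modeSum]
    rw [iteratedDerivWithin_sum_mul (uniqueDiffOn_Ici 0) hx N (fun k => (hu k).smooth₂) _ le_rfl,
      iteratedDerivWithin_sum_mul (uniqueDiffOn_Ici 0) hx N (fun k => (hu k).smooth₂) _ one_le_two,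
      ← Finset.sum_sub_distrib]
    refine Finset.sum_congr rfl fun k _ => ?_
    rw [← (hu k).eq₂ x hx]; ring

lemma dYY_modeSum {ℓ : ℝ} (hℓ : 0 < ℓ) (u : ℤ → LineFun) (N : Finset ℤ) :
    (∀ x, ∀ η ∈ cell ℓ, (dY ℓ 2 (modeSum ℓ u N)).1 x η
      = ∑ k ∈ N, (-lam ℓ k * (u k).1 x) * cas ℓ k η) ∧
    (∀ x, ∀ η ∈ cell ℓ, (dY ℓ 2 (modeSum ℓ u N)).2 x η
      = ∑ k ∈ N, (-lam ℓ k * (u k).2 x) * cas ℓ k η) := by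
  constructor <;>
  · intro x η hη
    simp only [dY, dEta, modeSum]
    rw [iteratedDerivWithin_sum_mul' (uniqueDiffOn_cell hℓ) hη N (fun k => contDiff_cas ℓ k 2) _
      le_rfl]
    refine Finset.sum_congr rfl fun k _ => ?_
    rw [iteratedDeriv_two_cas]; ring

lemma memX_of_sum {ℓ : ℝ} {N : Finset ℤ} {K : ℤ → ℝ} {a b : ℤ → ℝ → ℝ} {f : StripFun}
    (hf₁ : ∀ x ≤ 0, ∀ η ∈ cell ℓ, f.1 x η = ∑ k ∈ N, a k x * cas ℓ k η)
    (hf₂ : ∀ x ≥ 0, ∀ η ∈ cell ℓ, f.2 x η = ∑ k ∈ N, b k x * cas ℓ k η)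
    (ha : ∀ k, Continuous (a k)) (hb : ∀ k, Continuous (b k))
    (ba : ∀ k, ∀ x ≤ 0, |a k x| ≤ K k * Real.exp (x / 2))
    (bb : ∀ k, ∀ x ≥ 0, |b k x| ≤ K k * Real.exp (x / 2)) : MemX ℓ f := by
  have hc : ∀ c : ℤ → ℝ → ℝ, (∀ k, Continuous (c k)) →
      Continuous (fun p : ℝ × ℝ => ∑ k ∈ N, c k p.1 * cas ℓ k p.2) := fun c hc =>
    continuous_finsetSum _ fun k _ =>
      ((hc k).comp continuous_fst).mul ((continuous_cas ℓ k).comp continuous_snd)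
  have hbd : ∀ (c : ℤ → ℝ → ℝ) (x η : ℝ), (∀ k, |c k x| ≤ K k * Real.exp (x / 2)) →
      |∑ k ∈ N, c k x * cas ℓ k η| ≤ (∑ k ∈ N, 2 * K k) * Real.exp (x / 2) := by
    intro c x η h
    refine (Finset.abs_sum_le_sum_abs _ _).trans ?_
    rw [Finset.sum_mul]
    refine Finset.sum_le_sum fun k _ => ?_
    have := abs_mul_cas_le ℓ (fun k => c k x) k η
    have := h k
    linarith
  refine ⟨(hc a ha).continuousOn.congr fun p hp => hf₁ p.1 hp.1 p.2 hp.2,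
    (hc b hb).continuousOn.congr fun p hp => hf₂ p.1 hp.1 p.2 hp.2, ∑ k ∈ N, 2 * K k,
    fun x hx η hη => ?_, fun x hx η hη => ?_⟩
  · rw [exp_neg_mul_le_iff, hf₁ x hx η hη]
    simpa using hbd a x η fun k => ba k x hx
  · rw [exp_neg_mul_le_iff, hf₂ x hx η hη]
    simpa using hbd b x η fun k => bb k x hx

/-- Finite sums of modes are the elements of the domain that approximate the full series when the
closure of `L + εA` is tested. -/
lemma domLA_modeSum {ℓ : ℝ} (hℓ : 0 < ℓ) {p K K' : ℤ → ℝ} {h u : ℤ → LineFun}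
    (hu : ∀ k, IsMode (p k) (K k) (h k) (u k)) (hh₁ : ∀ k, Continuous (h k).1)
    (hh₂ : ∀ k, Continuous (h k).2) (bh₁ : ∀ k, ∀ x ≤ 0, |(h k).1 x| ≤ K' k * Real.exp (x / 2))
    (bh₂ : ∀ k, ∀ x ≥ 0, |(h k).2 x| ≤ K' k * Real.exp (x / 2)) (N : Finset ℤ) :
    DomLA ℓ (modeSum ℓ u N) where
  regular₁ := memC_sum_mul (uniqueDiffOn_Iic 0) (uniqueDiffOn_cell hℓ) N
    (fun k => (hu k).smooth₁) fun k => contDiff_cas ℓ k 2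
  regular₂ := memC_sum_mul (uniqueDiffOn_Ici 0) (uniqueDiffOn_cell hℓ) N
    (fun k => (hu k).smooth₂) fun k => contDiff_cas ℓ k 2
  memX := memX_of_sum (fun _ _ _ _ => rfl) (fun _ _ _ _ => rfl)
    (fun k => (hu k).smooth₁.continuous) (fun k => (hu k).smooth₂.continuous)
    (fun k => (hu k).bound₁) (fun k => (hu k).bound₂)
  memX_dYY := memX_of_sum (K := fun k => lam ℓ k * K k)
    (fun x _ => (dYY_modeSum hℓ u N).1 x) (fun x _ => (dYY_modeSum hℓ u N).2 x)
    (fun k => (hu k).smooth₁.continuous.const_mul _)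
    (fun k => (hu k).smooth₂.continuous.const_mul _)
    (fun k x hx => by
      rw [abs_mul, abs_neg, abs_of_nonneg (lam_nonneg ℓ k), mul_assoc]
      exact mul_le_mul_of_nonneg_left ((hu k).bound₁ x hx) (lam_nonneg ℓ k))
    (fun k x hx => by
      rw [abs_mul, abs_neg, abs_of_nonneg (lam_nonneg ℓ k), mul_assoc]
      exact mul_le_mul_of_nonneg_left ((hu k).bound₂ x hx) (lam_nonneg ℓ k))
  memX_opL := memX_of_sum (K := fun k => |p k| * K k + K' k)
    (fun x hx η _ => (opL_modeSum hu N).1 x hx η) (fun x hx η _ => (opL_modeSum hu N).2 x hx η)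
    (fun k => ((hu k).smooth₁.continuous.const_mul _).sub (hh₁ k))
    (fun k => ((hu k).smooth₂.continuous.const_mul _).sub (hh₂ k))
    (fun k x hx => by
      refine (abs_sub _ _).trans ?_
      rw [abs_mul, add_mul, mul_assoc]
      exact add_le_add (mul_le_mul_of_nonneg_left ((hu k).bound₁ x hx) (abs_nonneg _)) (bh₁ k x hx))
    (fun k x hx => by
      refine (abs_sub _ _).trans ?_
      rw [abs_mul, add_mul, mul_assoc]
      exact add_le_add (mul_le_mul_of_nonneg_left ((hu k).bound₂ x hx) (abs_nonneg _)) (bh₂ k x hx))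
  interface j hj η _ := by
    simp only [dX, modeSum]
    rw [iteratedDerivWithin_sum_mul (uniqueDiffOn_Iic 0) self_mem_Iic N (fun k => (hu k).smooth₁) _
        (by omega),
      iteratedDerivWithin_sum_mul (uniqueDiffOn_Ici 0) self_mem_Ici N (fun k => (hu k).smooth₂) _
        (by omega)]
    refine Finset.sum_congr rfl fun k _ => ?_
    interval_cases j
    · simp [(hu k).interface₀]
    · rw [(hu k).interface₁]
  periodic₁ j hj x _ := by
    simp only [dY, dEta, modeSum]
    rw [iteratedDerivWithin_sum_mul' (uniqueDiffOn_cell hℓ) (left_mem_cell hℓ) N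
        (fun k => contDiff_cas ℓ k 2) _ (by omega),
      iteratedDerivWithin_sum_mul' (uniqueDiffOn_cell hℓ) (right_mem_cell hℓ) N
        (fun k => contDiff_cas ℓ k 2) _ (by omega)]
    refine Finset.sum_congr rfl fun k _ => ?_
    interval_cases j
    · simp [cas_endpoints hℓ]
    · simp only [iteratedDeriv_one_cas, cas_endpoints hℓ]
  periodic₂ j hj x _ := by
    simp only [dY, dEta, modeSum]
    rw [iteratedDerivWithin_sum_mul' (uniqueDiffOn_cell hℓ) (left_mem_cell hℓ) N
        (fun k => contDiff_cas ℓ k 2) _ (by omega),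
      iteratedDerivWithin_sum_mul' (uniqueDiffOn_cell hℓ) (right_mem_cell hℓ) N
        (fun k => contDiff_cas ℓ k 2) _ (by omega)]
    refine Finset.sum_congr rfl fun k _ => ?_
    interval_cases j
    · simp [cas_endpoints hℓ]
    · simp only [iteratedDeriv_one_cas, cas_endpoints hℓ]

lemma modeSeries_bound {ℓ : ℝ} {K : ℤ → ℝ} {a : ℤ → ℝ → ℝ} {x : ℝ}
    (ba : ∀ k, |a k x| ≤ K k * Real.exp (x / 2)) (η : ℝ) (k : ℤ) :
    |a k x * cas ℓ k η| ≤ 2 * K k * Real.exp (x / 2) := by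
  have := abs_mul_cas_le ℓ (fun k => a k x) k η
  have := ba k
  linarith

/-- On an unbounded half strip the Weierstrass test needs a bound independent of `x`; multiplying by
`e^{-x/2}` provides it, and the weight is removed afterwards. -/
lemma continuousOn_modeSeries {ℓ : ℝ} {J : Set ℝ} {K : ℤ → ℝ} (hK : Summable K)
    {a : ℤ → ℝ → ℝ} (ha : ∀ k, Continuous (a k))
    (ba : ∀ k, ∀ x ∈ J, |a k x| ≤ K k * Real.exp (x / 2)) :
    ContinuousOn (fun p : ℝ × ℝ => ∑' k, a k p.1 * cas ℓ k p.2) (J ×ˢ cell ℓ) := by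
  have h : ContinuousOn (fun p : ℝ × ℝ =>
      ∑' k, Real.exp (-(p.1 / 2)) * (a k p.1 * cas ℓ k p.2)) (J ×ˢ cell ℓ) := by
    refine continuousOn_tsum (fun k => Continuous.continuousOn ?_) (hK.mul_left 2) fun k p hp => ?_
    · exact (by fun_prop : Continuous fun p : ℝ × ℝ => Real.exp (-(p.1 / 2))).mul
        (((ha k).comp continuous_fst).mul ((continuous_cas ℓ k).comp continuous_snd))
    · rw [Real.norm_eq_abs, abs_mul, abs_of_pos (Real.exp_pos _), exp_neg_mul_le_iff]
      exact modeSeries_bound (fun k => ba k p.1 hp.1) p.2 k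
  have h2 : ContinuousOn (fun p : ℝ × ℝ => Real.exp (p.1 / 2)) (J ×ˢ cell ℓ) := by fun_prop
  refine (h2.mul h).congr fun p _ => ?_
  simp only [Pi.mul_apply]
  rw [tsum_mul_left, ← mul_assoc, ← Real.exp_add, add_neg_cancel, Real.exp_zero, one_mul]

/-- Termwise integration in `x`; it transfers the vanishing of `Q` from each mode to the series. -/
lemma integral_modeSeries {ℓ : ℝ} {S : Set ℝ} (hS : MeasurableSet S) {K : ℤ → ℝ} (hK : Summable K)
    {a : ℤ → ℝ → ℝ} (ha : ∀ k, Continuous (a k)) {w : ℝ → ℝ} (hw : IntegrableOn w S)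
    (ba : ∀ k, ∀ x ∈ S, |a k x| ≤ K k * w x) (η : ℝ) :
    HasSum (fun k => (∫ x in S, a k x) * cas ℓ k η) (∫ x in S, ∑' k, a k x * cas ℓ k η) := by
  have hint : ∀ k, IntegrableOn (a k) S := fun k =>
    Integrable.mono' (hw.const_mul (K k)) (ha k).aestronglyMeasurable
      (ae_restrict_of_forall_mem hS (ba k))
  have h := hasSum_integral_of_summable_integral_norm (μ := volume.restrict S)
    (F := fun k x => a k x * cas ℓ k η) (fun k => (hint k).mul_const _) ?_
  · simpa only [integral_mul_const] using h
  · refine Summable.of_nonneg_of_le (fun k => integral_nonneg fun x => norm_nonneg _) (fun k => ?_)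
      (hK.mul_left (2 * ∫ x in S, w x))
    calc ∫ x in S, ‖a k x * cas ℓ k η‖ ≤ ∫ x in S, 2 * (K k * w x) := by
          refine integral_mono_ae ((hint k).mul_const _).norm ((hw.const_mul _).const_mul _)
            (ae_restrict_of_forall_mem hS fun x hx => ?_)
          have := abs_mul_cas_le ℓ (fun k => a k x) k η
          have := ba k x hx
          simp only [Real.norm_eq_abs]; linarith
      _ = _ := by rw [integral_const_mul, integral_const_mul]; ring

/-- The series of the mode solutions converges in the weighted sup-norm. Its partial sums lie in the
domain, and `L + εA` maps them to minus the partial sums of the source, so the series lies in the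
graph of the closure. Neither the series nor the source has to be regular enough for the domain
itself. -/
lemma exists_resolvent {ℓ : ℝ} (hℓ : 0 < ℓ) {ε : ℝ} (hε : 0 < ε) {φ χ : ℝ → ℝ}
    (hφ : ContinuousOn φ (cell ℓ)) (hχ : ContinuousOn χ (cell ℓ))
    (sφ : Summable fun k => |coef ℓ φ k|) (sχ : Summable fun k => |coef ℓ χ k|) :
    ∃ z, IsResolvent ℓ ε (sourceAB φ χ) z ∧
      ∀ η, z.1 0 η = casSum ℓ (traceCoef ℓ ε φ χ) η := by
  obtain ⟨K, hK, hmode⟩ := exists_isMode (mul_pos hε (lam_one_pos hℓ))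
  obtain ⟨K', hK', hv₁, hv₂⟩ := vec_bound
  have hp : ∀ k, 0 ≤ ε * lam ℓ k := fun k => mul_nonneg hε.le (lam_nonneg ℓ k)
  have hex : ∀ k, ∃ u : LineFun, IsMode (ε * lam ℓ k) (K * (|coef ℓ φ k| + |coef ℓ χ k|))
      (coef ℓ φ k • vecA + coef ℓ χ k • vecB) u ∧ u.1 0 = traceCoef ℓ ε φ χ k := fun k => by
    have h := hmode (rootS (ε * lam ℓ k)) (one_le_rootS (hp k)) (by
      rw [rootS_mul (hp k)]
      by_cases hk : k = 0
      · left; rw [hk, lam_zero, mul_zero, rootS_zero]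
      · right; exact mul_le_mul_of_nonneg_left (lam_one_le hk) hε.le) (coef ℓ φ k) (coef ℓ χ k)
    rwa [rootS_mul (hp k)] at h
  choose u hu hu0 using hex
  have hs : Summable fun k => |coef ℓ φ k| + |coef ℓ χ k| := sφ.add sχ
  have hKs := hs.mul_left K
  set z : StripFun := (fun x η => ∑' k, (u k).1 x * cas ℓ k η,
    fun x η => ∑' k, (u k).2 x * cas ℓ k η) with hz
  have hzX : MemX ℓ z := by
    refine ⟨continuousOn_modeSeries hKs (fun k => (hu k).smooth₁.continuous)
      (fun k x hx => (hu k).bound₁ x hx), continuousOn_modeSeries hKs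
      (fun k => (hu k).smooth₂.continuous) (fun k x hx => (hu k).bound₂ x hx),
      ∑' k, 2 * (K * (|coef ℓ φ k| + |coef ℓ χ k|)), fun x hx η _ => ?_, fun x hx η _ => ?_⟩
    · rw [exp_neg_mul_le_iff]
      -- With the empty partial sum, the tail estimate becomes a bound of the whole series.
      simpa [tsum_mul_right] using abs_tsum_sub_sum_le ((hKs.mul_left 2).mul_right _)
        (modeSeries_bound (ℓ := ℓ) (fun k => (hu k).bound₁ x hx) η) ∅
    · rw [exp_neg_mul_le_iff]
      simpa [tsum_mul_right] using abs_tsum_sub_sum_le ((hKs.mul_left 2).mul_right _)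
        (modeSeries_bound (ℓ := ℓ) (fun k => (hu k).bound₂ x hx) η) ∅
  have hQ : ∀ η, opQ z η = 0 := fun η => by
    have h1 := integral_modeSeries (ℓ := ℓ) measurableSet_Iic hKs
      (fun k => (hu k).smooth₁.continuous) (integrableOn_exp_mul_Iic_zero (r := 1 / 2) (by norm_num))
      (fun k x hx => by rw [one_div_mul_eq_div]; exact (hu k).bound₁ x hx) η
    have h2 := integral_modeSeries (ℓ := ℓ) measurableSet_Ioi hKs
      (a := fun k x => Real.exp (-x) * (u k).2 x)
      (fun k => (by fun_prop : Continuous fun x : ℝ => Real.exp (-x)).mul (hu k).smooth₂.continuous)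
      (integrableOn_exp_neg_mul_Ioi_zero (r := 1 / 2) (by norm_num))
      (fun k x hx => by
        rw [abs_mul, abs_of_pos (Real.exp_pos _), one_div_mul_eq_div]
        have e : Real.exp (-(x / 2)) = Real.exp (-x) * Real.exp (x / 2) := by
          rw [← Real.exp_add]; congr 1; ring
        rw [e]
        have := mul_le_mul_of_nonneg_left ((hu k).bound₂ x (le_of_lt hx)) (Real.exp_pos (-x)).le
        linarith) η
    have h3 := h1.add h2
    simp only [← add_mul, (hu _).integral, zero_mul] at h3
    have h4 := h3.unique hasSum_zero
    rw [← h4]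
    simp only [opQ, hz, mul_assoc, tsum_mul_left]
  refine ⟨z, ⟨⟨hzX, fun x _ η _ => ?_, fun x _ η _ => ?_⟩, hzX, ?_, fun δ hδ => ?_⟩, fun η => ?_⟩
  · simp [projP, tensor, hQ]
  · simp [projP, tensor, hQ]
  · obtain ⟨h1, h2, C, h3, h4⟩ := memX_sourceAB hφ hχ
    refine ⟨h1.neg, h2.neg, C, fun x hx η hη => ?_, fun x hx η hη => ?_⟩
    · simpa using h3 x hx η hη
    · simpa using h4 x hx η hη
  -- One finite set serves both approximations: `K` controls the modes of the solution, `K'` those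
  -- of the source, and the factor `2` bounds the basis functions.
  · have hb := hs.mul_left (2 * (K + K'))
    obtain ⟨N, hN⟩ := exists_sum_gt hb hδ
    have hcl : ∀ (F : ℤ → ℝ) (x : ℝ), (∀ k, |F k| ≤
        2 * (K + K') * (|coef ℓ φ k| + |coef ℓ χ k|) * Real.exp (x / 2)) →
        |∑' k, F k - ∑ k ∈ N, F k| ≤ δ * Real.exp (x / 2) := fun F x hF => by
      refine (abs_tsum_sub_sum_le (hb.mul_right _) hF N).trans ?_
      rw [tsum_mul_right, ← Finset.sum_mul, ← sub_mul]
      exact mul_le_mul_of_nonneg_right (by linarith) (Real.exp_pos _).le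
    have hb₁ : ∀ (a : ℤ → ℝ → ℝ) (x η : ℝ), (∀ k, |a k x| ≤
        K * (|coef ℓ φ k| + |coef ℓ χ k|) * Real.exp (x / 2)) → ∀ k, |a k x * cas ℓ k η| ≤
        2 * (K + K') * (|coef ℓ φ k| + |coef ℓ χ k|) * Real.exp (x / 2) := fun a x η h k => by
      refine (modeSeries_bound h η k).trans ?_
      have : 0 ≤ 2 * K' * (|coef ℓ φ k| + |coef ℓ χ k|) * Real.exp (x / 2) := by positivity
      linarith
    have hb₂ : ∀ (a : ℤ → ℝ → ℝ) (x η : ℝ), (∀ k, |a k x| ≤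
        K' * (|coef ℓ φ k| + |coef ℓ χ k|) * Real.exp (x / 2)) → ∀ k, |a k x * cas ℓ k η| ≤
        2 * (K + K') * (|coef ℓ φ k| + |coef ℓ χ k|) * Real.exp (x / 2) := fun a x η h k => by
      refine (modeSeries_bound h η k).trans ?_
      have : 0 ≤ 2 * K * (|coef ℓ φ k| + |coef ℓ χ k|) * Real.exp (x / 2) := by positivity
      linarith
    have hcombo : ∀ (η : ℝ), η ∈ cell ℓ → ∀ a b : ℝ, -(φ η * a + χ η * b)
        = ∑' k, -(coef ℓ φ k * a + coef ℓ χ k * b) * cas ℓ k η := fun η hη a b => by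
      have h1 := (hasSum_casSum ℓ sφ η).mul_right a
      have h2 := (hasSum_casSum ℓ sχ η).mul_right b
      rw [← eq_casSum_coef hℓ hφ sφ hη] at h1
      rw [← eq_casSum_coef hℓ hχ sχ hη] at h2
      rw [← (h1.add h2).neg.tsum_eq]
      congr 1; ext k; ring
    refine ⟨modeSum ℓ u N, domLA_modeSum hℓ hu
      (K' := fun k => K' * (|coef ℓ φ k| + |coef ℓ χ k|))
      (fun k => (continuous_vecA₁.const_smul _).add (continuous_vecB₁.const_smul _))
      (fun k => (continuous_vecA₂.const_smul _).add (continuous_vecB₂.const_smul _))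
      (fun k x hx => hv₁ x hx _ _) (fun k x hx => hv₂ x hx _ _) N,
      ⟨fun x hx η hη => ?_, fun x hx η hη => ?_⟩, ⟨fun x hx η hη => ?_, fun x hx η hη => ?_⟩⟩ <;>
      rw [exp_neg_mul_le_iff]
    · exact hcl _ x (hb₁ (fun k => (u k).1) x η fun k => (hu k).bound₁ x hx)
    · exact hcl _ x (hb₁ (fun k => (u k).2) x η fun k => (hu k).bound₂ x hx)
    · have e1 : (opLA ℓ ε (modeSum ℓ u N)).1 x η
          = ∑ k ∈ N, -(coef ℓ φ k * vecA.1 x + coef ℓ χ k * vecB.1 x) * cas ℓ k η := by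
        simp only [opLA, Prod.fst_add, Prod.smul_fst, Pi.add_apply, Pi.smul_apply, smul_eq_mul]
        rw [(opL_modeSum hu N).1 x hx η, (dYY_modeSum hℓ u N).1 x η hη, Finset.mul_sum,
          ← Finset.sum_add_distrib]
        refine Finset.sum_congr rfl fun k _ => ?_
        simp only [Prod.fst_add, Prod.smul_fst, Pi.add_apply, Pi.smul_apply, smul_eq_mul]
        ring
      have e2 : (-sourceAB φ χ).1 x η = -(φ η * vecA.1 x + χ η * vecB.1 x) := rfl
      rw [e1, e2, hcombo η hη]
      exact hcl _ x (hb₂ (fun k x => -(coef ℓ φ k * vecA.1 x + coef ℓ χ k * vecB.1 x)) x η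
        fun k => by rw [abs_neg]; exact hv₁ x hx _ _)
    · have e1 : (opLA ℓ ε (modeSum ℓ u N)).2 x η
          = ∑ k ∈ N, -(coef ℓ φ k * vecA.2 x + coef ℓ χ k * vecB.2 x) * cas ℓ k η := by
        simp only [opLA, Prod.snd_add, Prod.smul_snd, Pi.add_apply, Pi.smul_apply, smul_eq_mul]
        rw [(opL_modeSum hu N).2 x hx η, (dYY_modeSum hℓ u N).2 x η hη, Finset.mul_sum,
          ← Finset.sum_add_distrib]
        refine Finset.sum_congr rfl fun k _ => ?_
        simp only [Prod.snd_add, Prod.smul_snd, Pi.add_apply, Pi.smul_apply, smul_eq_mul]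
        ring
      have e2 : (-sourceAB φ χ).2 x η = -(φ η * vecA.2 x + χ η * vecB.2 x) := rfl
      rw [e1, e2, hcombo η hη]
      exact hcl _ x (hb₂ (fun k x => -(coef ℓ φ k * vecA.2 x + coef ℓ χ k * vecB.2 x)) x η
        fun k => by rw [abs_neg]; exact hv₂ x hx _ _)
  · simp only [hz, casSum, hu0]

/-! ### The trace of the resolvent is determined by the right-hand side -/

lemma hasDerivWithinAt_iteratedDerivWithin {J : Set ℝ} (hJ : UniqueDiffOn ℝ J) {n j : ℕ}
    {v : ℝ → ℝ} (hv : ContDiffOn ℝ n v J) (hj : j < n) {x : ℝ} (hx : x ∈ J) :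
    HasDerivWithinAt (iteratedDerivWithin j v J) (iteratedDerivWithin (j + 1) v J x) J x := by
  have h := ((hv.differentiableOn_iteratedDerivWithin (by exact_mod_cast hj) hJ) x
    hx).hasDerivWithinAt
  rwa [← iteratedDerivWithin_succ] at h

/-- The function `2 C e^{x/2}` is a primitive of the bound, so adding it to `g` gives a monotone
function and subtracting it an antitone one. Comparing with the value at `0` works on either half
line. -/
lemma abs_sub_le_of_deriv_exp_bound {D : Set ℝ} (hD : Convex ℝ D) (h0 : 0 ∈ D) {g g' : ℝ → ℝ}
    {C : ℝ} (hg : ContinuousOn g D) (hg' : ∀ x ∈ interior D, HasDerivAt g (g' x) x)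
    (hb : ∀ x ∈ D, |g' x| ≤ C * Real.exp (x / 2)) {x : ℝ} (hx : x ∈ D) :
    |g x - g 0| ≤ 2 * C * (1 + Real.exp (x / 2)) := by
  have hC : 0 ≤ C := by have := (abs_nonneg _).trans (hb 0 h0); simpa using this
  have he : ∀ x : ℝ, HasDerivAt (fun x => 2 * C * Real.exp (x / 2)) (C * Real.exp (x / 2)) x := by
    intro x
    have := (((hasDerivAt_id x).div_const 2).exp).const_mul (2 * C)
    exact this.congr_deriv (by simp; ring)
  have hce : ContinuousOn (fun x : ℝ => 2 * C * Real.exp (x / 2)) D := by fun_prop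
  have hm : MonotoneOn (fun x => g x + 2 * C * Real.exp (x / 2)) D := by
    refine monotoneOn_of_deriv_nonneg hD (hg.add hce)
      (fun x hx => ((hg' x hx).add (he x)).differentiableAt.differentiableWithinAt) fun x hx => ?_
    have hd : deriv (fun x => g x + 2 * C * Real.exp (x / 2)) x = _ :=
      ((hg' x hx).add (he x)).deriv
    rw [hd]
    have := neg_abs_le (g' x); have := hb x (interior_subset hx); linarith
  have ha : AntitoneOn (fun x => g x - 2 * C * Real.exp (x / 2)) D := by
    refine antitoneOn_of_deriv_nonpos hD (hg.sub hce)
      (fun x hx => ((hg' x hx).sub (he x)).differentiableAt.differentiableWithinAt) fun x hx => ?_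
    have hd : deriv (fun x => g x - 2 * C * Real.exp (x / 2)) x = _ :=
      ((hg' x hx).sub (he x)).deriv
    rw [hd]
    have := le_abs_self (g' x); have := hb x (interior_subset hx); linarith
  have hp := Real.exp_pos (x / 2)
  rw [abs_le]
  rcases le_total x 0 with h | h
  · have h1 := hm hx h0 h
    have h2 := ha hx h0 h
    simp only [zero_div, Real.exp_zero] at h1 h2
    constructor <;> nlinarith
  · have h1 := hm h0 hx h
    have h2 := ha h0 hx h
    simp only [zero_div, Real.exp_zero] at h1 h2
    constructor <;> nlinarith

lemma exp_half_mul_left (s x : ℝ) :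
    Real.exp (x / 2) * Real.exp ((s - 1) * x) = Real.exp ((s - 1 / 2) * x) := by
  rw [← Real.exp_add]; congr 1; ring

lemma exp_half_mul_right (s x : ℝ) :
    Real.exp (x / 2) * Real.exp (-(s * x)) = Real.exp (-((s - 1 / 2) * x)) := by
  rw [← Real.exp_add]; congr 1; ring

lemma hasDerivAt_exp_mul (r x : ℝ) :
    HasDerivAt (fun x => Real.exp (r * x)) (r * Real.exp (r * x)) x := by
  have : HasDerivAt (fun x : ℝ => r * x) r x := by simpa using (hasDerivAt_id x).const_mul r
  exact this.exp.congr_deriv (by ring)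

/-- The integrand minus `s (s - 1) v e^{(s-1)x}` is the derivative of `(v' - s v) e^{(s-1)x}`; the
boundary term at `-∞` vanishes because `s > 1`. The analogue on the right half line uses `(v' + (s -
1) v) e^{-sx}`. -/
lemma integral_left_pairing {s C : ℝ} (hs : 1 < s) {v : ℝ → ℝ} (hv : ContDiffOn ℝ 2 v (Iic 0))
    (bv : ∀ x ≤ 0, |v x| ≤ C * Real.exp (x / 2))
    (bL : ∀ x ≤ 0, |iteratedDerivWithin 2 v (Iic 0) x - iteratedDerivWithin 1 v (Iic 0) x|
      ≤ C * Real.exp (x / 2)) :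
    ∫ x in Iic 0, (iteratedDerivWithin 2 v (Iic 0) x - iteratedDerivWithin 1 v (Iic 0) x)
        * Real.exp ((s - 1) * x)
      = s * (s - 1) * (∫ x in Iic 0, v x * Real.exp ((s - 1) * x))
        + iteratedDerivWithin 1 v (Iic 0) 0 - s * v 0 := by
  have hJ := uniqueDiffOn_Iic (0 : ℝ)
  set v' := iteratedDerivWithin 1 v (Iic 0) with hv'
  set v'' := iteratedDerivWithin 2 v (Iic 0) with hv''
  have c0 : ContinuousOn v (Iic 0) := hv.continuousOn
  have c1 : ContinuousOn v' (Iic 0) := hv.continuousOn_iteratedDerivWithin (by norm_num) hJ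
  have c2 : ContinuousOn v'' (Iic 0) := hv.continuousOn_iteratedDerivWithin (by norm_num) hJ
  have d0 : ∀ x < 0, HasDerivAt v (v' x) x := fun x hx => by
    have := hasDerivWithinAt_iteratedDerivWithin hJ hv (j := 0) (by norm_num) hx.le
    rw [iteratedDerivWithin_zero] at this
    exact this.hasDerivAt (Iic_mem_nhds hx)
  have d1 : ∀ x < 0, HasDerivAt v' (v'' x) x := fun x hx =>
    (hasDerivWithinAt_iteratedDerivWithin hJ hv (j := 1) (by norm_num) hx.le).hasDerivAt
      (Iic_mem_nhds hx)
  have hC : 0 ≤ C := by have := (abs_nonneg _).trans (bv 0 le_rfl); simpa using this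
  -- Only `v` and `v'' - v'` are bounded by assumption. Integrating the latter bounds `v' - v`,
  -- hence `v'`, which is needed to discard the boundary term at infinity.
  have b1 : ∀ x ≤ 0, |v' x| ≤ |v' 0 - v 0| + 5 * C := fun x hx => by
    have h := abs_sub_le_of_deriv_exp_bound (convex_Iic 0) (self_mem_Iic) (c1.sub c0)
      (fun x hx => by
        rw [interior_Iic] at hx
        exact (d1 x hx).sub (d0 x hx)) (fun x hx => bL x hx) hx
    simp only [Pi.sub_apply] at h
    have e : Real.exp (x / 2) ≤ 1 := Real.exp_le_one_iff.2 (by linarith)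
    have h1 := bv x hx
    have : v' x = (v' x - v x - (v' 0 - v 0)) + (v' 0 - v 0) + v x := by ring
    rw [this]
    refine (abs_add_le _ _).trans (add_le_add (abs_add_le _ _) le_rfl |>.trans ?_)
    nlinarith
  set w : ℝ → ℝ := fun x => Real.exp ((s - 1) * x)
  have cw : ContinuousOn w (Iic 0) := by fun_prop
  have dw : ∀ x, HasDerivAt w ((s - 1) * w x) x := fun x => hasDerivAt_exp_mul (s - 1) x
  have bexp : ∀ x ≤ 0, Real.exp (x / 2) ≤ 1 := fun x hx => Real.exp_le_one_iff.2 (by linarith)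
  have b0 : ∀ x ≤ 0, |v x| ≤ C := fun x hx => (bv x hx).trans (by nlinarith [bexp x hx])
  have hM : 0 ≤ |v' 0 - v 0| := abs_nonneg _
  set M := |v' 0 - v 0| + 5 * C + s * C + s * (s - 1) * C + C with hMd
  have hsC : 0 ≤ s * C := by positivity
  have hssC : 0 ≤ s * (s - 1) * C := mul_nonneg (mul_nonneg (by linarith) (by linarith)) hC
  have key := integral_Iic_of_exp_bound (r := s - 1) (K := M) (by linarith)
    (F := fun x => (v' x - s * v x) * w x)
    (f := fun x => (v'' x - v' x) * w x - s * (s - 1) * (v x * w x))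
    (fun x hx => (((d1 x hx).sub ((d0 x hx).const_mul s)).mul (dw x)).congr_deriv (by
      simp only [Pi.sub_apply]; ring))
    (((c1.sub (c0.const_mul s)).mul cw) 0 self_mem_Iic)
    (((c2.sub c1).mul cw).sub ((c0.mul cw).const_mul _))
    (fun x hx => by
      rw [abs_mul, abs_of_pos (Real.exp_pos _)]
      refine mul_le_mul_of_nonneg_right ?_ (Real.exp_pos _).le
      refine (abs_sub _ _).trans ?_
      rw [abs_mul, abs_of_pos (by linarith : 0 < s)]
      have := b1 x hx; have := mul_le_mul_of_nonneg_left (b0 x hx) (by linarith : 0 ≤ s)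
      linarith)
    (fun x hx => by
      have e : (v'' x - v' x) * w x - s * (s - 1) * (v x * w x)
        = ((v'' x - v' x) - s * (s - 1) * v x) * w x := by ring
      rw [e, abs_mul, abs_of_pos (Real.exp_pos _)]
      refine mul_le_mul_of_nonneg_right ?_ (Real.exp_pos _).le
      refine (abs_sub _ _).trans ?_
      have hss : 0 ≤ s * (s - 1) := mul_nonneg (by linarith) (by linarith)
      rw [abs_mul, abs_of_nonneg hss]
      have h1 := bL x hx; have := mul_le_mul_of_nonneg_left (b0 x hx) hss
      have h2 : C * Real.exp (x / 2) ≤ C := by nlinarith [bexp x hx]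
      linarith)
  have i1 : IntegrableOn (fun x => (v'' x - v' x) * w x) (Iic 0) :=
    integrableOn_Iic_of_exp_bound (r := s - 1 / 2) (K := C) (by linarith)
      ((c2.sub c1).mul cw) fun x hx => by
        rw [abs_mul, abs_of_pos (Real.exp_pos _), ← exp_half_mul_left, ← mul_assoc]
        exact mul_le_mul_of_nonneg_right (bL x hx) (Real.exp_pos _).le
  have i2 : IntegrableOn (fun x => v x * w x) (Iic 0) :=
    integrableOn_Iic_of_exp_bound (r := s - 1 / 2) (K := C) (by linarith)
      (c0.mul cw) fun x hx => by
        rw [abs_mul, abs_of_pos (Real.exp_pos _), ← exp_half_mul_left, ← mul_assoc]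
        exact mul_le_mul_of_nonneg_right (bv x hx) (Real.exp_pos _).le
  rw [integral_sub i1 (i2.const_mul _), integral_const_mul] at key
  simp only [w, mul_zero, Real.exp_zero, mul_one] at key
  linarith

lemma integral_right_pairing {s C : ℝ} (hs : 1 < s) {v : ℝ → ℝ} (hv : ContDiffOn ℝ 2 v (Ici 0))
    (bv : ∀ x ≥ 0, |v x| ≤ C * Real.exp (x / 2))
    (bL : ∀ x ≥ 0, |iteratedDerivWithin 2 v (Ici 0) x - iteratedDerivWithin 1 v (Ici 0) x|
      ≤ C * Real.exp (x / 2)) :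
    ∫ x in Ioi 0, (iteratedDerivWithin 2 v (Ici 0) x - iteratedDerivWithin 1 v (Ici 0) x)
        * Real.exp (-(s * x))
      = s * (s - 1) * (∫ x in Ioi 0, v x * Real.exp (-(s * x)))
        - iteratedDerivWithin 1 v (Ici 0) 0 + (1 - s) * v 0 := by
  have hJ := uniqueDiffOn_Ici (0 : ℝ)
  set v' := iteratedDerivWithin 1 v (Ici 0) with hv'
  set v'' := iteratedDerivWithin 2 v (Ici 0) with hv''
  have c0 : ContinuousOn v (Ici 0) := hv.continuousOn
  have c1 : ContinuousOn v' (Ici 0) := hv.continuousOn_iteratedDerivWithin (by norm_num) hJ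
  have c2 : ContinuousOn v'' (Ici 0) := hv.continuousOn_iteratedDerivWithin (by norm_num) hJ
  have d0 : ∀ x > 0, HasDerivAt v (v' x) x := fun x hx => by
    have := hasDerivWithinAt_iteratedDerivWithin hJ hv (j := 0) (by norm_num) (le_of_lt hx)
    rw [iteratedDerivWithin_zero] at this
    exact this.hasDerivAt (Ici_mem_nhds hx)
  have d1 : ∀ x > 0, HasDerivAt v' (v'' x) x := fun x hx =>
    (hasDerivWithinAt_iteratedDerivWithin hJ hv (j := 1) (by norm_num) (le_of_lt hx)).hasDerivAt
      (Ici_mem_nhds hx)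
  have hC : 0 ≤ C := by have := (abs_nonneg _).trans (bv 0 le_rfl); simpa using this
  have b1 : ∀ x ≥ 0, |v' x| ≤ (|v' 0 - v 0| + 5 * C) * Real.exp (x / 2) := fun x hx => by
    have h := abs_sub_le_of_deriv_exp_bound (convex_Ici 0) (self_mem_Ici) (c1.sub c0)
      (fun x hx => by
        rw [interior_Ici] at hx
        exact (d1 x hx).sub (d0 x hx)) (fun x hx => bL x hx) hx
    simp only [Pi.sub_apply] at h
    have e : 1 ≤ Real.exp (x / 2) := Real.one_le_exp (by linarith)
    have h1 := bv x hx
    have : v' x = (v' x - v x - (v' 0 - v 0)) + (v' 0 - v 0) + v x := by ring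
    rw [this]
    refine (abs_add_le _ _).trans (add_le_add (abs_add_le _ _) le_rfl |>.trans ?_)
    nlinarith [abs_nonneg (v' 0 - v 0)]
  set w : ℝ → ℝ := fun x => Real.exp (-(s * x))
  have cw : ContinuousOn w (Ici 0) := by fun_prop
  have dw : ∀ x, HasDerivAt w (-s * w x) x := fun x => by
    simpa only [neg_mul] using hasDerivAt_exp_mul (-s) x
  have hM : 0 ≤ |v' 0 - v 0| := abs_nonneg _
  set M := |v' 0 - v 0| + 5 * C + s * C + s * (s - 1) * C + C with hMd
  have hsC : 0 ≤ s * C := by positivity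
  have hssC : 0 ≤ s * (s - 1) * C := mul_nonneg (mul_nonneg (by linarith) (by linarith)) hC
  have hMle : ∀ x a, |a| ≤ M * Real.exp (x / 2) →
      |a * w x| ≤ M * Real.exp (-((s - 1 / 2) * x)) := fun x a ha => by
    rw [abs_mul, abs_of_pos (Real.exp_pos _), ← exp_half_mul_right, ← mul_assoc]
    exact mul_le_mul_of_nonneg_right ha (Real.exp_pos _).le
  have key := integral_Ioi_of_exp_bound (r := s - 1 / 2) (K := M) (by linarith)
    (F := fun x => (v' x + (s - 1) * v x) * w x)
    (f := fun x => (v'' x - v' x) * w x - s * (s - 1) * (v x * w x))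
    (fun x hx => (((d1 x hx).add ((d0 x hx).const_mul (s - 1))).mul (dw x)).congr_deriv (by
      simp only [Pi.add_apply]; ring))
    (((c1.add (c0.const_mul (s - 1))).mul cw) 0 self_mem_Ici)
    (((c2.sub c1).mul cw).sub ((c0.mul cw).const_mul _))
    (fun x hx => hMle x _ (by
      refine (abs_add_le _ _).trans ?_
      rw [abs_mul, abs_of_pos (by linarith : 0 < s - 1)]
      have := b1 x hx
      have := mul_le_mul_of_nonneg_left (bv x hx) (by linarith : 0 ≤ s - 1)
      have h3 : 0 ≤ (s * (s - 1) * C + C) * Real.exp (x / 2) := by positivity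
      have h4 : 0 ≤ C * Real.exp (x / 2) := by positivity
      nlinarith))
    (fun x hx => by
      have e : (v'' x - v' x) * w x - s * (s - 1) * (v x * w x)
        = ((v'' x - v' x) - s * (s - 1) * v x) * w x := by ring
      rw [e]
      refine hMle x _ ((abs_sub _ _).trans ?_)
      have hss : 0 ≤ s * (s - 1) := mul_nonneg (by linarith) (by linarith)
      rw [abs_mul, abs_of_nonneg hss]
      have h1 := bL x hx; have := mul_le_mul_of_nonneg_left (bv x hx) hss
      have h3 : 0 ≤ (|v' 0 - v 0| + 5 * C + s * C) * Real.exp (x / 2) := by positivity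
      nlinarith)
  have i1 : IntegrableOn (fun x => (v'' x - v' x) * w x) (Ioi 0) :=
    integrableOn_Ioi_of_exp_bound (r := s - 1 / 2) (K := C) (by linarith)
      ((c2.sub c1).mul cw) fun x hx => by
        rw [abs_mul, abs_of_pos (Real.exp_pos _), ← exp_half_mul_right, ← mul_assoc]
        exact mul_le_mul_of_nonneg_right (bL x hx) (Real.exp_pos _).le
  have i2 : IntegrableOn (fun x => v x * w x) (Ioi 0) :=
    integrableOn_Ioi_of_exp_bound (r := s - 1 / 2) (K := C) (by linarith)
      (c0.mul cw) fun x hx => by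
        rw [abs_mul, abs_of_pos (Real.exp_pos _), ← exp_half_mul_right, ← mul_assoc]
        exact mul_le_mul_of_nonneg_right (bv x hx) (Real.exp_pos _).le
  rw [integral_sub i1 (i2.const_mul _), integral_const_mul] at key
  simp only [w, mul_zero, neg_zero, Real.exp_zero, mul_one] at key
  linarith

/-! ### Testing with the adjoint solutions -/

/-- The pairing in the variable `x` with the solution of the adjoint equation. -/
noncomputable def pairing (s : ℝ) (f : StripFun) (η : ℝ) : ℝ :=
  (∫ x in Iic (0 : ℝ), f.1 x η * Real.exp ((s - 1) * x))
    + ∫ x in Ioi (0 : ℝ), f.2 x η * Real.exp (-(s * x))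

lemma MemX.bound {ℓ : ℝ} {f : StripFun} (hf : MemX ℓ f) : ∃ C : ℝ, 0 ≤ C ∧
    (∀ x ≤ 0, ∀ η ∈ cell ℓ, |f.1 x η| ≤ C * Real.exp (x / 2)) ∧
    (∀ x ≥ 0, ∀ η ∈ cell ℓ, |f.2 x η| ≤ C * Real.exp (x / 2)) := by
  obtain ⟨-, -, C, h1, h2⟩ := hf
  refine ⟨max C 0, le_max_right _ _, fun x hx η hη => ?_, fun x hx η hη => ?_⟩
  · have := h1 x hx η hη
    rw [exp_neg_mul_le_iff] at this
    simp only [Prod.fst_zero, Pi.zero_apply, sub_zero] at this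
    exact this.trans (mul_le_mul_of_nonneg_right (le_max_left _ _) (Real.exp_pos _).le)
  · have := h2 x hx η hη
    rw [exp_neg_mul_le_iff] at this
    simp only [Prod.snd_zero, Pi.zero_apply, sub_zero] at this
    exact this.trans (mul_le_mul_of_nonneg_right (le_max_left _ _) (Real.exp_pos _).le)

lemma MemX.continuousOn_left {ℓ : ℝ} {f : StripFun} (hf : MemX ℓ f) {η : ℝ} (hη : η ∈ cell ℓ) :
    ContinuousOn (fun x => f.1 x η) (Iic 0) :=
  hf.1.comp (f := fun x : ℝ => (x, η)) (by fun_prop) fun _ hx => ⟨hx, hη⟩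

lemma MemX.continuousOn_right {ℓ : ℝ} {f : StripFun} (hf : MemX ℓ f) {η : ℝ} (hη : η ∈ cell ℓ) :
    ContinuousOn (fun x => f.2 x η) (Ici 0) :=
  hf.2.1.comp (f := fun x : ℝ => (x, η)) (by fun_prop) fun _ hx => ⟨hx, hη⟩

lemma MemX.integrable_left {ℓ s : ℝ} (hs : 1 < s) {f : StripFun} (hf : MemX ℓ f) {η : ℝ}
    (hη : η ∈ cell ℓ) : IntegrableOn (fun x => f.1 x η * Real.exp ((s - 1) * x)) (Iic 0) := by
  obtain ⟨C, -, h1, -⟩ := hf.bound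
  refine integrableOn_Iic_of_exp_bound (r := s - 1 / 2) (K := C) (by linarith)
    ((hf.continuousOn_left hη).mul (by fun_prop)) fun x hx => ?_
  rw [abs_mul, abs_of_pos (Real.exp_pos _), ← exp_half_mul_left, ← mul_assoc]
  exact mul_le_mul_of_nonneg_right (h1 x hx η hη) (Real.exp_pos _).le

lemma MemX.integrable_right {ℓ s : ℝ} (hs : 1 < s) {f : StripFun} (hf : MemX ℓ f) {η : ℝ}
    (hη : η ∈ cell ℓ) : IntegrableOn (fun x => f.2 x η * Real.exp (-(s * x))) (Ioi 0) := by
  obtain ⟨C, -, -, h1⟩ := hf.bound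
  refine integrableOn_Ioi_of_exp_bound (r := s - 1 / 2) (K := C) (by linarith)
    ((hf.continuousOn_right hη).mul (by fun_prop)) fun x hx => ?_
  rw [abs_mul, abs_of_pos (Real.exp_pos _), ← exp_half_mul_right, ← mul_assoc]
  exact mul_le_mul_of_nonneg_right (h1 x hx η hη) (Real.exp_pos _).le

lemma integral_exp_left {s : ℝ} (hs : 1 < s) :
    ∫ x in Iic (0 : ℝ), Real.exp x * Real.exp ((s - 1) * x) = 1 / s := by
  have h := integral_modeL hs.le 0 0 0 0 1
  simp only [modeL] at h
  simp only [zero_mul, add_zero, zero_add, one_mul, mul_zero, sub_zero] at h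
  rw [← h]
  congr 1; ext x; rw [← Real.exp_add]; congr 1; ring

/-- The interface conditions cancel the two one-sided derivatives and merge the boundary values into
`(1 - 2s) v(0)`. The nonlocal term `e^x v(0)` adds `v(0)/s`. The result involves `v` only through
the pairing itself and its trace. -/
lemma pairing_opL {ℓ s : ℝ} (hs : 1 < s) {v : StripFun} (hv : DomLA ℓ v) {η : ℝ}
    (hη : η ∈ cell ℓ) :
    pairing s (opL v) η = s * (s - 1) * pairing s v η + (1 / s - (2 * s - 1)) * v.1 0 η := by
  obtain ⟨C, hC, b1, b2⟩ := hv.memX.bound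
  obtain ⟨C', hC', b1', b2'⟩ := hv.memX_opL.bound
  set M := C + C' + |v.1 0 η|
  have hM : ∀ x y, |y| ≤ C * Real.exp (x / 2) → |y| ≤ M * Real.exp (x / 2) := fun x y h =>
    h.trans (mul_le_mul_of_nonneg_right (by simp only [M]; linarith [abs_nonneg (v.1 0 η)])
      (Real.exp_pos _).le)
  have iL : IntegrableOn (fun x => v.1 0 η * (Real.exp x * Real.exp ((s - 1) * x))) (Iic 0) := by
    refine Integrable.const_mul ?_ _
    have := integrableOn_exp_mul_Iic_zero (r := s) (by linarith)
    refine this.congr_fun (fun x _ => ?_) measurableSet_Iic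
    simp only []
    rw [← Real.exp_add]; congr 1; ring
  have hl := integral_left_pairing hs (C := M) (hv.regular₁.1 η hη)
    (fun x hx => hM x _ (b1 x hx η hη)) (fun x hx => by
      have h1 := b1' x hx η hη
      simp only [opL, dX] at h1
      have e : ∀ a b : ℝ, a - b = (a - b + Real.exp x * v.1 0 η) - Real.exp x * v.1 0 η :=
        fun a b => by ring
      rw [e]
      refine (abs_sub _ _).trans ?_
      rw [abs_mul, abs_of_pos (Real.exp_pos x)]
      have h2 : Real.exp x ≤ Real.exp (x / 2) := Real.exp_le_exp.2 (by linarith)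
      have h3 := mul_le_mul_of_nonneg_right h2 (abs_nonneg (v.1 0 η))
      have h4 : 0 ≤ C * Real.exp (x / 2) := by positivity
      simp only [M]
      nlinarith)
  have hr := integral_right_pairing hs (C := M) (hv.regular₂.1 η hη)
    (fun x hx => hM x _ (b2 x hx η hη)) (fun x hx => by
      have h1 := b2' x hx η hη
      simp only [opL, dX] at h1
      refine h1.trans (mul_le_mul_of_nonneg_right ?_ (Real.exp_pos _).le)
      simp only [M]; linarith [abs_nonneg (v.1 0 η)])
  have i0 := hv.interface 0 (by norm_num) η hη
  have i1 := hv.interface 1 le_rfl η hη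
  simp only [dX, iteratedDerivWithin_zero] at i0 i1
  have hopL : ∫ x in Iic (0 : ℝ), (opL v).1 x η * Real.exp ((s - 1) * x)
      = (∫ x in Iic (0 : ℝ), ((dX 2 v).1 x η - (dX 1 v).1 x η) * Real.exp ((s - 1) * x))
        + v.1 0 η * (1 / s) := by
    have i3 := (hv.memX_opL.integrable_left hs hη).sub iL
    rw [← integral_exp_left hs, ← integral_const_mul, ← integral_add (i3.congr_fun (fun x _ => by
      simp only [opL, Pi.sub_apply]; ring) measurableSet_Iic) iL]
    refine setIntegral_congr_fun measurableSet_Iic fun x _ => ?_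
    simp only [opL]; ring
  unfold pairing
  rw [hopL]
  simp only [dX, opL] at hl hr ⊢
  rw [hl, hr, ← i1, ← i0]
  ring

/-- The weight `e^{x/2}` of the norm times the test function is `e^{(s-1/2)x}` on the left and
`e^{-(s-1/2)x}` on the right, both integrable. So the pairing is continuous on `𝒳`, uniformly in
`η`, and passes to the closure. -/
lemma pairing_close {ℓ s δ : ℝ} (hs : 1 < s) {f g : StripFun} (hf : MemX ℓ f) (hg : MemX ℓ g)
    (h : XClose ℓ δ f g) {η : ℝ} (hη : η ∈ cell ℓ) :
    |pairing s f η - pairing s g η| ≤ δ * ((∫ x in Iic (0 : ℝ), Real.exp ((s - 1 / 2) * x))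
      + ∫ x in Ioi (0 : ℝ), Real.exp (-((s - 1 / 2) * x))) := by
  have hr : 0 < s - 1 / 2 := by linarith
  have e : pairing s f η - pairing s g η
      = (∫ x in Iic (0 : ℝ), (f.1 x η * Real.exp ((s - 1) * x) - g.1 x η * Real.exp ((s - 1) * x)))
        + ∫ x in Ioi (0 : ℝ), (f.2 x η * Real.exp (-(s * x)) - g.2 x η * Real.exp (-(s * x))) := by
    rw [integral_sub (hf.integrable_left hs hη) (hg.integrable_left hs hη),
      integral_sub (hf.integrable_right hs hη) (hg.integrable_right hs hη)]
    unfold pairing; ring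
  rw [e, mul_add, ← integral_const_mul, ← integral_const_mul]
  refine (abs_add_le _ _).trans (add_le_add ?_ ?_)
  · refine norm_integral_le_of_norm_le (f := fun x => f.1 x η * Real.exp ((s - 1) * x)
      - g.1 x η * Real.exp ((s - 1) * x)) ((integrableOn_exp_mul_Iic_zero hr).const_mul δ)
      (ae_restrict_of_forall_mem measurableSet_Iic fun x hx => ?_)
    rw [← sub_mul, Real.norm_eq_abs, abs_mul, abs_of_pos (Real.exp_pos _), ← exp_half_mul_left,
      ← mul_assoc]
    exact mul_le_mul_of_nonneg_right (exp_neg_mul_le_iff.1 (h.1 x hx η hη)) (Real.exp_pos _).le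
  · refine norm_integral_le_of_norm_le (f := fun x => f.2 x η * Real.exp (-(s * x))
      - g.2 x η * Real.exp (-(s * x))) ((integrableOn_exp_neg_mul_Ioi_zero hr).const_mul δ)
      (ae_restrict_of_forall_mem measurableSet_Ioi fun x hx => ?_)
    rw [← sub_mul, Real.norm_eq_abs, abs_mul, abs_of_pos (Real.exp_pos _), ← exp_half_mul_right,
      ← mul_assoc]
    exact mul_le_mul_of_nonneg_right (exp_neg_mul_le_iff.1 (h.2 x (le_of_lt hx) η hη))
      (Real.exp_pos _).le

/-- Continuous functions on a half strip with exponential bounds are integrable against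
integrable weights in `x` and bounded continuous weights in `η`. -/
lemma integrable_strip {ℓ C : ℝ} {S : Set ℝ} (hS : MeasurableSet S) {g : ℝ → ℝ → ℝ} {w e : ℝ → ℝ}
    (hg : ContinuousOn (fun p : ℝ × ℝ => g p.1 p.2) (S ×ˢ cell ℓ))
    (hw : Continuous w) (he : Continuous e) (be : ∀ η, |e η| ≤ 2)
    (hb : ∀ x ∈ S, ∀ η ∈ cell ℓ, |g x η| ≤ C * Real.exp (x / 2))
    (hi : IntegrableOn (fun x => Real.exp (x / 2) * |w x|) S) :
    Integrable (fun p : ℝ × ℝ => g p.1 p.2 * w p.1 * e p.2)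
      ((volume.restrict S).prod (volume.restrict (Ioc (-(ℓ / 2)) (ℓ / 2)))) := by
  have hsub : S ×ˢ Ioc (-(ℓ / 2)) (ℓ / 2) ⊆ S ×ˢ cell ℓ := prod_mono_right Ioc_subset_Icc_self
  have hms : MeasurableSet (S ×ˢ Ioc (-(ℓ / 2)) (ℓ / 2)) := hS.prod measurableSet_Ioc
  have hbd : Integrable (fun p : ℝ × ℝ => (Real.exp (p.1 / 2) * |w p.1|) * (2 * C))
      ((volume.restrict S).prod (volume.restrict (Ioc (-(ℓ / 2)) (ℓ / 2)))) :=
    Integrable.mul_prod (f := fun x => Real.exp (x / 2) * |w x|) (g := fun _ => 2 * C) hi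
      (integrable_const _)
  refine hbd.mono' ?_ ?_
  · rw [Measure.prod_restrict]
    refine ContinuousOn.aestronglyMeasurable ?_ hms
    exact ((hg.mono hsub).mul (hw.comp continuous_fst).continuousOn).mul
      (he.comp continuous_snd).continuousOn
  · rw [Measure.prod_restrict]
    refine ae_restrict_of_forall_mem hms fun p hp => ?_
    have h1 := hb p.1 hp.1 p.2 (Ioc_subset_Icc_self hp.2)
    have h2 := be p.2
    rw [Real.norm_eq_abs, abs_mul, abs_mul]
    calc |g p.1 p.2| * |w p.1| * |e p.2|
        ≤ (C * Real.exp (p.1 / 2)) * |w p.1| * 2 := by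
          have h0 : 0 ≤ C * Real.exp (p.1 / 2) := (abs_nonneg _).trans h1
          gcongr
      _ = _ := by ring

lemma MemX.integrable_strip_left {ℓ s : ℝ} (hs : 1 < s) {f : StripFun} (hf : MemX ℓ f) (k : ℤ) :
    Integrable (fun p : ℝ × ℝ => f.1 p.1 p.2 * Real.exp ((s - 1) * p.1) * cas ℓ k p.2)
      ((volume.restrict (Iic 0)).prod (volume.restrict (Ioc (-(ℓ / 2)) (ℓ / 2)))) := by
  obtain ⟨C, -, h1, -⟩ := hf.bound
  refine integrable_strip measurableSet_Iic hf.1 (w := fun x => Real.exp ((s - 1) * x))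
    (by fun_prop) (continuous_cas ℓ k) (abs_cas_le ℓ k) h1 ?_
  simp only [abs_of_pos (Real.exp_pos _), exp_half_mul_left]
  exact integrableOn_exp_mul_Iic_zero (by linarith)

lemma MemX.integrable_strip_right {ℓ s : ℝ} (hs : 1 < s) {f : StripFun} (hf : MemX ℓ f) (k : ℤ) :
    Integrable (fun p : ℝ × ℝ => f.2 p.1 p.2 * Real.exp (-(s * p.1)) * cas ℓ k p.2)
      ((volume.restrict (Ioi 0)).prod (volume.restrict (Ioc (-(ℓ / 2)) (ℓ / 2)))) := by
  obtain ⟨C, -, -, h1⟩ := hf.bound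
  refine integrable_strip measurableSet_Ioi (hf.2.1.mono (prod_mono_left Ioi_subset_Ici_self))
    (w := fun x => Real.exp (-(s * x)))
    (by fun_prop) (continuous_cas ℓ k) (abs_cas_le ℓ k) (fun x hx => h1 x (le_of_lt hx)) ?_
  simp only [abs_of_pos (Real.exp_pos _), exp_half_mul_right]
  exact integrableOn_exp_neg_mul_Ioi_zero (by linarith)

lemma MemX.integrable_pairing {ℓ s : ℝ} (hs : 1 < s) {f : StripFun} (hf : MemX ℓ f) (k : ℤ) :
    Integrable (fun η => pairing s f η * cas ℓ k η)
      (volume.restrict (Ioc (-(ℓ / 2)) (ℓ / 2))) := by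
  have h1 := (hf.integrable_strip_left hs k).integral_prod_right
  have h2 := (hf.integrable_strip_right hs k).integral_prod_right
  refine (h1.add h2).congr (ae_of_all _ fun η => ?_)
  simp only [Pi.add_apply, integral_mul_const, pairing]
  ring

lemma MemX.integral_pairing {ℓ s : ℝ} (hs : 1 < s) {f : StripFun} (hf : MemX ℓ f) (k : ℤ) :
    ∫ η in Ioc (-(ℓ / 2)) (ℓ / 2), pairing s f η * cas ℓ k η
      = (∫ x in Iic (0 : ℝ), (∫ η in Ioc (-(ℓ / 2)) (ℓ / 2), f.1 x η * cas ℓ k η)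
          * Real.exp ((s - 1) * x))
        + ∫ x in Ioi (0 : ℝ), (∫ η in Ioc (-(ℓ / 2)) (ℓ / 2), f.2 x η * cas ℓ k η)
          * Real.exp (-(s * x)) := by
  have i1 := hf.integrable_strip_left hs k
  have i2 := hf.integrable_strip_right hs k
  have e1 := integral_integral_swap (f := fun x η => f.1 x η * Real.exp ((s - 1) * x) * cas ℓ k η) i1
  have e2 := integral_integral_swap (f := fun x η => f.2 x η * Real.exp (-(s * x)) * cas ℓ k η) i2
  have h1 := i1.integral_prod_right
  have h2 := i2.integral_prod_right
  have hc : ∀ (u c : ℝ → ℝ) (y : ℝ), ∫ η in Ioc (-(ℓ / 2)) (ℓ / 2), u η * y * c η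
      = (∫ η in Ioc (-(ℓ / 2)) (ℓ / 2), u η * c η) * y := fun u c y => by
    rw [← integral_mul_const]; congr 1; ext η; ring
  simp only [hc] at e1 e2
  rw [e1, e2, ← integral_add h1 h2]
  simp only [integral_mul_const, pairing, add_mul]

lemma integral_dEta_two_mul_cas {ℓ : ℝ} (hℓ : 0 < ℓ) {φ : ℝ → ℝ} (hφ : ContDiffOn ℝ 2 φ (cell ℓ))
    (h0 : φ (-(ℓ / 2)) = φ (ℓ / 2)) (h1 : dEta ℓ 1 φ (-(ℓ / 2)) = dEta ℓ 1 φ (ℓ / 2)) (k : ℤ) :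
    ∫ η in Ioc (-(ℓ / 2)) (ℓ / 2), dEta ℓ 2 φ η * cas ℓ k η
      = -lam ℓ k * ∫ η in Ioc (-(ℓ / 2)) (ℓ / 2), φ η * cas ℓ k η := by
  have hφ0 := hasDerivWithinAt_dEta hℓ (n := 2) hφ (j := 0) (by norm_num)
  rw [dEta_zero] at hφ0
  have h := coef_deriv_deriv hℓ hφ0 (hasDerivWithinAt_dEta hℓ (n := 2) hφ (j := 1) (by norm_num))
    (continuousOn_dEta hℓ (n := 2) hφ le_rfl) h0 h1 k
  unfold coef at h
  rw [intervalIntegral.integral_of_le (by linarith), intervalIntegral.integral_of_le (by linarith)]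
    at h
  have hl : ℓ⁻¹ ≠ 0 := inv_ne_zero hℓ.ne'
  apply mul_left_cancel₀ hl
  rw [show (0 + 1 + 1) = 2 from rfl] at h
  rw [h]; ring

/-- The weak form of `L_ε z = f`, tested with the solutions of the adjoint equation. -/
lemma trace_of_graphLeps {ℓ : ℝ} (hℓ : 0 < ℓ) {ε : ℝ} {s : ℝ} (hs : 1 < s) {k : ℤ}
    (hsk : s * (s - 1) = ε * lam ℓ k) {z f : StripFun} (hz : GraphLeps ℓ ε z f) :
    (1 / s - (2 * s - 1)) * ∫ η in Ioc (-(ℓ / 2)) (ℓ / 2), z.1 0 η * cas ℓ k η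
      = ∫ η in Ioc (-(ℓ / 2)) (ℓ / 2), pairing s f η * cas ℓ k η := by
  obtain ⟨hzX, hfX, happ⟩ := hz
  set c := 1 / s - (2 * s - 1)
  have hcell : ∀ η ∈ Ioc (-(ℓ / 2)) (ℓ / 2), η ∈ cell ℓ := fun η hη => Ioc_subset_Icc_self hη
  have htr : ∀ {g : StripFun}, MemX ℓ g → Integrable (fun η => g.1 0 η * cas ℓ k η)
      (volume.restrict (Ioc (-(ℓ / 2)) (ℓ / 2))) := fun {g} hg => by
    have hc : ContinuousOn (fun η => g.1 0 η) (cell ℓ) :=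
      hg.1.comp (f := fun η : ℝ => ((0 : ℝ), η)) (by fun_prop) fun _ hη => ⟨self_mem_Iic, hη⟩
    exact ((hc.mul (continuous_cas ℓ k).continuousOn).integrableOn_Icc).mono_set
      Ioc_subset_Icc_self
  have hv : ∀ v, DomLA ℓ v → MemX ℓ (opLA ℓ ε v) ∧
      c * ∫ η in Ioc (-(ℓ / 2)) (ℓ / 2), v.1 0 η * cas ℓ k η
        = ∫ η in Ioc (-(ℓ / 2)) (ℓ / 2), pairing s (opLA ℓ ε v) η * cas ℓ k η := by
    intro v hv
    have hX1 := hv.memX_opL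
    have hX2 := hv.memX_dYY
    obtain ⟨C1, hC1, b1, b1'⟩ := hX1.bound
    obtain ⟨C2, hC2, b2, b2'⟩ := hX2.bound
    refine ⟨⟨hX1.1.add (hX2.1.const_smul ε), hX1.2.1.add (hX2.2.1.const_smul ε), C1 + |ε| * C2,
      fun x hx η hη => ?_, fun x hx η hη => ?_⟩, ?_⟩
    · rw [exp_neg_mul_le_iff]
      simp only [opLA, Prod.fst_add, Prod.smul_fst, Pi.add_apply, Pi.smul_apply, smul_eq_mul,
        Prod.fst_zero, Pi.zero_apply, sub_zero]
      refine (abs_add_le _ _).trans ?_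
      rw [abs_mul, add_mul, mul_assoc]
      exact add_le_add (b1 x hx η hη) (mul_le_mul_of_nonneg_left (b2 x hx η hη) (abs_nonneg _))
    · rw [exp_neg_mul_le_iff]
      simp only [opLA, Prod.snd_add, Prod.smul_snd, Pi.add_apply, Pi.smul_apply, smul_eq_mul,
        Prod.snd_zero, Pi.zero_apply, sub_zero]
      refine (abs_add_le _ _).trans ?_
      rw [abs_mul, add_mul, mul_assoc]
      exact add_le_add (b1' x hx η hη) (mul_le_mul_of_nonneg_left (b2' x hx η hη) (abs_nonneg _))
    · have hp : ∀ η ∈ Ioc (-(ℓ / 2)) (ℓ / 2), pairing s (opLA ℓ ε v) η * cas ℓ k η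
          = (s * (s - 1) * (pairing s v η * cas ℓ k η) + c * (v.1 0 η * cas ℓ k η))
            + ε * (pairing s (dY ℓ 2 v) η * cas ℓ k η) := fun η hη => by
        have hlin : pairing s (opLA ℓ ε v) η
            = pairing s (opL v) η + ε * pairing s (dY ℓ 2 v) η := by
          unfold pairing
          simp only [opLA, Prod.fst_add, Prod.smul_fst, Pi.add_apply, Pi.smul_apply, smul_eq_mul,
            Prod.snd_add, Prod.smul_snd, add_mul, mul_assoc]
          rw [integral_add (hX1.integrable_left hs (hcell η hη))
              ((hX2.integrable_left hs (hcell η hη)).const_mul ε),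
            integral_add (hX1.integrable_right hs (hcell η hη))
              ((hX2.integrable_right hs (hcell η hη)).const_mul ε), integral_const_mul,
            integral_const_mul]
          ring
        rw [hlin, pairing_opL hs hv (hcell η hη)]
        ring
      rw [setIntegral_congr_fun measurableSet_Ioc hp, integral_add, integral_add,
        integral_const_mul, integral_const_mul, integral_const_mul,
        hv.memX.integral_pairing hs, hX2.integral_pairing hs]
      · have e1 : ∀ x ∈ Iic (0 : ℝ), (∫ η in Ioc (-(ℓ / 2)) (ℓ / 2), (dY ℓ 2 v).1 x η * cas ℓ k η)
            * Real.exp ((s - 1) * x) = -lam ℓ k * ((∫ η in Ioc (-(ℓ / 2)) (ℓ / 2),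
              v.1 x η * cas ℓ k η) * Real.exp ((s - 1) * x)) := fun x hx => by
          have := integral_dEta_two_mul_cas hℓ (hv.regular₁.2.1 x hx)
            (by simpa [dY, dEta_zero] using hv.periodic₁ 0 (by norm_num) x hx)
            (hv.periodic₁ 1 le_rfl x hx) k
          simp only [dY]
          rw [this]; ring
        have e2 : ∀ x ∈ Ioi (0 : ℝ), (∫ η in Ioc (-(ℓ / 2)) (ℓ / 2), (dY ℓ 2 v).2 x η * cas ℓ k η)
            * Real.exp (-(s * x)) = -lam ℓ k * ((∫ η in Ioc (-(ℓ / 2)) (ℓ / 2),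
              v.2 x η * cas ℓ k η) * Real.exp (-(s * x))) := fun x (hx : 0 < x) => by
          have := integral_dEta_two_mul_cas hℓ (hv.regular₂.2.1 x hx.le)
            (by simpa [dY, dEta_zero] using hv.periodic₂ 0 (by norm_num) x (le_of_lt hx))
            (hv.periodic₂ 1 le_rfl x (le_of_lt hx)) k
          simp only [dY]
          rw [this]; ring
        -- Since `s (s - 1) = ε λ_k`, the contribution of `ε D_ηη` cancels the zeroth-order term of
        -- `pairing_opL`, and only the trace survives.
        rw [setIntegral_congr_fun measurableSet_Iic e1, setIntegral_congr_fun measurableSet_Ioi e2,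
          integral_const_mul, integral_const_mul, hsk]
        ring
      · exact (hv.memX.integrable_pairing hs k).const_mul _
      · exact (htr hv.memX).const_mul _
      · exact ((hv.memX.integrable_pairing hs k).const_mul _).add ((htr hv.memX).const_mul _)
      · exact (hX2.integrable_pairing hs k).const_mul _
  set I := (∫ x in Iic (0 : ℝ), Real.exp ((s - 1 / 2) * x))
      + ∫ x in Ioi (0 : ℝ), Real.exp (-((s - 1 / 2) * x))
  have hI : 0 ≤ I := add_nonneg (integral_nonneg fun x => (Real.exp_pos _).le)
    (integral_nonneg fun x => (Real.exp_pos _).le)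
  have hclose : ∀ (a b : ℝ → ℝ) (δ : ℝ), Integrable (fun η => a η * cas ℓ k η)
      (volume.restrict (Ioc (-(ℓ / 2)) (ℓ / 2))) → Integrable (fun η => b η * cas ℓ k η)
      (volume.restrict (Ioc (-(ℓ / 2)) (ℓ / 2))) → (∀ η ∈ cell ℓ, |a η - b η| ≤ δ) →
      |(∫ η in Ioc (-(ℓ / 2)) (ℓ / 2), a η * cas ℓ k η)
        - ∫ η in Ioc (-(ℓ / 2)) (ℓ / 2), b η * cas ℓ k η| ≤ 2 * δ * ℓ := by
    intro a b δ ha hb hab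
    rw [← integral_sub ha hb]
    have h := norm_setIntegral_le_of_norm_le_const (μ := volume) (s := Ioc (-(ℓ / 2)) (ℓ / 2))
      (f := fun η => a η * cas ℓ k η - b η * cas ℓ k η) (C := 2 * δ) measure_Ioc_lt_top
      (fun η hη => by
        rw [← sub_mul, Real.norm_eq_abs, abs_mul]
        have h1 := hab η (hcell η hη)
        have h2 := abs_cas_le ℓ k η
        nlinarith [abs_nonneg (a η - b η), abs_nonneg (cas ℓ k η)])
    have hvol : volume.real (Ioc (-(ℓ / 2)) (ℓ / 2)) = ℓ := by
      rw [Real.volume_real_Ioc_of_le (by linarith)]; ring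
    rwa [hvol] at h
  by_contra hne
  set X := c * ∫ η in Ioc (-(ℓ / 2)) (ℓ / 2), z.1 0 η * cas ℓ k η
  set Y := ∫ η in Ioc (-(ℓ / 2)) (ℓ / 2), pairing s f η * cas ℓ k η
  have hpos : 0 < |X - Y| := abs_pos.2 (sub_ne_zero.2 hne)
  -- Up to the summand `1`, which makes `A` positive, this is the total error of the two sides per
  -- unit of `δ`. The choice of `δ` below then bounds `|X - Y|` by half of itself.
  set A := |c| * 2 * ℓ + 2 * I * ℓ + 1 with hA
  have hA0 : 0 < A := by positivity
  obtain ⟨v, hvD, hzv, hfv⟩ := happ (|X - Y| / (2 * A)) (by positivity)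
  obtain ⟨hLX, hLe⟩ := hv v hvD
  set δ := |X - Y| / (2 * A)
  have hδ : 0 ≤ δ := by positivity
  have h1 := hclose (fun η => z.1 0 η) (fun η => v.1 0 η) δ (htr hzX) (htr hvD.memX)
    (fun η hη => by simpa using hzv.1 0 le_rfl η hη)
  have h2 := hclose (pairing s f) (pairing s (opLA ℓ ε v)) (δ * I) (hfX.integrable_pairing hs k)
    (hLX.integrable_pairing hs k) (fun η hη => pairing_close hs hfX hLX hfv hη)
  rw [← hLe] at h2
  set V := ∫ η in Ioc (-(ℓ / 2)) (ℓ / 2), v.1 0 η * cas ℓ k η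
  have h3 : |X - Y| ≤ |c| * (2 * δ * ℓ) + 2 * (δ * I) * ℓ := by
    have e : X - Y = c * ((∫ η in Ioc (-(ℓ / 2)) (ℓ / 2), z.1 0 η * cas ℓ k η) - V)
        - (Y - c * V) := by simp only [X]; ring
    rw [e]
    refine (abs_sub _ _).trans (add_le_add ?_ h2)
    rw [abs_mul]
    exact mul_le_mul_of_nonneg_left h1 (abs_nonneg c)
  have h4 : |c| * (2 * δ * ℓ) + 2 * (δ * I) * ℓ ≤ δ * A := by
    rw [hA]; nlinarith
  have h5 : δ * A = |X - Y| / 2 := by simp only [δ]; field_simp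
  linarith

/-! ### The operator `(D_ηη R(0, L_ε) ·)(0, ·)` as a Fourier multiplier -/

lemma rootS_gt_one {ℓ ε : ℝ} (hℓ : 0 < ℓ) (hε : 0 < ε) {k : ℤ} (hk : k ≠ 0) :
    1 < rootS (ε * lam ℓ k) := by
  have hp : 0 < ε * lam ℓ k := mul_pos hε (lam_pos hℓ hk)
  have h1 := one_le_rootS hp.le
  have h2 := rootS_mul hp.le
  rcases h1.eq_or_lt with h | h
  · rw [← h] at h2; linarith
  · exact h

/-- The multiplier is of order zero. -/
lemma abs_lam_traceSymbol_le {ℓ ε : ℝ} (hε : 0 < ε) (k : ℤ) (φ χ : ℝ) :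
    |lam ℓ k * traceSymbol (rootS (ε * lam ℓ k)) φ χ| ≤ ε⁻¹ * (|φ| + |χ|) := by
  have hp : 0 ≤ ε * lam ℓ k := mul_nonneg hε.le (lam_nonneg ℓ k)
  set s := rootS (ε * lam ℓ k)
  have hs : 1 ≤ s := one_le_rootS hp
  have hl : lam ℓ k = ε⁻¹ * (s * (s - 1)) := by rw [rootS_mul hp]; field_simp
  have hs0 : 0 < s := by linarith
  have e : lam ℓ k * traceSymbol s φ χ
      = ε⁻¹ * ((s - 1) / (3 * (2 * s + 1)) * φ
        - (s - 1) * (8 * s + 3) / (9 * s * (2 * s + 1)) * χ) := by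
    rw [hl]; unfold traceSymbol; field_simp
  rw [e, abs_mul, abs_of_pos (inv_pos.2 hε)]
  refine mul_le_mul_of_nonneg_left ((abs_sub _ _).trans ?_) (inv_pos.2 hε).le
  rw [abs_mul, abs_mul]
  have h1 : |(s - 1) / (3 * (2 * s + 1))| ≤ 1 := by
    rw [abs_of_nonneg (div_nonneg (by linarith) (by linarith)), div_le_one (by linarith)]
    linarith
  have h2 : |(s - 1) * (8 * s + 3) / (9 * s * (2 * s + 1))| ≤ 1 := by
    rw [abs_of_nonneg (div_nonneg (mul_nonneg (by linarith) (by linarith)) (by positivity)),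
      div_le_one (by positivity)]
    nlinarith
  nlinarith [abs_nonneg φ, abs_nonneg χ]

/-- At zero frequency `s = 1` and the factor `1/s - (2s - 1)` vanishes, so the weak formulation says
nothing about the mean of the trace. Two solutions are therefore compared up to a constant. -/
lemma eq_add_const_of_coef {ℓ : ℝ} (hℓ : 0 < ℓ) {f g : ℝ → ℝ} (hf : ContinuousOn f (cell ℓ))
    (hg : ContinuousOn g (cell ℓ)) (h : ∀ k ≠ 0, coef ℓ f k = coef ℓ g k) :
    ∃ c, ∀ η ∈ cell ℓ, f η = g η + c := by
  set c := coef ℓ f 0 - coef ℓ g 0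
  refine ⟨c, fun η hη => ?_⟩
  have hd : ContinuousOn (fun η => f η - g η) (cell ℓ) := hf.sub hg
  have hc : ContinuousOn (fun η => c * cas ℓ 0 η) (cell ℓ) := by fun_prop
  have := eq_zero_of_coef_eq_zero hℓ (hd.sub hc) (fun k => by
    have h1 := coef_sub hℓ hd hc k
    rw [coef_sub hℓ hf hg, coef_const_mul, coef_cas hℓ] at h1
    refine h1.trans ?_
    split_ifs with h0
    · subst h0; simp only [c]; ring
    · rw [h k (Ne.symm h0)]; ring) η hη
  simp only [Pi.sub_apply, cas_zero, mul_one] at this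
  linarith

/-- `(D_ηη R(0, L_ε) (φ a + χ b))(0, ·)` is given by a Hartley series. -/
lemma traceDR_sourceAB {ℓ : ℝ} (hℓ : 0 < ℓ) {ε : ℝ} (hε : 0 < ε) {φ χ : ℝ → ℝ}
    (hφ : ContinuousOn φ (cell ℓ)) (hχ : ContinuousOn χ (cell ℓ))
    (sφ : Summable fun k => |coef ℓ φ k|) (sχ : Summable fun k => |coef ℓ χ k|) :
    EqOn (traceDR ℓ ε (sourceAB φ χ)) (casSum ℓ fun k => -(lam ℓ k * traceCoef ℓ ε φ χ k))
      (cell ℓ) := by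
  obtain ⟨z, hz, hz0⟩ := exists_resolvent hℓ hε hφ hχ sφ sχ
  have hex : ∃ z, IsResolvent ℓ ε (sourceAB φ χ) z := ⟨z, hz⟩
  have hr : IsResolvent ℓ ε (sourceAB φ χ) (resolvent ℓ ε (sourceAB φ χ)) := by
    unfold resolvent; rw [dif_pos hex]; exact hex.choose_spec
  set y := resolvent ℓ ε (sourceAB φ χ) with hy
  have hcont : ∀ {g : StripFun}, MemX ℓ g → ContinuousOn (g.1 0) (cell ℓ) := fun {g} hg =>
    hg.1.comp (f := fun η : ℝ => ((0 : ℝ), η)) (by fun_prop) fun _ hη => ⟨self_mem_Iic, hη⟩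
  have s1 : Summable fun k => |traceCoef ℓ ε φ χ k| :=
    (sφ.add sχ).of_nonneg_of_le (fun _ => abs_nonneg _) fun k =>
      abs_traceSymbol_le (one_le_rootS (mul_nonneg hε.le (lam_nonneg ℓ k))) _ _
  have s2 : Summable fun k => |lam ℓ k * traceCoef ℓ ε φ χ k| :=
    ((sφ.add sχ).mul_left ε⁻¹).of_nonneg_of_le (fun _ => abs_nonneg _) fun k =>
      abs_lam_traceSymbol_le hε k _ _
  -- The resolvent is an arbitrary choice among the solutions. Its trace agrees with that of the
  -- explicit solution in every nonzero mode, and the constant `c` disappears under `D_ηη`.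
  obtain ⟨c, hc⟩ := eq_add_const_of_coef hℓ (hcont hr.1.1) (hcont hz.1.1) (fun k hk => by
    have hs := rootS_gt_one hℓ hε hk
    have hp : 0 ≤ ε * lam ℓ k := mul_nonneg hε.le (lam_nonneg ℓ k)
    have h1 := trace_of_graphLeps hℓ hs (rootS_mul hp) hr.2
    have h2 := trace_of_graphLeps hℓ hs (rootS_mul hp) hz.2
    rw [← h2] at h1
    set s := rootS (ε * lam ℓ k)
    have hne : 1 / s - (2 * s - 1) ≠ 0 := by
      have : 1 / s < 1 := (div_lt_one (by linarith)).2 hs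
      intro h0; linarith
    have h3 := mul_left_cancel₀ hne h1
    unfold coef
    rw [intervalIntegral.integral_of_le (by linarith), intervalIntegral.integral_of_le (by linarith),
      h3])
  intro η hη
  have e1 : EqOn (y.1 0) (fun η => casSum ℓ (traceCoef ℓ ε φ χ) η + c) (cell ℓ) := fun η hη => by
    rw [hc η hη, hz0]
  have e2 : EqOn (dEta ℓ 2 fun η => casSum ℓ (traceCoef ℓ ε φ χ) η + c)
      (casSum ℓ fun k => -(lam ℓ k * traceCoef ℓ ε φ χ k)) (cell ℓ) :=
    dEta_two_eq hℓ (fun η _ => ((hasDerivAt_casSum s1 s2 η).add_const c).hasDerivWithinAt)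
      (fun η _ => (hasDerivAt_casSum_deriv s1 s2 η).hasDerivWithinAt)
  simp only [traceDR, dY]
  rw [← hy, dEta_congr e1 2 hη, e2 hη]

/-! ### Weighted sums of squared coefficients -/

/-- One integration by parts trades a derivative for a factor `λ`. It maps the index `k` to `-k`,
under which both the weight and the summation are invariant. -/
lemma hasSum_lam_pow_succ {ℓ : ℝ} (hℓ : 0 < ℓ) {f f' : ℝ → ℝ}
    (hf : ∀ η ∈ cell ℓ, HasDerivWithinAt f (f' η) (cell ℓ) η)
    (hf' : ContinuousOn f' (cell ℓ)) (hp : f (-(ℓ / 2)) = f (ℓ / 2)) {j : ℕ} {v : ℝ}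
    (h : HasSum (fun k => lam ℓ k ^ j * coef ℓ f' k ^ 2) v) :
    HasSum (fun k => lam ℓ k ^ (j + 1) * coef ℓ f k ^ 2) v := by
  refine ((Equiv.hasSum_iff (Equiv.neg ℤ)).2 h).congr_fun fun k => ?_
  simp only [Function.comp, Equiv.neg_apply]
  rw [coef_deriv_sq hℓ hf hf' hp, neg_neg, lam_neg]
  ring

/-- Parseval for the `j`-th derivative, carried down to `φ` one derivative at a time. Only the
boundary values of orders below `j` have to match. -/
lemma hasSum_lam_pow_dEta {ℓ : ℝ} (hℓ : 0 < ℓ) {n j : ℕ} {φ : ℝ → ℝ}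
    (hφ : ContDiffOn ℝ n φ (cell ℓ)) (hj : j ≤ n)
    (hp : ∀ i < j, dEta ℓ i φ (-(ℓ / 2)) = dEta ℓ i φ (ℓ / 2)) :
    HasSum (fun k => lam ℓ k ^ j * coef ℓ φ k ^ 2)
      (ℓ⁻¹ * ∫ η in (-(ℓ / 2))..(ℓ / 2), dEta ℓ j φ η ^ 2) := by
  have key : ∀ i ≤ j, HasSum (fun k => lam ℓ k ^ i * coef ℓ (dEta ℓ (j - i) φ) k ^ 2)
      (ℓ⁻¹ * ∫ η in (-(ℓ / 2))..(ℓ / 2), dEta ℓ j φ η ^ 2) := by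
    intro i
    induction i with
    | zero => intro _; simpa using hasSum_coef_sq hℓ (continuousOn_dEta hℓ hφ hj)
    | succ i ih =>
      intro hi
      have e : j - i = j - (i + 1) + 1 := by omega
      have h := ih (by omega)
      rw [e] at h
      exact hasSum_lam_pow_succ hℓ (hasDerivWithinAt_dEta hℓ hφ (by omega))
        (continuousOn_dEta hℓ hφ (by omega)) (hp _ (by omega)) h
  simpa [dEta_zero] using key j le_rfl

lemma coef_dEta_two {ℓ : ℝ} (hℓ : 0 < ℓ) {n j : ℕ} {φ : ℝ → ℝ}
    (hφ : ContDiffOn ℝ n φ (cell ℓ)) (hj : j + 2 ≤ n)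
    (hp : dEta ℓ j φ (-(ℓ / 2)) = dEta ℓ j φ (ℓ / 2))
    (hp' : dEta ℓ (j + 1) φ (-(ℓ / 2)) = dEta ℓ (j + 1) φ (ℓ / 2)) (k : ℤ) :
    coef ℓ (dEta ℓ (j + 2) φ) k = -(lam ℓ k * coef ℓ (dEta ℓ j φ) k) :=
  coef_deriv_deriv hℓ (hasDerivWithinAt_dEta hℓ hφ (by omega))
    (hasDerivWithinAt_dEta hℓ hφ (by omega)) (continuousOn_dEta hℓ hφ (by omega)) hp hp' k

/-! ### Dependence on time -/

/-- Joint continuity on `[0,T] × [-ℓ/2, ℓ/2]`. -/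
def ContOnRect (ℓ T : ℝ) (g : ℝ → ℝ → ℝ) : Prop :=
  ContinuousOn (fun p : ℝ × ℝ => g p.1 p.2) (Icc 0 T ×ˢ cell ℓ)

lemma ContOnRect.slice {ℓ T : ℝ} {g : ℝ → ℝ → ℝ} (hg : ContOnRect ℓ T g) {t : ℝ}
    (ht : t ∈ Icc 0 T) : ContinuousOn (g t) (cell ℓ) :=
  ContinuousOn.comp (f := fun η : ℝ => (t, η)) hg (by fun_prop) fun _ hη => ⟨ht, hη⟩

lemma ContOnRect.slice' {ℓ T : ℝ} {g : ℝ → ℝ → ℝ} (hg : ContOnRect ℓ T g) {η : ℝ}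
    (hη : η ∈ cell ℓ) : ContinuousOn (fun t => g t η) (Icc 0 T) :=
  ContinuousOn.comp (f := fun t : ℝ => (t, η)) hg (by fun_prop) fun _ ht => ⟨ht, hη⟩

lemma ContOnRect.bound {ℓ T : ℝ} {g : ℝ → ℝ → ℝ} (hg : ContOnRect ℓ T g) :
    ∃ C, 0 ≤ C ∧ ∀ t ∈ Icc 0 T, ∀ η ∈ cell ℓ, |g t η| ≤ C := by
  obtain ⟨C, hC⟩ := (isCompact_Icc.prod isCompact_Icc).exists_bound_of_continuousOn hg
  exact ⟨max C 0, le_max_right _ _, fun t ht η hη => (hC (t, η) ⟨ht, hη⟩).trans (le_max_left _ _)⟩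

lemma uIoc_subset_cell {ℓ : ℝ} (hℓ : 0 < ℓ) {η : ℝ} (hη : η ∈ uIoc (-(ℓ / 2)) (ℓ / 2)) :
    η ∈ cell ℓ := by
  rw [uIoc_of_le (by linarith)] at hη; exact Ioc_subset_Icc_self hη

lemma aestronglyMeasurable_cell {ℓ : ℝ} (hℓ : 0 < ℓ) {f : ℝ → ℝ} (hf : ContinuousOn f (cell ℓ)) :
    AEStronglyMeasurable f (volume.restrict (uIoc (-(ℓ / 2)) (ℓ / 2))) := by
  rw [uIoc_of_le (by linarith)]
  exact (hf.mono Ioc_subset_Icc_self).aestronglyMeasurable measurableSet_Ioc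

lemma ContOnRect.continuousOn_integral {ℓ T : ℝ} (hℓ : 0 < ℓ) {g : ℝ → ℝ → ℝ}
    (hg : ContOnRect ℓ T g) :
    ContinuousOn (fun t => ∫ η in (-(ℓ / 2))..(ℓ / 2), g t η) (Icc 0 T) := by
  obtain ⟨C, hC, hb⟩ := hg.bound
  intro t _
  refine intervalIntegral.continuousWithinAt_of_dominated_interval (bound := fun _ => C)
    (by filter_upwards [self_mem_nhdsWithin] with s hs
        exact aestronglyMeasurable_cell hℓ (hg.slice hs))
    (by filter_upwards [self_mem_nhdsWithin] with s hs
        exact ae_of_all _ fun η hη => hb s hs η (uIoc_subset_cell hℓ hη))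
    (by simp) (ae_of_all _ fun η hη => hg.slice' (uIoc_subset_cell hℓ hη) t ‹_›)

lemma ContOnRect.mul {ℓ T : ℝ} {g h : ℝ → ℝ → ℝ} (hg : ContOnRect ℓ T g) (hh : ContOnRect ℓ T h) :
    ContOnRect ℓ T fun t η => g t η * h t η := ContinuousOn.mul hg hh

lemma ContOnRect.sub {ℓ T : ℝ} {g h : ℝ → ℝ → ℝ} (hg : ContOnRect ℓ T g) (hh : ContOnRect ℓ T h) :
    ContOnRect ℓ T fun t η => g t η - h t η := ContinuousOn.sub hg hh

lemma ContOnRect.pow {ℓ T : ℝ} {g : ℝ → ℝ → ℝ} (hg : ContOnRect ℓ T g) (n : ℕ) :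
    ContOnRect ℓ T fun t η => g t η ^ n := ContinuousOn.pow hg n

lemma contOnRect_of_continuous {ℓ T : ℝ} {e : ℝ → ℝ} (he : Continuous e) :
    ContOnRect ℓ T fun _ η => e η := (he.comp continuous_snd).continuousOn

lemma ContOnRect.continuousOn_coef {ℓ T : ℝ} (hℓ : 0 < ℓ) {g : ℝ → ℝ → ℝ}
    (hg : ContOnRect ℓ T g) (k : ℤ) : ContinuousOn (fun t => coef ℓ (g t) k) (Icc 0 T) :=
  ((hg.mul (contOnRect_of_continuous (continuous_cas ℓ k))).continuousOn_integral hℓ).const_mul _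

lemma hasDerivAt_integral_rect {ℓ T : ℝ} (hℓ : 0 < ℓ) {g g' : ℝ → ℝ → ℝ}
    (hg : ContOnRect ℓ T g) (hg' : ContOnRect ℓ T g')
    (hd : ∀ t ∈ Ioo 0 T, ∀ η ∈ cell ℓ, HasDerivAt (fun t => g t η) (g' t η) t) {t : ℝ}
    (ht : t ∈ Ioo 0 T) :
    HasDerivAt (fun t => ∫ η in (-(ℓ / 2))..(ℓ / 2), g t η)
      (∫ η in (-(ℓ / 2))..(ℓ / 2), g' t η) t := by
  obtain ⟨C, hC, hb⟩ := hg'.bound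
  have hT := Ioo_subset_Icc_self (a := (0 : ℝ)) (b := T)
  exact (intervalIntegral.hasDerivAt_integral_of_dominated_loc_of_deriv_le
    (bound := fun _ => C) (Ioo_mem_nhds ht.1 ht.2)
    (by filter_upwards [Ioo_mem_nhds ht.1 ht.2] with s hs
        exact aestronglyMeasurable_cell hℓ (hg.slice (hT hs)))
    (intervalIntegrable_of_cell hℓ (hg.slice (hT ht)))
    (aestronglyMeasurable_cell hℓ (hg'.slice (hT ht)))
    (ae_of_all _ fun η hη s hs => hb s (hT hs) η (uIoc_subset_cell hℓ hη)) (by simp)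
    (ae_of_all _ fun η hη s hs => hd s hs η (uIoc_subset_cell hℓ hη))).2

lemma hasDerivAt_coef {ℓ T : ℝ} (hℓ : 0 < ℓ) {g g' : ℝ → ℝ → ℝ}
    (hg : ContOnRect ℓ T g) (hg' : ContOnRect ℓ T g')
    (hd : ∀ t ∈ Ioo 0 T, ∀ η ∈ cell ℓ, HasDerivAt (fun t => g t η) (g' t η) t) {t : ℝ}
    (ht : t ∈ Ioo 0 T) (k : ℤ) :
    HasDerivAt (fun t => coef ℓ (g t) k) (coef ℓ (g' t) k) t :=
  (hasDerivAt_integral_rect hℓ (hg.mul (contOnRect_of_continuous (continuous_cas ℓ k)))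
    (hg'.mul (contOnRect_of_continuous (continuous_cas ℓ k)))
    (fun t ht η hη => (hd t ht η hη).mul_const _) ht).const_mul ℓ⁻¹

lemma MemC.contOnRect_dEta {ℓ T : ℝ} {h n : ℕ} {J : Set ℝ} (hJ : Icc 0 T ⊆ J) {f : ℝ → ℝ → ℝ}
    (hf : MemC h n J (cell ℓ) f) {j : ℕ} (hj : j ≤ n) :
    ContOnRect ℓ T fun t => dEta ℓ j (f t) :=
  (hf.2.2.2 j hj).mono (prod_mono_left hJ)

lemma MemC.contOnRect {ℓ T : ℝ} {h n : ℕ} {J : Set ℝ} (hJ : Icc 0 T ⊆ J) {f : ℝ → ℝ → ℝ}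
    (hf : MemC h n J (cell ℓ) f) : ContOnRect ℓ T f := by
  simpa only [dEta_zero] using hf.contOnRect_dEta hJ (Nat.zero_le n)

lemma MemC.contOnRect_dFst {ℓ T : ℝ} {n : ℕ} {J : Set ℝ} (hJ : Icc 0 T ⊆ J) {f : ℝ → ℝ → ℝ}
    (hf : MemC 1 n J (cell ℓ) f) : ContOnRect ℓ T (dFst J f) := by
  have h := (hf.2.2.1 1 le_rfl).mono (prod_mono_left (t := cell ℓ) hJ)
  simp only [iteratedDerivWithin_one] at h
  exact h

lemma MemC.hasDerivAt_dFst {ℓ T : ℝ} {n : ℕ} {J : Set ℝ} (hJ : Icc 0 T ⊆ J) {f : ℝ → ℝ → ℝ}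
    (hf : MemC 1 n J (cell ℓ) f) {t : ℝ} (ht : t ∈ Ioo 0 T) {η : ℝ} (hη : η ∈ cell ℓ) :
    HasDerivAt (fun t => f t η) (dFst J f t η) t := by
  have hn : J ∈ nhds t := Filter.mem_of_superset (Ioo_mem_nhds ht.1 ht.2)
    (Ioo_subset_Icc_self.trans hJ)
  have h := (hf.1 η hη).differentiableOn (by norm_num) t (hJ (Ioo_subset_Icc_self ht))
  exact h.hasDerivWithinAt.hasDerivAt hn

/-- If the time derivative is also continuous, periodicity carries over to it. -/
lemma periodic_of_hasDerivAt {T : ℝ} (hT : 0 < T) {a b a' b' : ℝ → ℝ}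
    (ha : ContinuousOn a' (Icc 0 T)) (hb : ContinuousOn b' (Icc 0 T))
    (hda : ∀ t ∈ Ioo 0 T, HasDerivAt a (a' t) t) (hdb : ∀ t ∈ Ioo 0 T, HasDerivAt b (b' t) t)
    (hab : ∀ t ∈ Icc 0 T, a t = b t) : ∀ t ∈ Icc 0 T, a' t = b' t := by
  have h : EqOn a' b' (Ioo 0 T) := fun t ht => by
    refine (hda t ht).unique ((hdb t ht).congr_of_eventuallyEq ?_)
    filter_upwards [Ioo_mem_nhds ht.1 ht.2] with s hs using hab s (Ioo_subset_Icc_self hs)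
  exact fun t ht => h.of_subset_closure ha hb Ioo_subset_Icc_self (by rw [closure_Ioo hT.ne]) ht

/-! ### Regularity of the solution of the Kuramoto–Sivashinsky equation -/

lemma hasSum_lam_cube_sq {ℓ : ℝ} (hℓ : 0 < ℓ) {f₀ f₁ f₂ f₃ : ℝ → ℝ}
    (h₀ : ∀ η ∈ cell ℓ, HasDerivWithinAt f₀ (f₁ η) (cell ℓ) η)
    (h₁ : ∀ η ∈ cell ℓ, HasDerivWithinAt f₁ (f₂ η) (cell ℓ) η)
    (h₂ : ∀ η ∈ cell ℓ, HasDerivWithinAt f₂ (f₃ η) (cell ℓ) η)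
    (h₃ : ContinuousOn f₃ (cell ℓ)) (p₀ : f₀ (-(ℓ / 2)) = f₀ (ℓ / 2))
    (p₁ : f₁ (-(ℓ / 2)) = f₁ (ℓ / 2)) (p₂ : f₂ (-(ℓ / 2)) = f₂ (ℓ / 2)) :
    HasSum (fun k => lam ℓ k ^ 3 * coef ℓ (fun η => f₀ η ^ 2) k ^ 2)
      (ℓ⁻¹ * ∫ η in (-(ℓ / 2))..(ℓ / 2), (6 * f₁ η * f₂ η + 2 * f₀ η * f₃ η) ^ 2) := by
  have c₀ : ContinuousOn f₀ (cell ℓ) := fun η hη => (h₀ η hη).continuousWithinAt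
  have c₁ : ContinuousOn f₁ (cell ℓ) := fun η hη => (h₁ η hη).continuousWithinAt
  have c₂ : ContinuousOn f₂ (cell ℓ) := fun η hη => (h₂ η hη).continuousWithinAt
  have d₀ : ∀ η ∈ cell ℓ, HasDerivWithinAt (fun η => f₀ η ^ 2) (2 * f₀ η * f₁ η) (cell ℓ) η :=
    fun η hη => ((h₀ η hη).pow 2).congr_deriv (by norm_num)
  have d₁ : ∀ η ∈ cell ℓ, HasDerivWithinAt (fun η => 2 * f₀ η * f₁ η)
      (2 * f₁ η ^ 2 + 2 * f₀ η * f₂ η) (cell ℓ) η := fun η hη =>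
    (((h₀ η hη).const_mul 2).mul (h₁ η hη)).congr_deriv (by ring)
  have d₂ : ∀ η ∈ cell ℓ, HasDerivWithinAt (fun η => 2 * f₁ η ^ 2 + 2 * f₀ η * f₂ η)
      (6 * f₁ η * f₂ η + 2 * f₀ η * f₃ η) (cell ℓ) η := fun η hη =>
    ((((h₁ η hη).pow 2).const_mul 2).add
      (((h₀ η hη).const_mul 2).mul (h₂ η hη))).congr_deriv (by norm_num; ring)
  have c₃ : ContinuousOn (fun η => 6 * f₁ η * f₂ η + 2 * f₀ η * f₃ η) (cell ℓ) := by fun_prop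
  have s₀ := hasSum_coef_sq hℓ c₃
  have s₁ := hasSum_lam_pow_succ hℓ d₂ c₃ (by simp only [p₀, p₁, p₂]) (j := 0) (by simpa using s₀)
  have s₂ := hasSum_lam_pow_succ hℓ d₁ (by fun_prop) (by simp only [p₀, p₁]) s₁
  exact hasSum_lam_pow_succ hℓ d₀ (by fun_prop) (by simp only [p₀]) s₂

lemma integral_sq_le {ℓ : ℝ} (hℓ : 0 < ℓ) {f : ℝ → ℝ} (hf : ContinuousOn f (cell ℓ)) {B : ℝ}
    (hB : ∀ η ∈ cell ℓ, f η ^ 2 ≤ B) :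
    ℓ⁻¹ * ∫ η in (-(ℓ / 2))..(ℓ / 2), f η ^ 2 ≤ B := by
  have h : ∫ η in (-(ℓ / 2))..(ℓ / 2), f η ^ 2 ≤ ∫ η in (-(ℓ / 2))..(ℓ / 2), B :=
    intervalIntegral.integral_mono_on (by linarith) (intervalIntegrable_of_cell hℓ (hf.pow 2))
      (by simp) fun η hη => hB η hη
  rw [intervalIntegral.integral_const, smul_eq_mul] at h
  rw [inv_mul_le_iff₀ hℓ]
  linarith

/-- The coefficients of the square of the slope. -/
noncomputable def slopeCoef (ℓ : ℝ) (φ : ℝ → ℝ) (k : ℤ) : ℝ :=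
  coef ℓ (fun η => dEta ℓ 1 φ η ^ 2) k

lemma SolvesKS.coef_equation {ℓ : ℝ} (hℓ : 0 < ℓ) {Φ₀ : ℝ → ℝ} {Φ : ℝ → ℝ → ℝ}
    (hΦ : SolvesKS ℓ Φ₀ Φ) {t : ℝ} (ht : 0 ≤ t) (k : ℤ) :
    coef ℓ (dFst (Ici 0) Φ t) k = -3 * (lam ℓ k ^ 2 * coef ℓ (Φ t) k) + lam ℓ k * coef ℓ (Φ t) k
      - 1 / 2 * slopeCoef ℓ (Φ t) k := by
  have hreg := hΦ.regular.2.1 t ht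
  have c : ∀ j ≤ 4, ContinuousOn (dEta ℓ j (Φ t)) (cell ℓ) := fun j hj =>
    continuousOn_dEta hℓ hreg hj
  have e := coef_congr hℓ (hΦ.equation t ht)
  have c1 := c 1 (by norm_num)
  have c2 := c 2 (by norm_num)
  have c4 := c 4 le_rfl
  have c41 : ContinuousOn (fun η => -3 * dEta ℓ 4 (Φ t) η) (cell ℓ) := by fun_prop
  have c42 : ContinuousOn (fun η => -3 * dEta ℓ 4 (Φ t) η - dEta ℓ 2 (Φ t) η) (cell ℓ) := by
    fun_prop
  have c12 : ContinuousOn (fun η => (1 / 2) * dEta ℓ 1 (Φ t) η ^ 2) (cell ℓ) := by fun_prop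
  have hp := hΦ.periodic t ht
  have e2 := coef_dEta_two hℓ hreg (j := 0) (by norm_num) (hp 0 (by norm_num)) (hp 1 (by norm_num)) k
  have e4 := coef_dEta_two hℓ hreg (j := 2) (by norm_num) (hp 2 (by norm_num)) (hp 3 (by norm_num)) k
  simp only [zero_add, dEta_zero] at e2
  norm_num at e4
  rw [e, coef_sub hℓ c42 c12, coef_sub hℓ c41 c2, coef_const_mul, coef_const_mul, e4, e2,
    slopeCoef]
  ring

/-- Three derivatives of `(Φ_η)²` involve at most four of `Φ`, exactly what `C^{1,4}` provides. This
makes the nonlinearity a bounded source at the level `λ³` of the energy estimate. -/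
lemma SolvesKS.slope_hasSum {ℓ : ℝ} (hℓ : 0 < ℓ) {Φ₀ : ℝ → ℝ} {Φ : ℝ → ℝ → ℝ}
    (hΦ : SolvesKS ℓ Φ₀ Φ) {t : ℝ} (ht : 0 ≤ t) :
    HasSum (fun k => lam ℓ k ^ 3 * slopeCoef ℓ (Φ t) k ^ 2)
      (ℓ⁻¹ * ∫ η in (-(ℓ / 2))..(ℓ / 2), (6 * dEta ℓ 2 (Φ t) η * dEta ℓ 3 (Φ t) η
        + 2 * dEta ℓ 1 (Φ t) η * dEta ℓ 4 (Φ t) η) ^ 2) := by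
  have hreg := hΦ.regular.2.1 t ht
  have hp := hΦ.periodic t ht
  exact hasSum_lam_cube_sq hℓ (hasDerivWithinAt_dEta hℓ hreg (by norm_num))
    (hasDerivWithinAt_dEta hℓ hreg (by norm_num)) (hasDerivWithinAt_dEta hℓ hreg (by norm_num))
    (continuousOn_dEta hℓ hreg le_rfl) (hp 1 (by norm_num)) (hp 2 (by norm_num)) (hp 3 le_rfl)

lemma Icc_subset_Ici_zero (T : ℝ) : Icc 0 T ⊆ Ici 0 := fun _ ht => ht.1

/-- Uniform bounds on the derivatives of the solution. -/
lemma SolvesKS.bounds {ℓ : ℝ} {Φ₀ : ℝ → ℝ} {Φ : ℝ → ℝ → ℝ} (hΦ : SolvesKS ℓ Φ₀ Φ) (T : ℝ) :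
    ∃ A, 1 ≤ A ∧ ∀ t ∈ Icc 0 T, ∀ η ∈ cell ℓ, ∀ j ≤ 4, |dEta ℓ j (Φ t) η| ≤ A := by
  have h : ∀ j ≤ 4, ∃ C, 0 ≤ C ∧ ∀ t ∈ Icc 0 T, ∀ η ∈ cell ℓ, |dEta ℓ j (Φ t) η| ≤ C := fun j hj =>
    (hΦ.regular.contOnRect_dEta (Icc_subset_Ici_zero T) hj).bound
  choose! C hC hb using h
  refine ⟨1 + ∑ j ∈ Finset.range 5, C j, ?_, fun t ht η hη j hj => (hb j hj t ht η hη).trans ?_⟩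
  · have : 0 ≤ ∑ j ∈ Finset.range 5, C j :=
      Finset.sum_nonneg fun j hj => hC j (by rw [Finset.mem_range] at hj; omega)
    linarith
  · have := Finset.single_le_sum (f := C) (s := Finset.range 5)
      (fun j hj => hC j (by rw [Finset.mem_range] at hj; omega)) (Finset.mem_range.2 (by omega : j < 5))
    linarith

/-- With `f` a coefficient of `Φ` and `n` one of `(Φ_η)²`, this is the equation multiplied by `λ⁵
f`. The antidiffusive term is interpolated by `λ⁶ ≤ λ⁷ + λ⁴`, and the nonlinear one is absorbed by
completing a square. One unit of the dissipation `λ⁷ f²` remains. -/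
lemma energy_pointwise {l f n : ℝ} (hl : 0 ≤ l) :
    l ^ 7 * f ^ 2 + l ^ 5 * f * (-3 * (l ^ 2 * f) + l * f - 1 / 2 * n)
      ≤ l ^ 4 * f ^ 2 + l ^ 3 * n ^ 2 := by
  have h6 : l ^ 6 ≤ l ^ 7 + l ^ 4 := by
    rcases le_total l 1 with h | h
    · have : l ^ 6 ≤ l ^ 4 := pow_le_pow_of_le_one hl h (by norm_num)
      have : 0 ≤ l ^ 7 := by positivity
      linarith
    · have : l ^ 6 ≤ l ^ 7 := pow_le_pow_right₀ h (by norm_num)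
      have : 0 ≤ l ^ 4 := by positivity
      linarith
  have h1 := mul_le_mul_of_nonneg_right h6 (sq_nonneg f)
  have h2 : 0 ≤ l ^ 3 * (l ^ 2 * f + 1 / 4 * n) ^ 2 := by positivity
  have h3 : 0 ≤ l ^ 3 * n ^ 2 := by positivity
  nlinarith

/-- The equation converts the dissipation `λ⁷ f²` into a bound of `λ³` times the squared time
derivative; `λ⁵` is interpolated between `λ⁷` and `λ⁴`. -/
lemma deriv_pointwise {l f n : ℝ} (hl : 0 ≤ l) :
    l ^ 5 * f ^ 2 + l ^ 3 * (-3 * (l ^ 2 * f) + l * f - 1 / 2 * n) ^ 2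
      ≤ 31 * (l ^ 7 * f ^ 2) + 4 * (l ^ 4 * f ^ 2) + l ^ 3 * n ^ 2 := by
  have h5 : l ^ 5 ≤ l ^ 7 + l ^ 4 := by
    rcases le_total l 1 with h | h
    · have : l ^ 5 ≤ l ^ 4 := pow_le_pow_of_le_one hl h (by norm_num)
      have : 0 ≤ l ^ 7 := by positivity
      linarith
    · have : l ^ 5 ≤ l ^ 7 := pow_le_pow_right₀ h (by norm_num)
      have : 0 ≤ l ^ 4 := by positivity
      linarith
  have h1 := mul_le_mul_of_nonneg_right h5 (sq_nonneg f)
  have h2 : (-3 * (l ^ 2 * f) + l * f - 1 / 2 * n) ^ 2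
      ≤ 27 * (l ^ 2 * f) ^ 2 + 3 * (l * f) ^ 2 + 3 / 4 * n ^ 2 := by
    nlinarith [sq_nonneg (-3 * (l ^ 2 * f) - l * f), sq_nonneg (-3 * (l ^ 2 * f) + 1 / 2 * n),
      sq_nonneg (l * f + 1 / 2 * n)]
  have h3 := mul_le_mul_of_nonneg_left h2 (by positivity : 0 ≤ l ^ 3)
  have h4 : 0 ≤ l ^ 3 * n ^ 2 := by positivity
  nlinarith

/-- The parabolic smoothing estimate, in terms of the coefficients. -/
lemma SolvesKS.energy {ℓ : ℝ} (hℓ : 0 < ℓ) {α : ℝ} {Φ₀ : ℝ → ℝ} (hΦ₀ : MemCSharp ℓ 6 α Φ₀)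
    {Φ : ℝ → ℝ → ℝ} (hΦ : SolvesKS ℓ Φ₀ Φ) {T : ℝ} (hT : 0 < T) :
    ∃ C, 0 ≤ C ∧ ∀ N : Finset ℤ, ∫ t in (0 : ℝ)..T, ∑ k ∈ N, (lam ℓ k ^ 5 * coef ℓ (Φ t) k ^ 2
      + lam ℓ k ^ 3 * coef ℓ (dFst (Ici 0) Φ t) k ^ 2) ≤ C := by
  obtain ⟨A, hA, hbd⟩ := hΦ.bounds T
  have hJ := Icc_subset_Ici_zero T
  -- The energy at time zero is the mean square of the fifth derivative of the initial datum.
  set E₀ := ℓ⁻¹ * ∫ η in (-(ℓ / 2))..(ℓ / 2), dEta ℓ 5 Φ₀ η ^ 2 with hE₀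
  have hE₀' : 0 ≤ E₀ := mul_nonneg (inv_pos.2 hℓ).le
    (intervalIntegral.integral_nonneg (by linarith) fun _ _ => sq_nonneg _)
  have cf : ∀ k, ContinuousOn (fun t => coef ℓ (Φ t) k) (Icc 0 T) := fun k =>
    (hΦ.regular.contOnRect hJ).continuousOn_coef hℓ k
  have cf' : ∀ k, ContinuousOn (fun t => coef ℓ (dFst (Ici 0) Φ t) k) (Icc 0 T) := fun k =>
    (hΦ.regular.contOnRect_dFst hJ).continuousOn_coef hℓ k
  have cn : ∀ k, ContinuousOn (fun t => slopeCoef ℓ (Φ t) k) (Icc 0 T) := fun k =>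
    ((hΦ.regular.contOnRect_dEta hJ (by norm_num : 1 ≤ 4)).pow 2).continuousOn_coef hℓ k
  have hint : ∀ {g : ℝ → ℝ}, ContinuousOn g (Icc 0 T) → IntervalIntegrable g volume 0 T :=
    fun hg => ContinuousOn.intervalIntegrable (by rwa [uIcc_of_le hT.le])
  have cint : ∀ {g : ℤ → ℝ → ℝ} (N : Finset ℤ), (∀ k, ContinuousOn (g k) (Icc 0 T)) →
      ContinuousOn (fun t => ∑ k ∈ N, g k t) (Icc 0 T) := fun N hg =>
    continuousOn_finsetSum _ fun k _ => hg k
  have c7 : ∀ k, ContinuousOn (fun t => lam ℓ k ^ 7 * coef ℓ (Φ t) k ^ 2) (Icc 0 T) := fun k =>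
    ((cf k).pow 2).const_mul _
  have c4 : ∀ k, ContinuousOn (fun t => lam ℓ k ^ 4 * coef ℓ (Φ t) k ^ 2
      + lam ℓ k ^ 3 * slopeCoef ℓ (Φ t) k ^ 2) (Icc 0 T) := fun k =>
    (((cf k).pow 2).const_mul _).add (((cn k).pow 2).const_mul _)
  set B := A ^ 2 + (8 * A ^ 2) ^ 2 with hB
  have hsum4 : ∀ N : Finset ℤ, ∀ t ∈ Icc 0 T, ∑ k ∈ N, (lam ℓ k ^ 4 * coef ℓ (Φ t) k ^ 2
      + lam ℓ k ^ 3 * slopeCoef ℓ (Φ t) k ^ 2) ≤ B := fun N t ht => by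
    have hreg := hΦ.regular.2.1 t ht.1
    have c : ∀ j ≤ 4, ContinuousOn (dEta ℓ j (Φ t)) (cell ℓ) := fun j hj =>
      continuousOn_dEta hℓ hreg hj
    have b := fun j hj η hη => hbd t ht η hη j hj
    rw [Finset.sum_add_distrib]
    refine add_le_add ?_ ?_
    · refine (sum_le_hasSum N (fun k _ => mul_nonneg (pow_nonneg (lam_nonneg ℓ k) _) (sq_nonneg _))
        (hasSum_lam_pow_dEta hℓ hreg le_rfl fun i hi =>
          hΦ.periodic t ht.1 i (by omega))).trans ?_
      refine integral_sq_le hℓ (c 4 le_rfl) fun η hη => ?_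
      rw [← sq_abs]
      exact pow_le_pow_left₀ (abs_nonneg _) (b 4 le_rfl η hη) 2
    · refine (sum_le_hasSum N (fun k _ => mul_nonneg (pow_nonneg (lam_nonneg ℓ k) _) (sq_nonneg _))
        (hΦ.slope_hasSum hℓ ht.1)).trans ?_
      have c1 := c 1 (by norm_num)
      have c2 := c 2 (by norm_num)
      have c3 := c 3 (by norm_num)
      have c4 := c 4 (by norm_num)
      refine integral_sq_le hℓ (by fun_prop) fun η hη => ?_
      rw [← sq_abs]
      refine pow_le_pow_left₀ (abs_nonneg _) ?_ 2
      refine (abs_add_le _ _).trans ?_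
      rw [mul_assoc 6, mul_assoc 2, abs_mul 6, abs_mul 2, abs_mul, abs_mul]
      norm_num
      have b1 := b 1 (by norm_num) η hη
      have b2 := b 2 (by norm_num) η hη
      have b3 := b 3 (by norm_num) η hη
      have b4 := b 4 (by norm_num) η hη
      have := mul_le_mul b2 b3 (abs_nonneg _) (by linarith)
      have := mul_le_mul b1 b4 (abs_nonneg _) (by linarith)
      nlinarith
  have h7 : ∀ N : Finset ℤ, ∫ t in (0 : ℝ)..T, ∑ k ∈ N, lam ℓ k ^ 7 * coef ℓ (Φ t) k ^ 2
      ≤ E₀ + T * B := fun N => by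
    -- The fifth derivative of `Φ(t)` is not known to exist for `t > 0`, so the energy is truncated
    -- to finitely many modes. Every bound is independent of `N`.
    set g : ℝ → ℝ := fun t => ∑ k ∈ N, (1 / 2) * (lam ℓ k ^ 5 * coef ℓ (Φ t) k ^ 2) with hg
    set g' : ℝ → ℝ := fun t => ∑ k ∈ N, lam ℓ k ^ 5 * coef ℓ (Φ t) k *
      coef ℓ (dFst (Ici 0) Φ t) k with hg'
    have cg' : ContinuousOn g' (Icc 0 T) := cint N fun k => ((cf k).const_mul _).mul (cf' k)
    have hftc : ∫ t in (0 : ℝ)..T, g' t = g T - g 0 :=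
      intervalIntegral.integral_eq_sub_of_hasDerivAt_of_le hT.le
        (cint N fun k => (((cf k).pow 2).const_mul _).const_mul _)
        (fun t ht => by
          refine HasDerivAt.fun_sum fun k _ => ?_
          have := hasDerivAt_coef hℓ (hΦ.regular.contOnRect hJ) (hΦ.regular.contOnRect_dFst hJ)
            (fun t ht η hη => hΦ.regular.hasDerivAt_dFst hJ ht hη) ht k
          exact (((this.pow 2).const_mul _).const_mul _).congr_deriv (by norm_num; ring))
        (hint cg')
    have hgT : 0 ≤ g T := Finset.sum_nonneg fun k _ =>
      mul_nonneg (by norm_num) (mul_nonneg (pow_nonneg (lam_nonneg ℓ k) _) (sq_nonneg _))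
    have hg0 : g 0 ≤ E₀ := by
      have e : coef ℓ (Φ 0) = coef ℓ Φ₀ := coef_congr hℓ fun η hη => hΦ.initial η hη
      have hs := sum_le_hasSum N (fun k _ => mul_nonneg (pow_nonneg (lam_nonneg ℓ k) _)
        (sq_nonneg _)) (hasSum_lam_pow_dEta hℓ hΦ₀.1 (by norm_num : 5 ≤ 6) fun i hi =>
          hΦ₀.2.2 i (by omega))
      simp only [hg, e]
      rw [← Finset.mul_sum]
      have : 0 ≤ ∑ k ∈ N, lam ℓ k ^ 5 * coef ℓ Φ₀ k ^ 2 := Finset.sum_nonneg fun k _ =>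
        mul_nonneg (pow_nonneg (lam_nonneg ℓ k) _) (sq_nonneg _)
      linarith
    have hle : ∫ t in (0 : ℝ)..T, ((∑ k ∈ N, lam ℓ k ^ 7 * coef ℓ (Φ t) k ^ 2) + g' t)
        ≤ ∫ t in (0 : ℝ)..T, B := by
      refine intervalIntegral.integral_mono_on hT.le (hint ((cint N c7).add cg')) (by simp)
        fun t ht => ?_
      refine le_trans ?_ (hsum4 N t ht)
      simp only [hg']
      rw [← Finset.sum_add_distrib]
      refine Finset.sum_le_sum fun k _ => ?_
      rw [hΦ.coef_equation hℓ ht.1 k]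
      exact energy_pointwise (lam_nonneg ℓ k)
    rw [intervalIntegral.integral_add (hint (cint N c7)) (hint cg'), hftc,
      intervalIntegral.integral_const, smul_eq_mul, sub_zero] at hle
    linarith
  refine ⟨31 * (E₀ + T * B) + 4 * (T * B), by positivity, fun N => ?_⟩
  have hle : ∫ t in (0 : ℝ)..T, ∑ k ∈ N, (lam ℓ k ^ 5 * coef ℓ (Φ t) k ^ 2
      + lam ℓ k ^ 3 * coef ℓ (dFst (Ici 0) Φ t) k ^ 2)
      ≤ ∫ t in (0 : ℝ)..T, (31 * (∑ k ∈ N, lam ℓ k ^ 7 * coef ℓ (Φ t) k ^ 2) + 4 * B) := by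
    refine intervalIntegral.integral_mono_on hT.le (hint (cint N fun k =>
      (((cf k).pow 2).const_mul _).add (((cf' k).pow 2).const_mul _)))
      (hint (((cint N c7).const_mul _).add continuousOn_const)) fun t ht => ?_
    have h1 := hsum4 N t ht
    have h2 : ∑ k ∈ N, (lam ℓ k ^ 5 * coef ℓ (Φ t) k ^ 2
        + lam ℓ k ^ 3 * coef ℓ (dFst (Ici 0) Φ t) k ^ 2)
        ≤ ∑ k ∈ N, (31 * (lam ℓ k ^ 7 * coef ℓ (Φ t) k ^ 2)
          + 4 * (lam ℓ k ^ 4 * coef ℓ (Φ t) k ^ 2 + lam ℓ k ^ 3 * slopeCoef ℓ (Φ t) k ^ 2)) := by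
      refine Finset.sum_le_sum fun k _ => ?_
      rw [hΦ.coef_equation hℓ ht.1 k]
      refine (deriv_pointwise (lam_nonneg ℓ k)).trans ?_
      have : 0 ≤ lam ℓ k ^ 3 * slopeCoef ℓ (Φ t) k ^ 2 :=
        mul_nonneg (pow_nonneg (lam_nonneg ℓ k) _) (sq_nonneg _)
      linarith
    refine h2.trans ?_
    rw [Finset.sum_add_distrib, ← Finset.mul_sum, ← Finset.mul_sum]
    linarith
  rw [intervalIntegral.integral_add (hint ((cint N c7).const_mul _)) (by simp),
    intervalIntegral.integral_const_mul, intervalIntegral.integral_const, smul_eq_mul] at hle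
  have := h7 N
  linarith

/-- Tonelli for series of nonnegative functions: a bound uniform over the finite sums passes to the
integral of the full series, with values in `[0, ∞]`, so no summability is presupposed. -/
lemma lintegral_tsum_le_of_integral_le {T : ℝ} (hT : 0 ≤ T) {g : ℤ → ℝ → ℝ} {C : ℝ}
    (hg : ∀ k, ContinuousOn (g k) (Icc 0 T)) (hg0 : ∀ k, ∀ t, 0 ≤ g k t)
    (h : ∀ N : Finset ℤ, ∫ t in (0 : ℝ)..T, ∑ k ∈ N, g k t ≤ C) :
    ∫⁻ t in Ioc 0 T, ∑' k, ENNReal.ofReal (g k t) ≤ ENNReal.ofReal C := by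
  set μ := volume.restrict (Ioc 0 T)
  have hm : ∀ k, AEMeasurable (fun t => ENNReal.ofReal (g k t)) μ := fun k =>
    (((hg k).mono Ioc_subset_Icc_self).aemeasurable measurableSet_Ioc).ennreal_ofReal
  have hi : ∀ k, Integrable (g k) μ := fun k =>
    ((hg k).integrableOn_Icc).mono_set Ioc_subset_Icc_self
  rw [lintegral_tsum hm, ENNReal.tsum_eq_iSup_sum]
  refine iSup_le fun N => ?_
  rw [← lintegral_finsetSum' _ fun k _ => hm k]
  have e : ∀ t, ∑ k ∈ N, ENNReal.ofReal (g k t) = ENNReal.ofReal (∑ k ∈ N, g k t) := fun t =>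
    (ENNReal.ofReal_sum_of_nonneg fun k _ => hg0 k t).symm
  simp only [e]
  rw [← ofReal_integral_eq_lintegral_ofReal (integrable_finsetSum _ fun k _ => hi k)
    (ae_of_all _ fun t => Finset.sum_nonneg fun k _ => hg0 k t)]
  have := h N
  rw [intervalIntegral.integral_of_le hT] at this
  exact ENNReal.ofReal_le_ofReal this

/-- A family of nonnegative continuous functions whose finite sums have bounded integrals is
summable almost everywhere. -/
lemma ae_summable_of_integral_le {T : ℝ} (hT : 0 ≤ T) {g : ℤ → ℝ → ℝ} {C : ℝ}
    (hg : ∀ k, ContinuousOn (g k) (Icc 0 T)) (hg0 : ∀ k, ∀ t, 0 ≤ g k t)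
    (h : ∀ N : Finset ℤ, ∫ t in (0 : ℝ)..T, ∑ k ∈ N, g k t ≤ C) :
    ∀ᵐ t ∂(volume.restrict (Ioc 0 T)), Summable fun k => g k t := by
  have hfin := ae_lt_top' (AEMeasurable.tsum fun k =>
    (((hg k).mono Ioc_subset_Icc_self).aemeasurable measurableSet_Ioc).ennreal_ofReal)
    ((lintegral_tsum_le_of_integral_le hT hg hg0 h).trans_lt ENNReal.ofReal_lt_top).ne
  filter_upwards [hfin] with t ht
  have h1 := ENNReal.summable_toReal ht.ne
  refine h1.congr fun k => ?_
  rw [ENNReal.toReal_ofReal (hg0 k t)]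

/-- The integral of the sum of a series of nonnegative continuous functions is bounded by a common
bound for the integrals of the finite sums. -/
lemma integral_hasSum_le {T : ℝ} (hT : 0 ≤ T) {g : ℤ → ℝ → ℝ} {G : ℝ → ℝ} {C : ℝ}
    (hg : ∀ k, ContinuousOn (g k) (Icc 0 T)) (hg0 : ∀ k, ∀ t, 0 ≤ g k t)
    (hG : ContinuousOn G (Icc 0 T)) (hs : ∀ t ∈ Icc 0 T, HasSum (fun k => g k t) (G t))
    (h : ∀ N : Finset ℤ, ∫ t in (0 : ℝ)..T, ∑ k ∈ N, g k t ≤ C) :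
    ∫ t in (0 : ℝ)..T, G t ≤ C := by
  have hC : 0 ≤ C := by simpa using h ∅
  have hG0 : ∀ t ∈ Icc 0 T, 0 ≤ G t := fun t ht => (hs t ht).nonneg fun k => hg0 k t
  have hle := lintegral_tsum_le_of_integral_le hT hg hg0 h
  have e : ∫⁻ t in Ioc 0 T, ∑' k, ENNReal.ofReal (g k t) = ∫⁻ t in Ioc 0 T, ENNReal.ofReal (G t) :=
    setLIntegral_congr_fun measurableSet_Ioc fun t ht => by
      have ht' := hs t (Ioc_subset_Icc_self ht)
      rw [← ENNReal.ofReal_tsum_of_nonneg (fun k => hg0 k t) ht'.summable, ht'.tsum_eq]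
  rw [e, ← ofReal_integral_eq_lintegral_ofReal (hG.integrableOn_Icc.mono_set Ioc_subset_Icc_self)
    (by filter_upwards [ae_restrict_mem measurableSet_Ioc] with t ht
        exact hG0 t (Ioc_subset_Icc_self ht)), ENNReal.ofReal_le_ofReal_iff hC] at hle
  rwa [intervalIntegral.integral_of_le hT]

/-- The integrated smoothing estimate forces finiteness for almost every time. At such times `Φ_τ`
has enough regularity for `ℋ_ε(Φ)` to be evaluated through its coefficients. -/
lemma SolvesKS.ae_summable {ℓ : ℝ} (hℓ : 0 < ℓ) {α : ℝ} {Φ₀ : ℝ → ℝ} (hΦ₀ : MemCSharp ℓ 6 α Φ₀)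
    {Φ : ℝ → ℝ → ℝ} (hΦ : SolvesKS ℓ Φ₀ Φ) {T : ℝ} (hT : 0 < T) :
    ∀ᵐ t ∂(volume.restrict (Ioc 0 T)),
      Summable fun k => lam ℓ k ^ 3 * coef ℓ (dFst (Ici 0) Φ t) k ^ 2 := by
  obtain ⟨C, -, hC⟩ := hΦ.energy hℓ hΦ₀ hT
  have hJ := Icc_subset_Ici_zero T
  have h := ae_summable_of_integral_le hT.le (fun k =>
    ((((hΦ.regular.contOnRect hJ).continuousOn_coef hℓ k).pow 2).const_mul (lam ℓ k ^ 5)).add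
      ((((hΦ.regular.contOnRect_dFst hJ).continuousOn_coef hℓ k).pow 2).const_mul (lam ℓ k ^ 3)))
    (fun k t => add_nonneg (mul_nonneg (pow_nonneg (lam_nonneg ℓ k) _) (sq_nonneg _))
      (mul_nonneg (pow_nonneg (lam_nonneg ℓ k) _) (sq_nonneg _))) hC
  filter_upwards [h] with t ht
  refine ht.of_nonneg_of_le (fun k => mul_nonneg (pow_nonneg (lam_nonneg ℓ k) _) (sq_nonneg _))
    fun k => ?_
  exact le_add_of_nonneg_left (mul_nonneg (pow_nonneg (lam_nonneg ℓ k) 5) (sq_nonneg _))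

/-! ### The symbols of the operators in the equation for the remainder -/

lemma lam_eq_rootS {ℓ ε : ℝ} (hε : 0 < ε) (k : ℤ) :
    lam ℓ k = rootS (ε * lam ℓ k) * (rootS (ε * lam ℓ k) - 1) / ε := by
  rw [rootS_mul (mul_nonneg hε.le (lam_nonneg ℓ k))]; field_simp

/-- The trace of the resolvent is continuous, with known coefficients. -/
lemma traceDR_coef {ℓ : ℝ} (hℓ : 0 < ℓ) {ε : ℝ} (hε : 0 < ε) {φ χ : ℝ → ℝ}
    (hφ : ContinuousOn φ (cell ℓ)) (hχ : ContinuousOn χ (cell ℓ))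
    (sφ : Summable fun k => |coef ℓ φ k|) (sχ : Summable fun k => |coef ℓ χ k|) :
    ContinuousOn (traceDR ℓ ε (sourceAB φ χ)) (cell ℓ) ∧
    ∀ k, coef ℓ (traceDR ℓ ε (sourceAB φ χ)) k
      = -(lam ℓ k * traceSymbol (rootS (ε * lam ℓ k)) (coef ℓ φ k) (coef ℓ χ k)) := by
  have h := traceDR_sourceAB hℓ hε hφ hχ sφ sχ
  have hs : Summable fun k => |-(lam ℓ k * traceCoef ℓ ε φ χ k)| := by
    simp only [abs_neg]
    exact ((sφ.add sχ).mul_left ε⁻¹).of_nonneg_of_le (fun _ => abs_nonneg _) fun k =>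
      abs_lam_traceSymbol_le hε k _ _
  refine ⟨(continuous_casSum ℓ hs).continuousOn.congr h, fun k => ?_⟩
  rw [coef_congr hℓ h, coef_casSum hℓ hs]
  rfl

lemma coef_zero_fun (ℓ : ℝ) (k : ℤ) : coef ℓ (fun _ => 0) k = 0 := by simp [coef]

lemma tensor_vecA (φ : ℝ → ℝ) : tensor φ vecA = sourceAB φ fun _ => 0 := by
  ext <;> simp [sourceAB, tensor]

lemma tensor_vecB (χ : ℝ → ℝ) : tensor χ vecB = sourceAB (fun _ => 0) χ := by
  ext <;> simp [sourceAB, tensor]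

lemma traceDR_vecA {ℓ : ℝ} (hℓ : 0 < ℓ) {ε : ℝ} (hε : 0 < ε) {φ : ℝ → ℝ}
    (hφ : ContinuousOn φ (cell ℓ)) (sφ : Summable fun k => |coef ℓ φ k|) :
    ContinuousOn (traceDR ℓ ε (tensor φ vecA)) (cell ℓ) ∧
    ∀ k, coef ℓ (traceDR ℓ ε (tensor φ vecA)) k
      = -(lam ℓ k * traceSymbol (rootS (ε * lam ℓ k)) (coef ℓ φ k) 0) := by
  have h := traceDR_coef hℓ hε hφ (χ := fun _ => 0) continuousOn_const sφ
    (by simp [coef_zero_fun])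
  simpa only [coef_zero_fun, ← tensor_vecA] using h

lemma traceDR_vecB {ℓ : ℝ} (hℓ : 0 < ℓ) {ε : ℝ} (hε : 0 < ε) {χ : ℝ → ℝ}
    (hχ : ContinuousOn χ (cell ℓ)) (sχ : Summable fun k => |coef ℓ χ k|) :
    ContinuousOn (traceDR ℓ ε (tensor χ vecB)) (cell ℓ) ∧
    ∀ k, coef ℓ (traceDR ℓ ε (tensor χ vecB)) k
      = -(lam ℓ k * traceSymbol (rootS (ε * lam ℓ k)) 0 (coef ℓ χ k)) := by
  have h := traceDR_coef hℓ hε (φ := fun _ => 0) continuousOn_const hχ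
    (by simp [coef_zero_fun]) sχ
  simpa only [coef_zero_fun, ← tensor_vecB] using h

/-- The symbol of `ℬ_ε`. -/
noncomputable def symB (ℓ ε : ℝ) (k : ℤ) : ℝ :=
  3 * rootS (ε * lam ℓ k) * (2 * rootS (ε * lam ℓ k) ^ 2 - 1) / (2 * rootS (ε * lam ℓ k) + 1)

/-- The symbol of `𝒮_ε`. -/
noncomputable def symS (ℓ ε : ℝ) (k : ℤ) : ℝ :=
  -3 * (1 - ε) * lam ℓ k ^ 2 + lam ℓ k
    + ε * lam ℓ k ^ 2 / (rootS (ε * lam ℓ k) * (2 * rootS (ε * lam ℓ k) + 1))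

/-- The symbol of `𝒢_ε`. -/
noncomputable def symG (ℓ ε : ℝ) (k : ℤ) : ℝ :=
  -lam ℓ k * (6 * rootS (ε * lam ℓ k) ^ 2 + 9 * rootS (ε * lam ℓ k) + 1)
    / (2 * rootS (ε * lam ℓ k) * (2 * rootS (ε * lam ℓ k) + 1))

lemma one_le_rootS_lam {ℓ ε : ℝ} (hε : 0 < ε) (k : ℤ) : 1 ≤ rootS (ε * lam ℓ k) :=
  one_le_rootS (mul_nonneg hε.le (lam_nonneg ℓ k))

/-- After clearing the denominator the difference of the two sides is `(s² - 1) (4 s + 1) ≥ 0`. The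
summand `ε λ`, and not merely positivity, is what later absorbs the part of `𝒢_ε` that depends on
`ρ`. -/
lemma symB_ge {ℓ ε : ℝ} (hε : 0 < ε) (k : ℤ) : 1 + ε * lam ℓ k ≤ symB ℓ ε k := by
  have hs := one_le_rootS_lam (ℓ := ℓ) hε k
  have hp := rootS_mul (mul_nonneg hε.le (lam_nonneg ℓ k))
  unfold symB
  set s := rootS (ε * lam ℓ k)
  rw [← hp, le_div_iff₀ (by linarith)]
  nlinarith [mul_nonneg (by linarith : 0 ≤ s) (sub_nonneg.2 hs),
    mul_nonneg (mul_nonneg (by linarith : 0 ≤ s) (sub_nonneg.2 hs)) (by linarith : 0 ≤ s)]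

/-- A second-order upper bound; it is used to carry the convergence of difference quotients of `ρ`,
weighted by `1 + λ`, over to those of `ℬ_ε(ρ)`. -/
lemma abs_symB_le {ℓ ε : ℝ} (hε : 0 < ε) (k : ℤ) : |symB ℓ ε k| ≤ 6 * (1 + ε * lam ℓ k) := by
  have hs := one_le_rootS_lam (ℓ := ℓ) hε k
  have hp := rootS_mul (mul_nonneg hε.le (lam_nonneg ℓ k))
  have h0 : 0 ≤ symB ℓ ε k := le_trans (by have := lam_nonneg ℓ k; positivity) (symB_ge hε k)
  rw [abs_of_nonneg h0]
  unfold symB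
  set s := rootS (ε * lam ℓ k)
  rw [← hp, div_le_iff₀ (by linarith)]
  nlinarith [mul_nonneg (by linarith : 0 ≤ s) (sub_nonneg.2 hs), sq_nonneg (s - 1),
    mul_nonneg (mul_nonneg (by linarith : 0 ≤ s) (sub_nonneg.2 hs)) (by linarith : 0 ≤ s),
    mul_nonneg (mul_nonneg (by linarith : 0 ≤ s) (sub_nonneg.2 hs)) (sub_nonneg.2 hs)]

lemma abs_symG_le {ℓ ε : ℝ} (hε : 0 < ε) (k : ℤ) : |symG ℓ ε k| ≤ 3 * lam ℓ k := by
  have hs := one_le_rootS_lam (ℓ := ℓ) hε k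
  have hl := lam_nonneg ℓ k
  unfold symG
  set s := rootS (ε * lam ℓ k)
  have h1 : 0 < 2 * s * (2 * s + 1) := by positivity
  rw [abs_div, abs_of_pos h1, div_le_iff₀ h1, abs_mul, abs_neg, abs_of_nonneg hl,
    abs_of_pos (by positivity)]
  nlinarith [mul_nonneg hl (by nlinarith : 0 ≤ 6 * s ^ 2 - 3 * s - 1)]

/-- The shift by `λ` compensates the antidiffusion `-ψ_ηη`. Of the factor `3 (1 - ε) ≥ 3/2` in front
of `λ²`, the nonlocal term consumes at most `ε/3`, because `s (2s + 1) ≥ 3`. -/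
lemma neg_symS_ge {ℓ ε : ℝ} (hε : 0 < ε) (hε' : ε ≤ 1 / 2) (k : ℤ) :
    lam ℓ k ^ 2 ≤ lam ℓ k - symS ℓ ε k := by
  have hs := one_le_rootS_lam (ℓ := ℓ) hε k
  unfold symS
  set s := rootS (ε * lam ℓ k)
  have h1 : ε * lam ℓ k ^ 2 / (s * (2 * s + 1)) ≤ ε * lam ℓ k ^ 2 / 3 :=
    div_le_div_of_nonneg_left (by positivity) (by norm_num) (by nlinarith)
  nlinarith [sq_nonneg (lam ℓ k), mul_nonneg (sub_nonneg.2 hε') (sq_nonneg (lam ℓ k))]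

/-! ### The coefficients of the operators -/

section Operators

variable {ℓ : ℝ} {ψ : ℝ → ℝ}

lemma coef_dEta_two' (hℓ : 0 < ℓ) (hψ : ContDiffOn ℝ 4 ψ (cell ℓ))
    (hp : ∀ j ≤ 3, dEta ℓ j ψ (-(ℓ / 2)) = dEta ℓ j ψ (ℓ / 2)) (k : ℤ) :
    coef ℓ (dEta ℓ 2 ψ) k = -(lam ℓ k * coef ℓ ψ k) := by
  have := coef_dEta_two hℓ (n := 4) hψ (j := 0) (by norm_num) (hp 0 (by norm_num))
    (hp 1 (by norm_num)) k
  simpa only [zero_add, dEta_zero] using this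

lemma coef_dEta_four (hℓ : 0 < ℓ) (hψ : ContDiffOn ℝ 4 ψ (cell ℓ))
    (hp : ∀ j ≤ 3, dEta ℓ j ψ (-(ℓ / 2)) = dEta ℓ j ψ (ℓ / 2)) (k : ℤ) :
    coef ℓ (dEta ℓ 4 ψ) k = lam ℓ k ^ 2 * coef ℓ ψ k := by
  have := coef_dEta_two hℓ (n := 4) hψ (j := 2) (by norm_num) (hp 2 (by norm_num))
    (hp 3 (by norm_num)) k
  rw [coef_dEta_two' hℓ hψ hp] at this
  rw [this]; ring

lemma summable_coef_dEta_two (hℓ : 0 < ℓ) (hψ : ContDiffOn ℝ 4 ψ (cell ℓ))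
    (hp : ∀ j ≤ 3, dEta ℓ j ψ (-(ℓ / 2)) = dEta ℓ j ψ (ℓ / 2)) :
    Summable fun k => |coef ℓ (dEta ℓ 2 ψ) k| := by
  refine summable_abs_of_lam_sq hℓ ?_
  refine (hasSum_lam_pow_dEta hℓ (n := 4) hψ (by norm_num : 3 ≤ 4) fun i hi =>
    hp i (by omega)).summable.congr fun k => ?_
  rw [coef_dEta_two' hℓ hψ hp]; ring

lemma opB_coef (hℓ : 0 < ℓ) {ε : ℝ} (hε : 0 < ε) (hψ : ContDiffOn ℝ 4 ψ (cell ℓ))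
    (hp : ∀ j ≤ 3, dEta ℓ j ψ (-(ℓ / 2)) = dEta ℓ j ψ (ℓ / 2)) :
    ContinuousOn (opB ℓ ε ψ) (cell ℓ) ∧ ∀ k, coef ℓ (opB ℓ ε ψ) k = symB ℓ ε k * coef ℓ ψ k := by
  have c2 := continuousOn_dEta hℓ (n := 4) hψ (by norm_num : 2 ≤ 4)
  have c0 := hψ.continuousOn
  obtain ⟨ct, ht⟩ := traceDR_vecB hℓ hε c2 (summable_coef_dEta_two hℓ hψ hp)
  have c1 : ContinuousOn (fun η => ψ η - 13 * ε / 3 * dEta ℓ 2 ψ η) (cell ℓ) := by fun_prop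
  have c1' : ContinuousOn (fun η => 13 * ε / 3 * dEta ℓ 2 ψ η) (cell ℓ) := by fun_prop
  have c3 : ContinuousOn (fun η => 3 * ε ^ 2 * traceDR ℓ ε (tensor (dEta ℓ 2 ψ) vecB) η)
      (cell ℓ) := ct.const_mul _
  refine ⟨c1.add c3, fun k => ?_⟩
  have e : opB ℓ ε ψ = fun η => (ψ η - 13 * ε / 3 * dEta ℓ 2 ψ η)
      + 3 * ε ^ 2 * traceDR ℓ ε (tensor (dEta ℓ 2 ψ) vecB) η := rfl
  rw [e, coef_add hℓ c1 c3, coef_sub hℓ c0 c1', coef_const_mul, coef_const_mul, ht,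
    coef_dEta_two' hℓ hψ hp]
  have hs := one_le_rootS_lam (ℓ := ℓ) hε k
  have hl := lam_eq_rootS (ℓ := ℓ) hε k
  unfold symB traceSymbol
  set s := rootS (ε * lam ℓ k)
  have hs0 : s ≠ 0 := by linarith
  have hs1 : 2 * s + 1 ≠ 0 := by linarith
  rw [hl]
  field_simp
  ring

lemma opS_coef (hℓ : 0 < ℓ) {ε : ℝ} (hε : 0 < ε) (hψ : ContDiffOn ℝ 4 ψ (cell ℓ))
    (hp : ∀ j ≤ 3, dEta ℓ j ψ (-(ℓ / 2)) = dEta ℓ j ψ (ℓ / 2)) :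
    ContinuousOn (opS ℓ ε ψ) (cell ℓ) ∧ ∀ k, coef ℓ (opS ℓ ε ψ) k = symS ℓ ε k * coef ℓ ψ k := by
  have c2 := continuousOn_dEta hℓ (n := 4) hψ (by norm_num : 2 ≤ 4)
  have c4 := continuousOn_dEta hℓ (n := 4) hψ (le_refl 4)
  obtain ⟨ct, ht⟩ := traceDR_vecA hℓ hε c2 (summable_coef_dEta_two hℓ hψ hp)
  have c41 : ContinuousOn (fun η => -3 * (1 - ε) * dEta ℓ 4 ψ η) (cell ℓ) := by fun_prop
  have c1 : ContinuousOn (fun η => -3 * (1 - ε) * dEta ℓ 4 ψ η - dEta ℓ 2 ψ η) (cell ℓ) := by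
    fun_prop
  have c3 : ContinuousOn (fun η => 3 * ε * traceDR ℓ ε (tensor (dEta ℓ 2 ψ) vecA) η)
      (cell ℓ) := ct.const_mul _
  refine ⟨c1.add c3, fun k => ?_⟩
  have e : opS ℓ ε ψ = fun η => (-3 * (1 - ε) * dEta ℓ 4 ψ η - dEta ℓ 2 ψ η)
      + 3 * ε * traceDR ℓ ε (tensor (dEta ℓ 2 ψ) vecA) η := rfl
  rw [e, coef_add hℓ c1 c3, coef_sub hℓ c41 c2, coef_const_mul, coef_const_mul, ht,
    coef_dEta_two' hℓ hψ hp, coef_dEta_four hℓ hψ hp]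
  have hs := one_le_rootS_lam (ℓ := ℓ) hε k
  unfold symS traceSymbol
  set s := rootS (ε * lam ℓ k)
  have hs0 : s ≠ 0 := by linarith
  have hs1 : 2 * s + 1 ≠ 0 := by linarith
  field_simp
  ring

/-- The operator feeds `ξ_ηη` into the resolvent, whose trace formula needs absolutely summable
coefficients. The weight `λ³` on `ξ` is the weight `λ` on `ξ_ηη`, which suffices for that. -/
lemma opG_coef (hℓ : 0 < ℓ) {ε : ℝ} (hε : 0 < ε) {ξ ξ' ξ'' : ℝ → ℝ}
    (h : ∀ η ∈ cell ℓ, HasDerivWithinAt ξ (ξ' η) (cell ℓ) η)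
    (h' : ∀ η ∈ cell ℓ, HasDerivWithinAt ξ' (ξ'' η) (cell ℓ) η)
    (h'' : ContinuousOn ξ'' (cell ℓ)) (p : ξ (-(ℓ / 2)) = ξ (ℓ / 2))
    (p' : ξ' (-(ℓ / 2)) = ξ' (ℓ / 2)) (hs : Summable fun k => lam ℓ k ^ 3 * coef ℓ ξ k ^ 2) :
    ContinuousOn (opG ℓ ε ξ) (cell ℓ) ∧ ∀ k, coef ℓ (opG ℓ ε ξ) k = symG ℓ ε k * coef ℓ ξ k := by
  have e2 := dEta_two_eq hℓ h h'
  have c0 : ContinuousOn ξ (cell ℓ) := fun η hη => (h η hη).continuousWithinAt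
  have c1 : ContinuousOn ξ' (cell ℓ) := fun η hη => (h' η hη).continuousWithinAt
  have c2 : ContinuousOn (dEta ℓ 2 ξ) (cell ℓ) := h''.congr e2
  have k2 : ∀ k, coef ℓ (dEta ℓ 2 ξ) k = -(lam ℓ k * coef ℓ ξ k) := fun k => by
    rw [coef_congr hℓ e2, coef_deriv_deriv hℓ h h' h'' p p']
  have s0 : Summable fun k => |coef ℓ ξ k| :=
    summable_abs_of_lam_sq hℓ (hasSum_lam_coef_sq hℓ h c1 p).summable
  have s2 : Summable fun k => |coef ℓ (dEta ℓ 2 ξ) k| := by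
    refine summable_abs_of_lam_sq hℓ (hs.congr fun k => ?_)
    rw [k2]; ring
  have c0' : ContinuousOn (fun η => 1 / 2 * ξ η) (cell ℓ) := by fun_prop
  have c2' : ContinuousOn (fun η => ε * dEta ℓ 2 ξ η) (cell ℓ) := by fun_prop
  obtain ⟨ct, ht⟩ := traceDR_coef hℓ hε c0' c2'
    (by simpa only [coef_const_mul, abs_mul] using s0.mul_left |1 / 2|)
    (by simpa only [coef_const_mul, abs_mul] using s2.mul_left |ε|)
  have es : (1 / 2 : ℝ) • tensor ξ vecA + ε • tensor (dEta ℓ 2 ξ) vecB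
      = sourceAB (fun η => 1 / 2 * ξ η) fun η => ε * dEta ℓ 2 ξ η := by
    ext <;> simp [sourceAB, tensor, mul_assoc]
  have e : opG ℓ ε ξ = fun η => 17 / 6 * dEta ℓ 2 ξ η
      - 3 * traceDR ℓ ε (sourceAB (fun η => 1 / 2 * ξ η) fun η => ε * dEta ℓ 2 ξ η) η := by
    ext η; unfold opG; rw [es]
  have ca : ContinuousOn (fun η => 17 / 6 * dEta ℓ 2 ξ η) (cell ℓ) := by fun_prop
  have cb := ct.const_mul 3
  rw [e]
  refine ⟨ca.sub cb, fun k => ?_⟩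
  rw [coef_sub hℓ ca cb, coef_const_mul, coef_const_mul, ht, coef_const_mul, coef_const_mul, k2]
  have hs := one_le_rootS_lam (ℓ := ℓ) hε k
  have hl := lam_eq_rootS (ℓ := ℓ) hε k
  unfold symG traceSymbol
  set s := rootS (ε * lam ℓ k)
  have hs0 : s ≠ 0 := by linarith
  have hs1 : 2 * s + 1 ≠ 0 := by linarith
  rw [hl]
  field_simp
  ring

/-- No differentiability of `ψ'` in `η` is assumed. The summability shows that it equals a Hartley
series that can be differentiated twice, so `dEta ℓ 2 ψ'` is a continuous function with the expected
coefficients. -/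
lemma opH_coef (hℓ : 0 < ℓ) {ε : ℝ} (hε : 0 < ε) (hψ : ContDiffOn ℝ 4 ψ (cell ℓ))
    (hp : ∀ j ≤ 3, dEta ℓ j ψ (-(ℓ / 2)) = dEta ℓ j ψ (ℓ / 2)) {ψ' : ℝ → ℝ}
    (hψ' : ContinuousOn ψ' (cell ℓ)) (hs : Summable fun k => lam ℓ k ^ 3 * coef ℓ ψ' k ^ 2) :
    ContinuousOn (opH ℓ ε ψ ψ') (cell ℓ) ∧ ∀ k, coef ℓ (opH ℓ ε ψ ψ') k ^ 2
      ≤ 50 * (lam ℓ k ^ 4 * coef ℓ ψ k ^ 2 + lam ℓ k ^ 2 * coef ℓ ψ' k ^ 2) := by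
  have s2 : Summable fun k => |lam ℓ k * coef ℓ ψ' k| :=
    summable_abs_of_lam_sq hℓ (hs.congr fun k => by ring)
  have s0 : Summable fun k => |coef ℓ ψ' k| := by
    have h1 : Summable fun k => (lam ℓ 1)⁻¹ * |lam ℓ k * coef ℓ ψ' k|
        + if k = 0 then |coef ℓ ψ' 0| else 0 :=
      (s2.mul_left _).add (hasSum_ite_eq (0 : ℤ) |coef ℓ ψ' 0|).summable
    refine h1.of_nonneg_of_le (fun _ => abs_nonneg _) fun k => ?_
    split_ifs with hk
    · subst hk; simp [lam_zero]
    · rw [add_zero, abs_mul, abs_of_nonneg (lam_nonneg ℓ k), ← mul_assoc]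
      refine le_mul_of_one_le_left (abs_nonneg _) ?_
      rw [inv_mul_eq_div, one_le_div (lam_one_pos hℓ)]
      exact lam_one_le hk
  have hψc := eq_casSum_coef hℓ hψ' s0
  have hd2 : EqOn (dEta ℓ 2 ψ') (casSum ℓ fun k => -(lam ℓ k * coef ℓ ψ' k)) (cell ℓ) :=
    (dEta_congr hψc 2).trans (dEta_two_casSum hℓ s0 s2)
  have s2' : Summable fun k => |-(lam ℓ k * coef ℓ ψ' k)| := by simpa only [abs_neg] using s2
  have c2' : ContinuousOn (dEta ℓ 2 ψ') (cell ℓ) := (continuous_casSum ℓ s2').continuousOn.congr hd2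
  have k2 : ∀ k, coef ℓ (dEta ℓ 2 ψ') k = -(lam ℓ k * coef ℓ ψ' k) := fun k => by
    rw [coef_congr hℓ hd2, coef_casSum hℓ s2']
  have c2 := continuousOn_dEta hℓ (n := 4) hψ (by norm_num : 2 ≤ 4)
  have c4 := continuousOn_dEta hℓ (n := 4) hψ (le_refl 4)
  obtain ⟨ca, ha⟩ := traceDR_vecA hℓ hε c2 (summable_coef_dEta_two hℓ hψ hp)
  obtain ⟨cb, hb⟩ := traceDR_vecB hℓ hε c2' (by simpa only [k2] using s2')
  have d1 : ContinuousOn (fun η => 3 * dEta ℓ 4 ψ η) (cell ℓ) := by fun_prop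
  have d2 := ca.const_mul 3
  have d3 : ContinuousOn (fun η => 13 / 3 * dEta ℓ 2 ψ' η) (cell ℓ) := by fun_prop
  have d4 := cb.const_mul (3 * ε)
  have e : opH ℓ ε ψ ψ' = fun η => ((3 * dEta ℓ 4 ψ η
      + 3 * traceDR ℓ ε (tensor (dEta ℓ 2 ψ) vecA) η) + 13 / 3 * dEta ℓ 2 ψ' η)
      - 3 * ε * traceDR ℓ ε (tensor (dEta ℓ 2 ψ') vecB) η := rfl
  rw [e]
  have d12 : ContinuousOn (fun η => 3 * dEta ℓ 4 ψ η
      + 3 * traceDR ℓ ε (tensor (dEta ℓ 2 ψ) vecA) η) (cell ℓ) := d1.add d2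
  have d123 : ContinuousOn (fun η => (3 * dEta ℓ 4 ψ η
      + 3 * traceDR ℓ ε (tensor (dEta ℓ 2 ψ) vecA) η) + 13 / 3 * dEta ℓ 2 ψ' η) (cell ℓ) :=
    d12.add d3
  refine ⟨d123.sub d4, fun k => ?_⟩
  rw [coef_sub hℓ d123 d4, coef_add hℓ d12 d3, coef_add hℓ d1 d2,
    coef_const_mul, coef_const_mul, coef_const_mul, coef_const_mul, ha, hb, k2,
    coef_dEta_two' hℓ hψ hp, coef_dEta_four hℓ hψ hp]
  have hs := one_le_rootS_lam (ℓ := ℓ) hε k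
  have hpp := rootS_mul (mul_nonneg hε.le (lam_nonneg ℓ k))
  have hl0 := lam_nonneg ℓ k
  unfold traceSymbol
  set s := rootS (ε * lam ℓ k)
  set l := lam ℓ k
  set f := coef ℓ ψ k
  set g := coef ℓ ψ' k
  have hs0 : s ≠ 0 := by linarith
  have hs1 : 2 * s + 1 ≠ 0 := by linarith
  -- Substituting `ε λ = s (s - 1)` removes every power of `ε`: the coefficient is `a λ² f + b λ g`
  -- with `a` and `b` bounded for all `s ≥ 1`.
  set a := 3 + 1 / (s * (2 * s + 1)) with hadef
  set b := -13 / 3 + (s - 1) * (8 * s + 3) / (3 * s * (2 * s + 1)) with hbdef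
  have ea : |a| ≤ 4 := by
    have h1 : 0 < 1 / (s * (2 * s + 1)) := by positivity
    have h2 : 1 / (s * (2 * s + 1)) ≤ 1 := by
      rw [div_le_one (by positivity)]; nlinarith
    rw [abs_le]; constructor <;> linarith
  have eb : |b| ≤ 5 := by
    have h1 : 0 ≤ (s - 1) * (8 * s + 3) / (3 * s * (2 * s + 1)) :=
      div_nonneg (mul_nonneg (by linarith) (by linarith)) (by positivity)
    have h2 : (s - 1) * (8 * s + 3) / (3 * s * (2 * s + 1)) ≤ 2 := by
      rw [div_le_iff₀ (by positivity)]; nlinarith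
    rw [abs_le]; constructor <;> linarith
  have key : 3 * (l ^ 2 * f) + 3 * -(l * (-(l * f) / (3 * s * (2 * s + 1))
        - 0 * (8 * s + 3) / (9 * s ^ 2 * (2 * s + 1)))) + 13 / 3 * -(l * g)
      - 3 * ε * -(l * (0 / (3 * s * (2 * s + 1))
        - -(l * g) * (8 * s + 3) / (9 * s ^ 2 * (2 * s + 1)))) = a * (l ^ 2 * f) + b * (l * g) := by
    have hb2 : b = -13 / 3 + ε * l * (8 * s + 3) / (3 * s ^ 2 * (2 * s + 1)) := by
      rw [hbdef, ← hpp]; field_simp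
    rw [hb2, hadef]
    field_simp
    ring
  rw [key]
  have ha2 : a ^ 2 ≤ 16 := by rw [← sq_abs]; nlinarith [abs_nonneg a]
  have hb2 : b ^ 2 ≤ 25 := by rw [← sq_abs]; nlinarith [abs_nonneg b]
  have := sq_nonneg (a * (l ^ 2 * f) - b * (l * g))
  have h2 : a ^ 2 * (l ^ 2 * f) ^ 2 ≤ 16 * (l ^ 2 * f) ^ 2 :=
    mul_le_mul_of_nonneg_right ha2 (sq_nonneg _)
  have h3 : b ^ 2 * (l * g) ^ 2 ≤ 25 * (l * g) ^ 2 :=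
    mul_le_mul_of_nonneg_right hb2 (sq_nonneg _)
  nlinarith [sq_nonneg (l ^ 2 * f), sq_nonneg (l * g)]

end Operators

/-! ### Limits of coefficients -/

/-- Fatou's lemma; the bound on the integrals is only required eventually. -/
lemma integral_sq_le_of_tendsto {ℓ : ℝ} (hℓ : 0 < ℓ) {w : ℕ → ℝ → ℝ} {v : ℝ → ℝ} {C : ℝ}
    (hw : ∀ n, ContinuousOn (w n) (cell ℓ)) (hv : ContinuousOn v (cell ℓ))
    (hlim : ∀ η ∈ cell ℓ, Filter.Tendsto (fun n => w n η) Filter.atTop (nhds (v η)))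
    (hC : ∀ᶠ n in Filter.atTop, ∫ η in (-(ℓ / 2))..(ℓ / 2), w n η ^ 2 ≤ C) :
    ∫ η in (-(ℓ / 2))..(ℓ / 2), v η ^ 2 ≤ C := by
  have hle : -(ℓ / 2) ≤ ℓ / 2 := by linarith
  set μ := volume.restrict (Ioc (-(ℓ / 2)) (ℓ / 2))
  have hI : ∀ f : ℝ → ℝ, ContinuousOn f (cell ℓ) → Integrable (fun η => f η ^ 2) μ := fun f hf =>
    ((hf.pow 2).integrableOn_Icc).mono_set Ioc_subset_Icc_self
  have e : ∀ f : ℝ → ℝ, ContinuousOn f (cell ℓ) →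
      ∫⁻ η, ENNReal.ofReal (f η ^ 2) ∂μ
        = ENNReal.ofReal (∫ η in (-(ℓ / 2))..(ℓ / 2), f η ^ 2) := fun f hf => by
    rw [intervalIntegral.integral_of_le hle,
      ofReal_integral_eq_lintegral_ofReal (hI f hf) (ae_of_all _ fun _ => sq_nonneg _)]
  have h1 : ∫⁻ η, ENNReal.ofReal (v η ^ 2) ∂μ
      = ∫⁻ η, Filter.liminf (fun n => ENNReal.ofReal (w n η ^ 2)) Filter.atTop ∂μ := by
    refine lintegral_congr_ae ?_
    filter_upwards [ae_restrict_mem measurableSet_Ioc] with η hη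
    exact ((ENNReal.continuous_ofReal.tendsto _).comp
      ((hlim η (Ioc_subset_Icc_self hη)).pow 2)).liminf_eq.symm
  have h2 := lintegral_liminf_le' (μ := μ) (u := Filter.atTop)
    (f := fun n η => ENNReal.ofReal (w n η ^ 2))
    fun n => (hI _ (hw n)).aestronglyMeasurable.aemeasurable.ennreal_ofReal
  have h3 : Filter.liminf (fun n => ∫⁻ η, ENNReal.ofReal (w n η ^ 2) ∂μ) Filter.atTop
      ≤ ENNReal.ofReal C := by
    refine (Filter.liminf_le_liminf (v := fun _ => ENNReal.ofReal C) ?_).trans (by simp)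
    filter_upwards [hC] with n hn
    rw [e _ (hw n)]
    exact ENNReal.ofReal_le_ofReal hn
  rw [← h1, e v hv] at h2
  have h0 : 0 ≤ C := by
    obtain ⟨n, hn⟩ := hC.exists
    exact (intervalIntegral.integral_nonneg hle fun _ _ => sq_nonneg _).trans hn
  exact (ENNReal.ofReal_le_ofReal_iff h0).1 (h2.trans h3)

/-- A pointwise limit whose coefficients converge in square mean has the limiting
coefficients. -/
lemma coef_of_tendsto {ℓ : ℝ} (hℓ : 0 < ℓ) {u : ℕ → ℝ → ℝ} {v : ℝ → ℝ} {a : ℤ → ℝ}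
    (hu : ∀ n, ContinuousOn (u n) (cell ℓ)) (hv : ContinuousOn v (cell ℓ))
    (hlim : ∀ η ∈ cell ℓ, Filter.Tendsto (fun n => u n η) Filter.atTop (nhds (v η)))
    (ha : ∀ δ > 0, ∀ᶠ n in Filter.atTop, ∀ N : Finset ℤ, ∑ k ∈ N, (coef ℓ (u n) k - a k) ^ 2 ≤ δ)
    (k : ℤ) : coef ℓ v k = a k := by
  have key : ∀ δ > 0, (coef ℓ v k - a k) ^ 2 ≤ 10 * δ := by
    intro δ hδ
    obtain ⟨n, hn⟩ := (ha δ hδ).exists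
    have hd : ∀ m, ContinuousOn (fun η => u n η - u m η) (cell ℓ) := fun m => (hu n).sub (hu m)
    have hd' : ContinuousOn (fun η => u n η - v η) (cell ℓ) := (hu n).sub hv
    -- By Parseval `u n` and `u m` are close in mean square as soon as both are close to `a`.
    -- Letting `m → ∞` pointwise replaces `u m` by `v`.
    have h1 : ∫ η in (-(ℓ / 2))..(ℓ / 2), (u n η - v η) ^ 2 ≤ ℓ * (4 * δ) := by
      refine integral_sq_le_of_tendsto hℓ hd hd' (fun η hη => (hlim η hη).const_sub (u n η)) ?_
      filter_upwards [ha δ hδ] with m hm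
      rw [← inv_mul_le_iff₀ hℓ]
      refine hasSum_le_of_sum_le (hasSum_coef_sq hℓ (hd m)) fun N => ?_
      calc ∑ j ∈ N, coef ℓ (fun η => u n η - u m η) j ^ 2
          ≤ ∑ j ∈ N, (2 * (coef ℓ (u n) j - a j) ^ 2 + 2 * (coef ℓ (u m) j - a j) ^ 2) := by
            refine Finset.sum_le_sum fun j _ => ?_
            rw [coef_sub hℓ (hu n) (hu m)]
            nlinarith [sq_nonneg ((coef ℓ (u n) j - a j) + (coef ℓ (u m) j - a j))]
        _ ≤ 4 * δ := by
            rw [Finset.sum_add_distrib, ← Finset.mul_sum, ← Finset.mul_sum]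
            linarith [hn N, hm N]
    have h2 := coef_sq_le hℓ hd' k
    rw [coef_sub hℓ (hu n) hv] at h2
    rw [← inv_mul_le_iff₀ hℓ] at h1
    have h3 := hn {k}
    rw [Finset.sum_singleton] at h3
    nlinarith [sq_nonneg ((coef ℓ (u n) k - coef ℓ v k) + (coef ℓ (u n) k - a k))]
  have h0 : (coef ℓ v k - a k) ^ 2 ≤ 0 := by
    refine le_of_forall_pos_le_add fun δ hδ => ?_
    have := key (δ / 10) (by positivity)
    linarith
  exact sub_eq_zero.1 (pow_eq_zero_iff (by norm_num) |>.1 (le_antisymm h0 (sq_nonneg _)))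

/-! ### Mixed derivatives -/

/-- The space derivative of `f_τ` has to be identified with the time derivative of `f_η`. Inside the
cell one differentiates `f(t) - f(0) = ∫ f_τ` under the integral; continuity of both sides extends
the identity to the end points, where the periodicity conditions live. -/
lemma dEta_one_sub_eq_integral {ℓ T : ℝ} (hℓ : 0 < ℓ) {n m : ℕ} (hn : 1 ≤ n) (hm : 1 ≤ m)
    {f : ℝ → ℝ → ℝ} (hf : MemC 1 n (Icc 0 T) (cell ℓ) f)
    (hf' : MemC 0 m (Icc 0 T) (cell ℓ) (dFst (Icc 0 T) f)) {t : ℝ} (ht : t ∈ Icc 0 T) {η : ℝ}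
    (hη : η ∈ cell ℓ) :
    dEta ℓ 1 (f t) η - dEta ℓ 1 (f 0) η
      = ∫ r in (0 : ℝ)..t, dEta ℓ 1 (dFst (Icc 0 T) f r) η := by
  have hR := Subset.refl (Icc 0 T)
  have h0 : (0 : ℝ) ∈ Icc 0 T := ⟨le_rfl, ht.1.trans ht.2⟩
  have hsub : Icc 0 t ⊆ Icc 0 T := Icc_subset_Icc_right ht.2
  have hc := hf.contOnRect_dFst hR
  have hc1 := hf'.contOnRect_dEta hR hm
  obtain ⟨C, hC, hb⟩ := hc1.bound
  have hio : ∀ {r}, r ∈ uIoc 0 t → r ∈ Icc 0 T := fun hr => by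
    rw [uIoc_of_le ht.1] at hr; exact hsub (Ioc_subset_Icc_self hr)
  have hint : ∀ g : ℝ → ℝ → ℝ, ContOnRect ℓ T g → ∀ η ∈ cell ℓ,
      IntervalIntegrable (fun r => g r η) volume 0 t := fun g hg η hη =>
    ContinuousOn.intervalIntegrable (by rw [uIcc_of_le ht.1]; exact (hg.slice' hη).mono hsub)
  have hFTC : ∀ η ∈ cell ℓ, ∫ r in (0 : ℝ)..t, dFst (Icc 0 T) f r η = f t η - f 0 η := fun η hη =>
    intervalIntegral.integral_eq_sub_of_hasDerivAt_of_le ht.1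
      (((hf.contOnRect hR).slice' hη).mono hsub)
      (fun r hr => hf.hasDerivAt_dFst hR ⟨hr.1, hr.2.trans_le ht.2⟩ hη) (hint _ hc η hη)
  have hnhds : ∀ η ∈ Ioo (-(ℓ / 2)) (ℓ / 2), cell ℓ ∈ nhds η := fun η hη => Icc_mem_nhds hη.1 hη.2
  have hder : ∀ (p : ℕ) (φ : ℝ → ℝ), 1 ≤ p → ContDiffOn ℝ p φ (cell ℓ) →
      ∀ η ∈ Ioo (-(ℓ / 2)) (ℓ / 2), HasDerivAt φ (dEta ℓ 1 φ η) η := fun p φ hp hφ η hη => by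
    have := hasDerivWithinAt_dEta hℓ hφ (j := 0) hp η (Ioo_subset_Icc_self hη)
    rw [dEta_zero] at this
    exact this.hasDerivAt (hnhds η hη)
  have hmeas : ∀ g : ℝ → ℝ → ℝ, ContOnRect ℓ T g → ∀ η ∈ cell ℓ,
      AEStronglyMeasurable (fun r => g r η) (volume.restrict (uIoc 0 t)) := fun g hg η hη => by
    rw [uIoc_of_le ht.1]
    exact ((hg.slice' hη).mono (Ioc_subset_Icc_self.trans hsub)).aestronglyMeasurable
      measurableSet_Ioc
  have hin : EqOn (fun η => dEta ℓ 1 (f t) η - dEta ℓ 1 (f 0) η)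
      (fun η => ∫ r in (0 : ℝ)..t, dEta ℓ 1 (dFst (Icc 0 T) f r) η)
      (Ioo (-(ℓ / 2)) (ℓ / 2)) := by
    intro η hη
    have hηc : η ∈ cell ℓ := Ioo_subset_Icc_self hη
    have hd1 := (hder n _ hn (hf.2.1 t ht) η hη).sub (hder n _ hn (hf.2.1 0 h0) η hη)
    have hd2 := (intervalIntegral.hasDerivAt_integral_of_dominated_loc_of_deriv_le
      (F := fun η r => dFst (Icc 0 T) f r η) (F' := fun η r => dEta ℓ 1 (dFst (Icc 0 T) f r) η)
      (bound := fun _ => C) (Ioo_mem_nhds hη.1 hη.2)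
      (by filter_upwards [Ioo_mem_nhds hη.1 hη.2] with s hs
          exact hmeas _ hc s (Ioo_subset_Icc_self hs))
      (hint _ hc η hηc) (hmeas _ hc1 η hηc)
      (ae_of_all _ fun r hr s hs => hb r (hio hr) s (Ioo_subset_Icc_self hs)) (by simp)
      (ae_of_all _ fun r hr s hs => hder m _ hm (hf'.2.1 r (hio hr)) s hs)).2
    refine hd1.unique (hd2.congr_of_eventuallyEq ?_)
    filter_upwards [hnhds η hη] with s hs
    exact (hFTC s hs).symm
  have hcR : ContinuousOn (fun η => ∫ r in (0 : ℝ)..t, dEta ℓ 1 (dFst (Icc 0 T) f r) η)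
      (cell ℓ) := by
    intro η hη
    refine intervalIntegral.continuousWithinAt_of_dominated_interval (bound := fun _ => C)
      (by filter_upwards [self_mem_nhdsWithin] with s hs
          exact hmeas _ hc1 s hs)
      (by filter_upwards [self_mem_nhdsWithin] with s hs
          exact ae_of_all _ fun r hr => hb r (hio hr) s hs)
      (by simp) (ae_of_all _ fun r hr => hc1.slice (hio hr) η hη)
  exact hin.of_subset_closure ((continuousOn_dEta hℓ (hf.2.1 t ht) hn).sub
    (continuousOn_dEta hℓ (hf.2.1 0 h0) hn)) hcR Ioo_subset_Icc_self
    (by rw [closure_Ioo (by linarith)]; exact Subset.rfl) hη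

lemma hasDerivAt_dEta_one {ℓ T : ℝ} (hℓ : 0 < ℓ) {n m : ℕ} (hn : 1 ≤ n) (hm : 1 ≤ m)
    {f : ℝ → ℝ → ℝ} (hf : MemC 1 n (Icc 0 T) (cell ℓ) f)
    (hf' : MemC 0 m (Icc 0 T) (cell ℓ) (dFst (Icc 0 T) f)) {t : ℝ} (ht : t ∈ Ioo 0 T) {η : ℝ}
    (hη : η ∈ cell ℓ) :
    HasDerivAt (fun t => dEta ℓ 1 (f t) η) (dEta ℓ 1 (dFst (Icc 0 T) f t) η) t := by
  have hc := (hf'.contOnRect_dEta (Subset.refl _) hm).slice' hη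
  have hn' : Icc 0 T ∈ nhds t := Icc_mem_nhds ht.1 ht.2
  have h := intervalIntegral.integral_hasDerivAt_right
    (f := fun r => dEta ℓ 1 (dFst (Icc 0 T) f r) η) (a := 0) (b := t)
    (ContinuousOn.intervalIntegrable (by
      rw [uIcc_of_le ht.1.le]; exact hc.mono (Icc_subset_Icc_right ht.2.le)))
    (hc.stronglyMeasurableAtFilter_nhdsWithin measurableSet_Icc t |>.filter_mono
      (by rw [nhdsWithin_eq_nhds.2 hn'])) (hc.continuousAt hn')
  refine (h.add_const (dEta ℓ 1 (f 0) η)).congr_of_eventuallyEq ?_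
  filter_upwards [hn'] with s hs
  rw [← dEta_one_sub_eq_integral hℓ hn hm hf hf' hs hη]
  ring

/-- The time derivative of an element of `𝒴_T` is periodic, together with its space derivative. -/
lemma MemY.periodic_dFst {ℓ α T : ℝ} (hℓ : 0 < ℓ) (hT : 0 < T) {ζ : ℝ → ℝ → ℝ}
    (hζ : MemY ℓ α T ζ) {t : ℝ} (ht : t ∈ Icc 0 T) {j : ℕ} (hj : j < 2) :
    dEta ℓ j (dFst (Icc 0 T) ζ t) (-(ℓ / 2)) = dEta ℓ j (dFst (Icc 0 T) ζ t) (ℓ / 2) := by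
  obtain ⟨hreg, ⟨hreg', -⟩, hper⟩ := hζ
  have hR := Subset.refl (Icc 0 T)
  have hl := left_mem_cell hℓ
  have hr := right_mem_cell hℓ
  interval_cases j
  · simp only [dEta_zero] at hper ⊢
    have hc := hreg.contOnRect_dFst hR
    exact periodic_of_hasDerivAt hT (hc.slice' hl) (hc.slice' hr)
      (fun t ht => hreg.hasDerivAt_dFst hR ht hl) (fun t ht => hreg.hasDerivAt_dFst hR ht hr)
      (fun t ht => by simpa only [dEta_zero] using hper t ht 0 (by norm_num)) t ht
  · have hc := hreg'.contOnRect_dEta hR (by norm_num : 1 ≤ 2)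
    exact periodic_of_hasDerivAt hT (hc.slice' hl) (hc.slice' hr)
      (fun t ht => hasDerivAt_dEta_one hℓ (by norm_num) (by norm_num) hreg hreg' ht hl)
      (fun t ht => hasDerivAt_dEta_one hℓ (by norm_num) (by norm_num) hreg hreg' ht hr)
      (fun t ht => hper t ht 1 (by norm_num)) t ht

/-! ### The equations for the coefficients of the remainder -/

lemma MemY.hasDerivAt_coef {ℓ α T : ℝ} (hℓ : 0 < ℓ) {ζ : ℝ → ℝ → ℝ} (hζ : MemY ℓ α T ζ) {t : ℝ}
    (ht : t ∈ Ioo 0 T) (k : ℤ) :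
    HasDerivAt (fun t => coef ℓ (ζ t) k) (coef ℓ (dFst (Icc 0 T) ζ t) k) t :=
  FrontKS.hasDerivAt_coef hℓ (hζ.1.contOnRect (Subset.refl _)) (hζ.1.contOnRect_dFst (Subset.refl _))
    (fun _ ht _ hη => hζ.1.hasDerivAt_dFst (Subset.refl _) ht hη) ht k

/-- Difference quotients in time converge in the second order Sobolev norm. -/
lemma MemY.diffQuot {ℓ α T : ℝ} (hℓ : 0 < ℓ) (hT : 0 < T) {ζ : ℝ → ℝ → ℝ} (hζ : MemY ℓ α T ζ)
    {t : ℝ} (ht : t ∈ Ioo 0 T) {δ : ℝ} (hδ : 0 < δ) :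
    ∃ h > 0, ∀ s ∈ Ioo t T, s < t + h → ∀ N : Finset ℤ,
      ∑ k ∈ N, ((1 + lam ℓ k) * ((coef ℓ (ζ s) k - coef ℓ (ζ t) k) / (s - t)
        - coef ℓ (dFst (Icc 0 T) ζ t) k)) ^ 2 ≤ δ := by
  have hR := Subset.refl (Icc 0 T)
  set g := dFst (Icc 0 T) ζ with hg
  have hreg' := hζ.2.1.1
  have hθ : ContOnRect ℓ T fun r η => g r η - dEta ℓ 2 (g r) η :=
    (hreg'.contOnRect hR).sub (hreg'.contOnRect_dEta hR le_rfl)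
  have hcθ : ∀ r ∈ Icc 0 T, ∀ k, coef ℓ (fun η => g r η - dEta ℓ 2 (g r) η) k
      = (1 + lam ℓ k) * coef ℓ (g r) k := fun r hr k => by
    have h2 := coef_dEta_two hℓ (hreg'.2.1 r hr) (j := 0) le_rfl
      (hζ.periodic_dFst hℓ hT hr (by norm_num)) (hζ.periodic_dFst hℓ hT hr (by norm_num)) k
    rw [zero_add, dEta_zero] at h2
    rw [coef_sub hℓ ((hreg'.contOnRect hR).slice hr)
      ((hreg'.contOnRect_dEta hR le_rfl).slice hr), h2]
    ring
  have huc := (isCompact_Icc.prod isCompact_Icc).uniformContinuousOn_of_continuous hθ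
  rw [Metric.uniformContinuousOn_iff] at huc
  obtain ⟨h, hh, hunif⟩ := huc (Real.sqrt δ) (Real.sqrt_pos.2 hδ)
  refine ⟨h, hh, fun s hs hsh N => ?_⟩
  have htI : t ∈ Icc 0 T := Ioo_subset_Icc_self ht
  set c : ℤ → ℝ := fun k => (1 + lam ℓ k) * ((coef ℓ (ζ s) k - coef ℓ (ζ t) k) / (s - t)
        - coef ℓ (g t) k) with hc
  have hst : s - t ≠ 0 := (sub_pos.2 hs.1).ne'
  -- A mean value inequality for vectors: the scalar theorem is applied to the inner product with
  -- the error vector `c` itself. It gives `Σ c² = Σ c d`, hence `Σ c² ≤ Σ d²` with a single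
  -- intermediate time `r` for all modes in `N`.
  obtain ⟨r, hr, hmvt⟩ := exists_hasDerivAt_eq_slope
    (fun r => ∑ k ∈ N, c k * ((1 + lam ℓ k) * (coef ℓ (ζ r) k - r * coef ℓ (g t) k)))
    (fun r => ∑ k ∈ N, c k * ((1 + lam ℓ k) * (coef ℓ (g r) k - coef ℓ (g t) k))) hs.1
    (by
      refine continuousOn_finsetSum _ fun k _ => ContinuousOn.const_mul (ContinuousOn.const_mul
        (ContinuousOn.sub ?_ (by fun_prop)) _) _
      exact ((hζ.1.contOnRect hR).continuousOn_coef hℓ k).mono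
        (Icc_subset_Icc htI.1 hs.2.le))
    (fun r hr => by
      refine HasDerivAt.fun_sum fun k _ => ?_
      exact ((((hζ.hasDerivAt_coef hℓ ⟨ht.1.trans hr.1, hr.2.trans hs.2⟩ k).sub
        ((hasDerivAt_id r).mul_const (coef ℓ (g t) k))).const_mul (1 + lam ℓ k)).const_mul
          (c k)).congr_deriv (by ring))
  have hrI : r ∈ Icc 0 T := ⟨(ht.1.trans hr.1).le, (hr.2.trans hs.2).le⟩
  set d : ℤ → ℝ := fun k => (1 + lam ℓ k) * (coef ℓ (g r) k - coef ℓ (g t) k) with hd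
  have hsum : ∑ k ∈ N, c k ^ 2 = ∑ k ∈ N, c k * d k := by
    rw [show ∑ k ∈ N, c k * d k = _ from hmvt, ← Finset.sum_sub_distrib, Finset.sum_div]
    refine Finset.sum_congr rfl fun k _ => ?_
    simp only [hc]
    field_simp
    ring
  have cr := hθ.slice hrI
  have ct := hθ.slice htI
  have hdle : ∑ k ∈ N, d k ^ 2 ≤ δ := by
    have cd : ContinuousOn (fun η => (g r η - dEta ℓ 2 (g r) η) - (g t η - dEta ℓ 2 (g t) η))
      (cell ℓ) := cr.sub ct
    have h1 := sum_coef_sq_le hℓ cd N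
    refine le_trans (le_of_eq (Finset.sum_congr rfl fun k _ => ?_)) (h1.trans
      (integral_sq_le hℓ cd fun η hη => ?_))
    · rw [coef_sub hℓ cr ct, hcθ r hrI, hcθ t htI]; simp only [hd]; ring
    · have h2 := hunif (r, η) ⟨hrI, hη⟩ (t, η) ⟨htI, hη⟩ (by
        rw [Prod.dist_eq, dist_self, max_eq_left dist_nonneg, Real.dist_eq,
          abs_of_pos (sub_pos.2 hr.1)]
        linarith [hr.2])
      rw [Real.dist_eq] at h2
      calc _ = |(g r η - dEta ℓ 2 (g r) η) - (g t η - dEta ℓ 2 (g t) η)| ^ 2 := (sq_abs _).symm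
        _ ≤ Real.sqrt δ ^ 2 := by gcongr
        _ = δ := Real.sq_sqrt hδ.le
  have h3 : ∑ k ∈ N, c k * d k ≤ ∑ k ∈ N, (1 / 2 * c k ^ 2 + 1 / 2 * d k ^ 2) :=
    Finset.sum_le_sum fun k _ => by nlinarith [sq_nonneg (c k - d k)]
  rw [Finset.sum_add_distrib, ← Finset.mul_sum, ← Finset.mul_sum] at h3
  change ∑ k ∈ N, c k ^ 2 ≤ δ
  linarith

/-! ### The equation projected onto the modes -/

/-- The convective terms `-φ_η ψ_η - (ε/2) (ψ_η)²`. -/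
noncomputable def convTerm (ℓ ε : ℝ) (φ ψ : ℝ → ℝ) (η : ℝ) : ℝ :=
  -(dEta ℓ 1 φ η * dEta ℓ 1 ψ η) - ε / 2 * (dEta ℓ 1 ψ η) ^ 2

/-- The squared slope `(φ_η + ε ψ_η)²`. -/
noncomputable def slopeSq (ℓ ε : ℝ) (φ ψ : ℝ → ℝ) (η : ℝ) : ℝ :=
  (dEta ℓ 1 φ η + ε * dEta ℓ 1 ψ η) ^ 2

lemma opG_slopeSq {ℓ : ℝ} (hℓ : 0 < ℓ) {ε : ℝ} (hε : 0 < ε) {φ ψ : ℝ → ℝ}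
    (hφ : ContDiffOn ℝ 4 φ (cell ℓ))
    (pφ : ∀ j ≤ 3, dEta ℓ j φ (-(ℓ / 2)) = dEta ℓ j φ (ℓ / 2))
    (hψ : ContDiffOn ℝ 4 ψ (cell ℓ))
    (pψ : ∀ j ≤ 3, dEta ℓ j ψ (-(ℓ / 2)) = dEta ℓ j ψ (ℓ / 2)) :
    ContinuousOn (opG ℓ ε (slopeSq ℓ ε φ ψ)) (cell ℓ) ∧
    ∀ k, coef ℓ (opG ℓ ε (slopeSq ℓ ε φ ψ)) k = symG ℓ ε k * coef ℓ (slopeSq ℓ ε φ ψ) k := by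
  set f : ℕ → ℝ → ℝ := fun j η => dEta ℓ j φ η + ε * dEta ℓ j ψ η with hf
  have hd : ∀ j < 4, ∀ η ∈ cell ℓ, HasDerivWithinAt (f j) (f (j + 1) η) (cell ℓ) η :=
    fun j hj η hη => (hasDerivWithinAt_dEta hℓ (n := 4) hφ hj η hη).add
      ((hasDerivWithinAt_dEta hℓ (n := 4) hψ hj η hη).const_mul ε)
  have hc : ∀ j ≤ 4, ContinuousOn (f j) (cell ℓ) := fun j hj =>
    (continuousOn_dEta hℓ (n := 4) hφ hj).add ((continuousOn_dEta hℓ (n := 4) hψ hj).const_mul ε)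
  have hp : ∀ j ≤ 3, f j (-(ℓ / 2)) = f j (ℓ / 2) := fun j hj => by
    simp only [hf, pφ j hj, pψ j hj]
  have hs := (hasSum_lam_cube_sq hℓ (hd 1 (by norm_num)) (hd 2 (by norm_num)) (hd 3 (by norm_num))
    (hc 4 le_rfl) (hp 1 (by norm_num)) (hp 2 (by norm_num)) (hp 3 (by norm_num))).summable
  have c1 := hc 1 (by norm_num)
  have c2 := hc 2 (by norm_num)
  have c3 := hc 3 (by norm_num)
  exact opG_coef hℓ hε (ξ := fun η => f 1 η ^ 2) (ξ' := fun η => 2 * f 1 η * f 2 η)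
    (ξ'' := fun η => 2 * f 2 η ^ 2 + 2 * f 1 η * f 3 η)
    (fun η hη => ((hd 1 (by norm_num) η hη).pow 2).congr_deriv (by simp))
    (fun η hη => (((hd 1 (by norm_num) η hη).const_mul 2).mul
      (hd 2 (by norm_num) η hη)).congr_deriv (by ring))
    (by fun_prop) (by simp only [hp 1 (by norm_num)])
    (by simp only [hp 1 (by norm_num), hp 2 (by norm_num)]) hs

/-- The equation for the coefficients of the remainder. -/
lemma SolvesRemainder.coef_equation {ℓ α ε T : ℝ} (hℓ : 0 < ℓ) (hT : 0 < T) (hε : 0 < ε)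
    (hε' : ε ≤ 1) {Φ₀ : ℝ → ℝ} {Φ ρ : ℝ → ℝ → ℝ} (hΦ : SolvesKS ℓ Φ₀ Φ) (hρ : MemY ℓ α T ρ)
    (hsol : SolvesRemainder ℓ ε T Φ ρ) {t : ℝ} (ht : t ∈ Ioo 0 T)
    (hs : Summable fun k => lam ℓ k ^ 3 * coef ℓ (dFst (Ici 0) Φ t) k ^ 2) (k : ℤ) :
    symB ℓ ε k * coef ℓ (dFst (Icc 0 T) ρ t) k
      = symS ℓ ε k * coef ℓ (ρ t) k + coef ℓ (convTerm ℓ ε (Φ t) (ρ t)) k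
        + symG ℓ ε k * coef ℓ (slopeSq ℓ ε (Φ t) (ρ t)) k
        + coef ℓ (opH ℓ ε (Φ t) (dFst (Ici 0) Φ t)) k := by
  have htI : t ∈ Icc 0 T := Ioo_subset_Icc_self ht
  have hρt := fun s (hs : s ∈ Icc 0 T) => hρ.1.2.1 s hs
  have pρ := hρ.2.2
  have hΦt := hΦ.regular.2.1 t ht.1.le
  have pΦ := hΦ.periodic t ht.1.le
  obtain ⟨cS, hS⟩ := opS_coef hℓ hε (hρt t htI) (pρ t htI)
  obtain ⟨cG, hG⟩ := opG_slopeSq hℓ hε hΦt pΦ (hρt t htI) (pρ t htI)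
  have cH := (opH_coef hℓ hε hΦt pΦ
    ((hΦ.regular.contOnRect_dFst (Icc_subset_Ici_zero T)).slice htI) hs).1
  have c1 := continuousOn_dEta hℓ (n := 4) hΦt (by norm_num : 1 ≤ 4)
  have c1' := continuousOn_dEta hℓ (n := 4) (hρt t htI) (by norm_num : 1 ≤ 4)
  have cP : ContinuousOn (convTerm ℓ ε (Φ t) (ρ t)) (cell ℓ) := by unfold convTerm; fun_prop
  have cSP : ContinuousOn (fun η => opS ℓ ε (ρ t) η + convTerm ℓ ε (Φ t) (ρ t) η) (cell ℓ) :=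
    cS.add cP
  have cSPG : ContinuousOn (fun η => (opS ℓ ε (ρ t) η + convTerm ℓ ε (Φ t) (ρ t) η)
      + opG ℓ ε (slopeSq ℓ ε (Φ t) (ρ t)) η) (cell ℓ) := cSP.add cG
  set v : ℝ → ℝ := fun η => ((opS ℓ ε (ρ t) η + convTerm ℓ ε (Φ t) (ρ t) η)
      + opG ℓ ε (slopeSq ℓ ε (Φ t) (ρ t)) η) + opH ℓ ε (Φ t) (dFst (Ici 0) Φ t) η with hv
  have cv : ContinuousOn v (cell ℓ) := cSPG.add cH
  have hcv : coef ℓ v k = symS ℓ ε k * coef ℓ (ρ t) k + coef ℓ (convTerm ℓ ε (Φ t) (ρ t)) k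
        + symG ℓ ε k * coef ℓ (slopeSq ℓ ε (Φ t) (ρ t)) k
        + coef ℓ (opH ℓ ε (Φ t) (dFst (Ici 0) Φ t)) k := by
    rw [hv, coef_add hℓ cSPG cH, coef_add hℓ cSP cG, coef_add hℓ cS cP, hS, hG]
  rw [← hcv]
  -- Times decreasing to `t`; the shift by `2` keeps even the first one strictly below `T`.
  set s : ℕ → ℝ := fun n => t + (T - t) / (n + 2) with hsdef
  have hTt : 0 < T - t := sub_pos.2 ht.2
  have hs1 : ∀ n, s n ∈ Ioo t T := fun n => by
    have h2 : (0 : ℝ) < n + 2 := by positivity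
    refine ⟨by simp only [hsdef]; linarith [div_pos hTt h2], ?_⟩
    have : (T - t) / (n + 2) < T - t := div_lt_self hTt (by linarith [(Nat.cast_nonneg n : (0:ℝ) ≤ n)])
    simp only [hsdef]; linarith
  have hs2 : Filter.Tendsto s Filter.atTop (nhds t) := by
    have h1 : Filter.Tendsto (fun n : ℕ => (T - t) / ((n : ℝ) + 2)) Filter.atTop (nhds 0) :=
      Filter.Tendsto.div_atTop tendsto_const_nhds
        (Filter.tendsto_atTop_add_const_right _ _ tendsto_natCast_atTop_atTop)
    simpa using h1.const_add t
  have hsI : ∀ n, s n ∈ Icc 0 T := fun n => ⟨(ht.1.trans (hs1 n).1).le, (hs1 n).2.le⟩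
  have hs3 : Filter.Tendsto s Filter.atTop (nhdsWithin t (Icc 0 T \ {t})) :=
    tendsto_nhdsWithin_iff.2 ⟨hs2, Filter.Eventually.of_forall fun n =>
      ⟨hsI n, (hs1 n).1.ne'⟩⟩
  set u : ℕ → ℝ → ℝ := fun n η =>
    (s n - t)⁻¹ * (opB ℓ ε (ρ (s n)) η - opB ℓ ε (ρ t) η) with hu
  have hB := fun s (hs : s ∈ Icc 0 T) => opB_coef hℓ hε (hρt s hs) (pρ s hs)
  have hcu : ∀ n j, coef ℓ (u n) j
      = symB ℓ ε j * ((coef ℓ (ρ (s n)) j - coef ℓ (ρ t) j) / (s n - t)) := fun n j => by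
    rw [hu]
    dsimp only
    rw [coef_const_mul, coef_sub hℓ (hB _ (hsI n)).1 (hB t htI).1, (hB _ (hsI n)).2, (hB t htI).2]
    ring
  -- The difference quotients of `ℬ_ε(ρ)` converge pointwise to the right-hand side by the equation,
  -- while their coefficients converge to `symB` times those of `ρ_τ`. The two limits must agree.
  refine (coef_of_tendsto hℓ (u := u) (a := fun k => symB ℓ ε k * coef ℓ (dFst (Icc 0 T) ρ t) k)
    (fun n => ((hB _ (hsI n)).1.sub (hB t htI).1).const_mul _) cv (fun η hη => ?_)
    (fun δ hδ => ?_) k).symm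
  · have h1 := hasDerivWithinAt_iff_tendsto_slope.1 (hsol t htI η hη)
    have h2 := h1.comp hs3
    have e : v η = opS ℓ ε (ρ t) η - dEta ℓ 1 (Φ t) η * dEta ℓ 1 (ρ t) η
        - ε / 2 * (dEta ℓ 1 (ρ t) η) ^ 2
        + opG ℓ ε (fun η' => (dEta ℓ 1 (Φ t) η' + ε * dEta ℓ 1 (ρ t) η') ^ 2) η
        + opH ℓ ε (Φ t) (dFst (Ici 0) Φ t) η := by
      simp only [hv, convTerm]
      change _ + opG ℓ ε (fun η' => (dEta ℓ 1 (Φ t) η' + ε * dEta ℓ 1 (ρ t) η') ^ 2) η + _ = _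
      ring
    rw [e]
    exact h2
  -- The divisor `36` is the square of the constant in `abs_symB_le`.
  · obtain ⟨h, hh, hq⟩ := hρ.diffQuot hℓ hT ht (δ := δ / 36) (by positivity)
    filter_upwards [hs2.eventually (gt_mem_nhds (by linarith : t < t + h))] with n hn N
    have h1 := hq (s n) (hs1 n) hn N
    calc ∑ j ∈ N, (coef ℓ (u n) j - symB ℓ ε j * coef ℓ (dFst (Icc 0 T) ρ t) j) ^ 2
        ≤ ∑ j ∈ N, 36 * ((1 + lam ℓ j) * ((coef ℓ (ρ (s n)) j - coef ℓ (ρ t) j) / (s n - t)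
          - coef ℓ (dFst (Icc 0 T) ρ t) j)) ^ 2 := by
          refine Finset.sum_le_sum fun j _ => ?_
          rw [hcu, ← mul_sub, mul_pow, mul_pow, ← mul_assoc]
          refine mul_le_mul_of_nonneg_right ?_ (sq_nonneg _)
          have hb := abs_symB_le (ℓ := ℓ) hε j
          have hl := lam_nonneg ℓ j
          have hb' : |symB ℓ ε j| ≤ 6 * (1 + lam ℓ j) := hb.trans (by nlinarith)
          rw [← sq_abs]
          calc |symB ℓ ε j| ^ 2 ≤ (6 * (1 + lam ℓ j)) ^ 2 := by gcongr
            _ = _ := by ring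
      _ ≤ δ := by rw [← Finset.mul_sum]; linarith

/-! ### Pointwise bounds and the nonlinear terms -/

lemma hasDerivAt_of_cell {ℓ : ℝ} {f : ℝ → ℝ} {f' η : ℝ}
    (h : HasDerivWithinAt f f' (cell ℓ) η) (hη : η ∈ Ioo (-(ℓ / 2)) (ℓ / 2)) : HasDerivAt f f' η :=
  h.hasDerivAt (Icc_mem_nhds hη.1 hη.2)

/-- Integration from the zero bounds `|f|` by the integral `I` of `|f'|`. Cauchy–Schwarz then
follows by expanding the integral of `(|f'| - I/ℓ)²`. -/
lemma sq_le_of_exists_zero {ℓ : ℝ} (hℓ : 0 < ℓ) {f f' : ℝ → ℝ}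
    (hf : ∀ η ∈ cell ℓ, HasDerivWithinAt f (f' η) (cell ℓ) η) (hf' : ContinuousOn f' (cell ℓ))
    {z : ℝ} (hz : z ∈ cell ℓ) (hfz : f z = 0) {η : ℝ} (hη : η ∈ cell ℓ) :
    f η ^ 2 ≤ ℓ ^ 2 * (ℓ⁻¹ * ∫ η in (-(ℓ / 2))..(ℓ / 2), f' η ^ 2) := by
  have hle : -(ℓ / 2) ≤ ℓ / 2 := by linarith
  set I := ∫ η in (-(ℓ / 2))..(ℓ / 2), |f' η| with hI
  have hsub : uIcc z η ⊆ cell ℓ := ordConnected_Icc.uIcc_subset hz hη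
  have hFTC : ∫ r in z..η, f' r = f η - f z := by
    refine intervalIntegral.integral_eq_sub_of_hasDeriv_right
      (fun r hr => (hf r (hsub hr)).continuousWithinAt.mono hsub) (fun r hr => ?_)
      (ContinuousOn.intervalIntegrable (hf'.mono hsub))
    have hr' : r ∈ Ioo (-(ℓ / 2)) (ℓ / 2) :=
      ⟨(le_min hz.1 hη.1).trans_lt hr.1, hr.2.trans_le (max_le hz.2 hη.2)⟩
    exact (hasDerivAt_of_cell (hf r (Ioo_subset_Icc_self hr')) hr').hasDerivWithinAt
  have h1 : |f η| ≤ I := by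
    rw [hfz, sub_zero] at hFTC
    rw [← hFTC, ← Real.norm_eq_abs, hI, intervalIntegral.integral_of_le hle]
    refine intervalIntegral.norm_integral_le_integral_norm_uIoc.trans ?_
    refine setIntegral_mono_set ((hf'.norm.integrableOn_Icc).mono_set Ioc_subset_Icc_self)
      (ae_of_all _ fun _ => norm_nonneg _) (LE.le.eventuallyLE fun r hr => ?_)
    exact ⟨(le_min hz.1 hη.1).trans_lt hr.1, hr.2.trans (max_le hz.2 hη.2)⟩
  have ca : ContinuousOn (fun η => |f' η|) (cell ℓ) := hf'.abs
  have h2 : 0 ≤ ∫ r in (-(ℓ / 2))..(ℓ / 2), (f' r ^ 2 - 2 * (I / ℓ) * |f' r| + (I / ℓ) ^ 2) := by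
    refine intervalIntegral.integral_nonneg hle fun r _ => ?_
    rw [← sq_abs (f' r)]
    nlinarith [sq_nonneg (|f' r| - I / ℓ)]
  have i1 : IntervalIntegrable (fun r => f' r ^ 2) volume (-(ℓ / 2)) (ℓ / 2) :=
    intervalIntegrable_of_cell hℓ (hf'.pow 2)
  have i2 : IntervalIntegrable (fun r => 2 * (I / ℓ) * |f' r|) volume (-(ℓ / 2)) (ℓ / 2) :=
    intervalIntegrable_of_cell hℓ (ca.const_mul _)
  have i12 : IntervalIntegrable (fun r => f' r ^ 2 - 2 * (I / ℓ) * |f' r|) volume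
    (-(ℓ / 2)) (ℓ / 2) := i1.sub i2
  rw [intervalIntegral.integral_add i12 (by simp), intervalIntegral.integral_sub i1 i2,
    intervalIntegral.integral_const_mul, intervalIntegral.integral_const, smul_eq_mul, ← hI] at h2
  set V := ∫ η in (-(ℓ / 2))..(ℓ / 2), f' η ^ 2
  have h3 : I ^ 2 ≤ ℓ * V := by
    have e : V - 2 * (I / ℓ) * I + (ℓ / 2 - -(ℓ / 2)) * (I / ℓ) ^ 2 = V - I ^ 2 / ℓ := by
      field_simp; ring
    rw [e, sub_nonneg, div_le_iff₀ hℓ] at h2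
    linarith
  calc f η ^ 2 = |f η| ^ 2 := (sq_abs _).symm
    _ ≤ I ^ 2 := by gcongr
    _ ≤ ℓ * V := h3
    _ = _ := by field_simp

/-- The mean square of the third derivative. -/
noncomputable def thirdSq (ℓ : ℝ) (ψ : ℝ → ℝ) : ℝ :=
  ℓ⁻¹ * ∫ η in (-(ℓ / 2))..(ℓ / 2), dEta ℓ 3 ψ η ^ 2

lemma thirdSq_nonneg {ℓ : ℝ} (hℓ : 0 < ℓ) (ψ : ℝ → ℝ) : 0 ≤ thirdSq ℓ ψ :=
  mul_nonneg (inv_pos.2 hℓ).le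
    (intervalIntegral.integral_nonneg (by linarith) fun _ _ => sq_nonneg _)

/-- Rolle's theorem: periodicity supplies the zero from which the next derivative is integrated. -/
lemma exists_dEta_succ_eq_zero {ℓ : ℝ} (hℓ : 0 < ℓ) {n j : ℕ} {ψ : ℝ → ℝ}
    (hψ : ContDiffOn ℝ n ψ (cell ℓ)) (hj : j < n)
    (hp : dEta ℓ j ψ (-(ℓ / 2)) = dEta ℓ j ψ (ℓ / 2)) :
    ∃ z ∈ cell ℓ, dEta ℓ (j + 1) ψ z = 0 := by
  obtain ⟨z, hz, h⟩ := exists_hasDerivAt_eq_zero (by linarith : -(ℓ / 2) < ℓ / 2)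
    (continuousOn_dEta hℓ hψ hj.le) hp fun η hη =>
      hasDerivAt_of_cell (hasDerivWithinAt_dEta hℓ hψ hj η (Ioo_subset_Icc_self hη)) hη
  exact ⟨z, Ioo_subset_Icc_self hz, h⟩

section Nonlinear

variable {ℓ : ℝ} {φ ψ : ℝ → ℝ}

lemma dEta_two_sq_le (hℓ : 0 < ℓ) (hψ : ContDiffOn ℝ 4 ψ (cell ℓ))
    (pψ : ∀ j ≤ 3, dEta ℓ j ψ (-(ℓ / 2)) = dEta ℓ j ψ (ℓ / 2)) {η : ℝ} (hη : η ∈ cell ℓ) :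
    dEta ℓ 2 ψ η ^ 2 ≤ ℓ ^ 2 * thirdSq ℓ ψ := by
  obtain ⟨z, hz, h⟩ := exists_dEta_succ_eq_zero hℓ (n := 4) hψ (j := 1) (by norm_num)
    (pψ 1 (by norm_num))
  exact sq_le_of_exists_zero hℓ (hasDerivWithinAt_dEta hℓ (n := 4) hψ (by norm_num))
    (continuousOn_dEta hℓ (n := 4) hψ (by norm_num)) hz h hη

lemma dEta_one_sq_le (hℓ : 0 < ℓ) (hψ : ContDiffOn ℝ 4 ψ (cell ℓ))
    (pψ : ∀ j ≤ 3, dEta ℓ j ψ (-(ℓ / 2)) = dEta ℓ j ψ (ℓ / 2)) {η : ℝ} (hη : η ∈ cell ℓ) :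
    dEta ℓ 1 ψ η ^ 2 ≤ ℓ ^ 4 * thirdSq ℓ ψ := by
  obtain ⟨z, hz, h⟩ := exists_dEta_succ_eq_zero hℓ (n := 4) hψ (j := 0) (by norm_num)
    (pψ 0 (by norm_num))
  have h1 := sq_le_of_exists_zero hℓ (hasDerivWithinAt_dEta hℓ (n := 4) hψ (j := 1) (by norm_num))
    (continuousOn_dEta hℓ (n := 4) hψ (by norm_num)) hz h hη
  have h2 := integral_sq_le hℓ (continuousOn_dEta hℓ (n := 4) hψ (by norm_num)) fun η hη =>
    dEta_two_sq_le hℓ hψ pψ hη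
  calc _ ≤ _ := h1
    _ ≤ ℓ ^ 2 * (ℓ ^ 2 * thirdSq ℓ ψ) := by gcongr
    _ = _ := by ring

lemma sq_add_three_le (a b c : ℝ) : (a + b + c) ^ 2 ≤ 3 * (a ^ 2 + b ^ 2 + c ^ 2) := by
  nlinarith [sq_nonneg (a - b), sq_nonneg (a - c), sq_nonneg (b - c)]

/-- The weighted sum is at most the mean square of the first derivative of the convective term. It
contains derivatives of `ψ` of order at most two, each bounded pointwise by `thirdSq`. -/
lemma sum_lam_convTerm_le (hℓ : 0 < ℓ) {ε A : ℝ}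
    (hφ : ContDiffOn ℝ 4 φ (cell ℓ))
    (pφ : ∀ j ≤ 3, dEta ℓ j φ (-(ℓ / 2)) = dEta ℓ j φ (ℓ / 2))
    (hA : ∀ η ∈ cell ℓ, ∀ j ≤ 4, |dEta ℓ j φ η| ≤ A)
    (hψ : ContDiffOn ℝ 4 ψ (cell ℓ))
    (pψ : ∀ j ≤ 3, dEta ℓ j ψ (-(ℓ / 2)) = dEta ℓ j ψ (ℓ / 2)) (N : Finset ℤ) :
    ∑ k ∈ N, lam ℓ k * coef ℓ (convTerm ℓ ε φ ψ) k ^ 2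
      ≤ 3 * (A ^ 2 * (ℓ ^ 4 * thirdSq ℓ ψ) + A ^ 2 * (ℓ ^ 2 * thirdSq ℓ ψ)
        + ε ^ 2 * (ℓ ^ 4 * thirdSq ℓ ψ) * (ℓ ^ 2 * thirdSq ℓ ψ)) := by
  have d1 := hasDerivWithinAt_dEta hℓ (n := 4) hφ (j := 1) (by norm_num)
  have d1' := hasDerivWithinAt_dEta hℓ (n := 4) hψ (j := 1) (by norm_num)
  have c : ∀ j ≤ 4, ContinuousOn (dEta ℓ j φ) (cell ℓ) := fun j hj => continuousOn_dEta hℓ hφ hj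
  have c' : ∀ j ≤ 4, ContinuousOn (dEta ℓ j ψ) (cell ℓ) := fun j hj => continuousOn_dEta hℓ hψ hj
  have c1 := c 1 (by norm_num)
  have c2 := c 2 (by norm_num)
  have c1' := c' 1 (by norm_num)
  have c2' := c' 2 (by norm_num)
  set g : ℝ → ℝ := fun η => -(dEta ℓ 2 φ η * dEta ℓ 1 ψ η) + -(dEta ℓ 1 φ η * dEta ℓ 2 ψ η)
    + -(ε * dEta ℓ 1 ψ η * dEta ℓ 2 ψ η) with hg
  have cg : ContinuousOn g (cell ℓ) := by fun_prop
  have hd : ∀ η ∈ cell ℓ, HasDerivWithinAt (convTerm ℓ ε φ ψ) (g η) (cell ℓ) η := fun η hη =>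
    (((d1 η hη).mul (d1' η hη)).neg.sub (((d1' η hη).pow 2).const_mul (ε / 2))).congr_deriv (by
      simp only [hg]; norm_num; ring)
  have hp : convTerm ℓ ε φ ψ (-(ℓ / 2)) = convTerm ℓ ε φ ψ (ℓ / 2) := by
    simp only [convTerm, pφ 1 (by norm_num), pψ 1 (by norm_num)]
  refine (sum_le_hasSum N (fun k _ => mul_nonneg (lam_nonneg ℓ k) (sq_nonneg _))
    (hasSum_lam_coef_sq hℓ hd cg hp)).trans (integral_sq_le hℓ cg fun η hη => ?_)
  have hsq : ∀ j ≤ 4, dEta ℓ j φ η ^ 2 ≤ A ^ 2 := fun j hj =>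
    sq_le_sq' (neg_le_of_abs_le (hA η hη j hj)) (le_of_abs_le (hA η hη j hj))
  have m1 := dEta_one_sq_le hℓ hψ pψ hη
  have m2 := dEta_two_sq_le hℓ hψ pψ hη
  have hE := thirdSq_nonneg hℓ ψ
  refine (sq_add_three_le _ _ _).trans ?_
  simp only [neg_sq, mul_pow]
  have h1 := hsq 1 (by norm_num)
  have h2 := hsq 2 (by norm_num)
  gcongr

/-- The part of the squared slope that depends on `ψ`, divided by `ε`. -/
noncomputable def crossTerm (ℓ ε : ℝ) (φ ψ : ℝ → ℝ) (η : ℝ) : ℝ :=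
  2 * dEta ℓ 1 φ η * dEta ℓ 1 ψ η + ε * (dEta ℓ 1 ψ η) ^ 2

/-- The part of the squared slope without `ψ` is a known source and tolerates the weight `λ³`. The
part with `ψ` carries an explicit `ε`, which pairs with the surplus `ε λ` of `symB`. -/
lemma coef_slopeSq (hℓ : 0 < ℓ) {ε : ℝ} (hφ : ContDiffOn ℝ 4 φ (cell ℓ))
    (hψ : ContDiffOn ℝ 4 ψ (cell ℓ)) (k : ℤ) :
    coef ℓ (slopeSq ℓ ε φ ψ) k = slopeCoef ℓ φ k + ε * coef ℓ (crossTerm ℓ ε φ ψ) k := by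
  have c1 := continuousOn_dEta hℓ (n := 4) hφ (by norm_num : 1 ≤ 4)
  have c1' := continuousOn_dEta hℓ (n := 4) hψ (by norm_num : 1 ≤ 4)
  have e : slopeSq ℓ ε φ ψ = fun η => dEta ℓ 1 φ η ^ 2 + ε * crossTerm ℓ ε φ ψ η := by
    ext η; simp only [slopeSq, crossTerm]; ring
  have ca : ContinuousOn (fun η => dEta ℓ 1 φ η ^ 2) (cell ℓ) := c1.pow 2
  have cb : ContinuousOn (fun η => ε * crossTerm ℓ ε φ ψ η) (cell ℓ) := by
    unfold crossTerm; fun_prop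
  rw [e, coef_add hℓ ca cb, coef_const_mul]
  rfl

/-- In the second derivative of the cross term the top derivative `ψ_ηηη` occurs linearly, with
pointwise bounded coefficients. Its square can thus be integrated, while all other factors are
bounded pointwise by `thirdSq`. -/
lemma sum_lam_crossTerm_le (hℓ : 0 < ℓ) {ε A : ℝ}
    (hφ : ContDiffOn ℝ 4 φ (cell ℓ))
    (pφ : ∀ j ≤ 3, dEta ℓ j φ (-(ℓ / 2)) = dEta ℓ j φ (ℓ / 2))
    (hA : ∀ η ∈ cell ℓ, ∀ j ≤ 4, |dEta ℓ j φ η| ≤ A)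
    (hψ : ContDiffOn ℝ 4 ψ (cell ℓ))
    (pψ : ∀ j ≤ 3, dEta ℓ j ψ (-(ℓ / 2)) = dEta ℓ j ψ (ℓ / 2)) (N : Finset ℤ) :
    ∑ k ∈ N, lam ℓ k ^ 2 * coef ℓ (crossTerm ℓ ε φ ψ) k ^ 2
      ≤ 20 * (A ^ 2 * (ℓ ^ 4 * thirdSq ℓ ψ) + 4 * (A ^ 2 * (ℓ ^ 2 * thirdSq ℓ ψ))
        + ε ^ 2 * (ℓ ^ 2 * thirdSq ℓ ψ) ^ 2 + (A ^ 2 + ε ^ 2 * (ℓ ^ 4 * thirdSq ℓ ψ))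
          * thirdSq ℓ ψ) := by
  have d : ∀ j < 4, ∀ η ∈ cell ℓ, HasDerivWithinAt (dEta ℓ j φ) (dEta ℓ (j + 1) φ η) (cell ℓ) η :=
    fun j hj => hasDerivWithinAt_dEta hℓ (n := 4) hφ hj
  have d' : ∀ j < 4, ∀ η ∈ cell ℓ, HasDerivWithinAt (dEta ℓ j ψ) (dEta ℓ (j + 1) ψ η) (cell ℓ) η :=
    fun j hj => hasDerivWithinAt_dEta hℓ (n := 4) hψ hj
  have c : ∀ j ≤ 4, ContinuousOn (dEta ℓ j φ) (cell ℓ) := fun j hj => continuousOn_dEta hℓ hφ hj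
  have c' : ∀ j ≤ 4, ContinuousOn (dEta ℓ j ψ) (cell ℓ) := fun j hj => continuousOn_dEta hℓ hψ hj
  have c1 := c 1 (by norm_num)
  have c2 := c 2 (by norm_num)
  have c3 := c 3 (by norm_num)
  have c1' := c' 1 (by norm_num)
  have c2' := c' 2 (by norm_num)
  have c3' := c' 3 (by norm_num)
  set g : ℝ → ℝ := fun η => 2 * dEta ℓ 2 φ η * dEta ℓ 1 ψ η + 2 * dEta ℓ 1 φ η * dEta ℓ 2 ψ η
    + 2 * ε * dEta ℓ 1 ψ η * dEta ℓ 2 ψ η with hg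
  set h : ℝ → ℝ := fun η => 2 * dEta ℓ 3 φ η * dEta ℓ 1 ψ η + 4 * dEta ℓ 2 φ η * dEta ℓ 2 ψ η
    + 2 * dEta ℓ 1 φ η * dEta ℓ 3 ψ η + 2 * ε * dEta ℓ 2 ψ η ^ 2
    + 2 * ε * dEta ℓ 1 ψ η * dEta ℓ 3 ψ η with hh
  have cg : ContinuousOn g (cell ℓ) := by fun_prop
  have ch : ContinuousOn h (cell ℓ) :=
    (((((c3.const_mul 2).mul c1').add ((c2.const_mul 4).mul c2')).add
      ((c1.const_mul 2).mul c3')).add ((c2'.pow 2).const_mul (2 * ε))).add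
      ((c1'.const_mul (2 * ε)).mul c3')
  have hd : ∀ η ∈ cell ℓ, HasDerivWithinAt (crossTerm ℓ ε φ ψ) (g η) (cell ℓ) η := fun η hη =>
    ((((d 1 (by norm_num) η hη).const_mul 2).mul (d' 1 (by norm_num) η hη)).add
      (((d' 1 (by norm_num) η hη).pow 2).const_mul ε)).congr_deriv (by
      simp only [hg]; norm_num; ring)
  have hd' : ∀ η ∈ cell ℓ, HasDerivWithinAt g (h η) (cell ℓ) η := fun η hη =>
    (((((d 2 (by norm_num) η hη).const_mul 2).mul (d' 1 (by norm_num) η hη)).add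
      (((d 1 (by norm_num) η hη).const_mul 2).mul (d' 2 (by norm_num) η hη))).add
      (((d' 1 (by norm_num) η hη).const_mul (2 * ε)).mul (d' 2 (by norm_num) η hη))).congr_deriv (by
      simp only [hh]; norm_num; ring)
  have hp : crossTerm ℓ ε φ ψ (-(ℓ / 2)) = crossTerm ℓ ε φ ψ (ℓ / 2) := by
    simp only [crossTerm, pφ 1 (by norm_num), pψ 1 (by norm_num)]
  have hp' : g (-(ℓ / 2)) = g (ℓ / 2) := by
    simp only [hg, pφ 1 (by norm_num), pψ 1 (by norm_num), pφ 2 (by norm_num), pψ 2 (by norm_num)]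
  have hsum := hasSum_lam_pow_succ hℓ hd cg hp (j := 1)
    (by simpa only [pow_one] using hasSum_lam_coef_sq hℓ hd' ch hp')
  refine (sum_le_hasSum N (fun k _ => mul_nonneg (pow_nonneg (lam_nonneg ℓ k) 2) (sq_nonneg _)) hsum).trans ?_
  set E := thirdSq ℓ ψ with hE
  have hE0 : 0 ≤ E := thirdSq_nonneg hℓ ψ
  set K := 20 * (A ^ 2 * (ℓ ^ 4 * E) + 4 * (A ^ 2 * (ℓ ^ 2 * E)) + ε ^ 2 * (ℓ ^ 2 * E) ^ 2) with hK
  set L := 20 * (A ^ 2 + ε ^ 2 * (ℓ ^ 4 * E)) with hL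
  have hpt : ∀ η ∈ cell ℓ, h η ^ 2 ≤ K + L * dEta ℓ 3 ψ η ^ 2 := by
    intro η hη
    have hsq : ∀ j ≤ 4, dEta ℓ j φ η ^ 2 ≤ A ^ 2 := fun j hj =>
      sq_le_sq' (neg_le_of_abs_le (hA η hη j hj)) (le_of_abs_le (hA η hη j hj))
    have m1 := dEta_one_sq_le hℓ hψ pψ hη
    have m2 := dEta_two_sq_le hℓ hψ pψ hη
    have h1 := hsq 1 (by norm_num)
    have h2 := hsq 2 (by norm_num)
    have h3 := hsq 3 (by norm_num)
    have five : ∀ a b c d e : ℝ, (2 * a + 4 * b + 2 * c + 2 * d + 2 * e) ^ 2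
        ≤ 20 * (a ^ 2 + 4 * b ^ 2 + d ^ 2 + (c ^ 2 + e ^ 2)) := fun a b c d e => by
      nlinarith [sq_nonneg (a - 2 * b), sq_nonneg (a - c), sq_nonneg (a - d), sq_nonneg (a - e),
        sq_nonneg (2 * b - c), sq_nonneg (2 * b - d), sq_nonneg (2 * b - e), sq_nonneg (c - d),
        sq_nonneg (c - e), sq_nonneg (d - e)]
    calc h η ^ 2 = (2 * (dEta ℓ 3 φ η * dEta ℓ 1 ψ η) + 4 * (dEta ℓ 2 φ η * dEta ℓ 2 ψ η)
          + 2 * (dEta ℓ 1 φ η * dEta ℓ 3 ψ η) + 2 * (ε * dEta ℓ 2 ψ η ^ 2)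
          + 2 * (ε * dEta ℓ 1 ψ η * dEta ℓ 3 ψ η)) ^ 2 := by simp only [hh]; ring
      _ ≤ _ := five _ _ _ _ _
      _ ≤ 20 * (A ^ 2 * (ℓ ^ 4 * E) + 4 * (A ^ 2 * (ℓ ^ 2 * E)) + ε ^ 2 * (ℓ ^ 2 * E) ^ 2
          + (A ^ 2 * dEta ℓ 3 ψ η ^ 2 + ε ^ 2 * (ℓ ^ 4 * E) * dEta ℓ 3 ψ η ^ 2)) := by
          simp only [mul_pow (dEta ℓ 3 φ η), mul_pow (dEta ℓ 2 φ η), mul_pow (dEta ℓ 1 φ η),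
            mul_pow (ε * dEta ℓ 1 ψ η), mul_pow ε]
          gcongr
      _ = _ := by rw [hK, hL]; ring
  have c3sq : ContinuousOn (fun η => dEta ℓ 3 ψ η ^ 2) (cell ℓ) := c3'.pow 2
  have hint : ∫ η in (-(ℓ / 2))..(ℓ / 2), h η ^ 2
      ≤ ∫ η in (-(ℓ / 2))..(ℓ / 2), (K + L * dEta ℓ 3 ψ η ^ 2) :=
    intervalIntegral.integral_mono_on (by linarith) (intervalIntegrable_of_cell hℓ (ch.pow 2))
      (intervalIntegrable_of_cell hℓ (by fun_prop)) hpt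
  rw [intervalIntegral.integral_add (by simp) (intervalIntegrable_of_cell hℓ (by fun_prop)),
    intervalIntegral.integral_const, intervalIntegral.integral_const_mul, smul_eq_mul] at hint
  have hE' : ∫ η in (-(ℓ / 2))..(ℓ / 2), dEta ℓ 3 ψ η ^ 2 = ℓ * E := by
    rw [hE, thirdSq]; field_simp
  rw [hE'] at hint
  rw [inv_mul_le_iff₀ hℓ]
  refine hint.trans (le_of_eq ?_)
  rw [hK, hL]; ring

/-- Applied with `k = 0`: the weight `λ` does not see the mean, so the unweighted coefficient needs
its own bound. -/
lemma coef_convTerm_sq_le (hℓ : 0 < ℓ) {ε A : ℝ}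
    (hφ : ContDiffOn ℝ 4 φ (cell ℓ))
    (hA : ∀ η ∈ cell ℓ, ∀ j ≤ 4, |dEta ℓ j φ η| ≤ A)
    (hψ : ContDiffOn ℝ 4 ψ (cell ℓ))
    (pψ : ∀ j ≤ 3, dEta ℓ j ψ (-(ℓ / 2)) = dEta ℓ j ψ (ℓ / 2)) (k : ℤ) :
    coef ℓ (convTerm ℓ ε φ ψ) k ^ 2
      ≤ 2 * (A ^ 2 * (ℓ ^ 4 * thirdSq ℓ ψ)) + ε ^ 2 * (ℓ ^ 4 * thirdSq ℓ ψ) ^ 2 := by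
  have c1 := continuousOn_dEta hℓ (n := 4) hφ (by norm_num : 1 ≤ 4)
  have c1' := continuousOn_dEta hℓ (n := 4) hψ (by norm_num : 1 ≤ 4)
  have cP : ContinuousOn (convTerm ℓ ε φ ψ) (cell ℓ) := by unfold convTerm; fun_prop
  refine (coef_sq_le hℓ cP k).trans (integral_sq_le hℓ cP fun η hη => ?_)
  have m1 := dEta_one_sq_le hℓ hψ pψ hη
  have h1 : dEta ℓ 1 φ η ^ 2 ≤ A ^ 2 := sq_le_sq' (neg_le_of_abs_le (hA η hη 1 (by norm_num)))
    (le_of_abs_le (hA η hη 1 (by norm_num)))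
  have hE0 := thirdSq_nonneg hℓ ψ
  have h2 : dEta ℓ 1 φ η ^ 2 * dEta ℓ 1 ψ η ^ 2 ≤ A ^ 2 * (ℓ ^ 4 * thirdSq ℓ ψ) := by gcongr
  have h3 : ε ^ 2 * (dEta ℓ 1 ψ η ^ 2) ^ 2 ≤ ε ^ 2 * (ℓ ^ 4 * thirdSq ℓ ψ) ^ 2 := by gcongr
  unfold convTerm
  nlinarith [sq_nonneg (dEta ℓ 1 φ η * dEta ℓ 1 ψ η - ε / 2 * dEta ℓ 1 ψ η ^ 2),
    sq_nonneg (ε * dEta ℓ 1 ψ η ^ 2)]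

end Nonlinear

/-! ### A Gronwall inequality with a small quadratic term -/

/-- The right-hand side `F` satisfies `F' ≤ C F (1 + e F)`. This makes `F / (1 + e F) · e^{-Ct}`
nonincreasing, the exact Bernoulli substitution, so no continuation argument is needed. -/
lemma gronwall_quadratic {T C A e : ℝ} (hC : 0 ≤ C) (hA : 0 ≤ A) (he : 0 ≤ e) {E : ℝ → ℝ}
    (hE : ContinuousOn E (Icc 0 T)) (hE0 : ∀ t ∈ Icc 0 T, 0 ≤ E t)
    (h : ∀ t ∈ Icc 0 T, E t ≤ A + C * ∫ s in (0 : ℝ)..t, (E s + e * E s ^ 2))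
    (hs : e * (A * Real.exp (C * T)) ≤ 1 / 2) {t : ℝ} (ht : t ∈ Icc 0 T) :
    E t ≤ 2 * (A * Real.exp (C * T)) := by
  set q : ℝ → ℝ := fun s => E s + e * E s ^ 2 with hq
  have cq : ContinuousOn q (Icc 0 T) := by fun_prop
  set F : ℝ → ℝ := fun t => A + C * ∫ s in (0 : ℝ)..t, q s with hF
  have hEF : ∀ t ∈ Icc 0 T, E t ≤ F t := h
  have hF0 : ∀ t ∈ Icc 0 T, 0 ≤ F t := fun t ht => (hE0 t ht).trans (hEF t ht)
  have hT : 0 ≤ T := ht.1.trans ht.2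
  have cF : ContinuousOn F (Icc 0 T) := by
    have := intervalIntegral.continuousOn_primitive_interval (f := q) (a := 0) (b := T) (μ := volume)
      (by rw [uIcc_of_le hT]; exact cq.integrableOn_Icc)
    rw [uIcc_of_le hT] at this
    exact (this.const_mul C).const_add A
  have hdF : ∀ t ∈ Ioo 0 T, HasDerivAt F (C * q t) t := fun t ht => by
    have hn : Icc 0 T ∈ nhds t := Icc_mem_nhds ht.1 ht.2
    have := intervalIntegral.integral_hasDerivAt_right (f := q) (a := 0) (b := t)
      (ContinuousOn.intervalIntegrable (by
        rw [uIcc_of_le ht.1.le]; exact cq.mono (Icc_subset_Icc_right ht.2.le)))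
      (cq.stronglyMeasurableAtFilter_nhdsWithin measurableSet_Icc t |>.filter_mono
        (by rw [nhdsWithin_eq_nhds.2 hn])) (cq.continuousAt hn)
    exact (this.const_mul C).const_add A
  have hpos : ∀ t ∈ Icc 0 T, 0 < 1 + e * F t := fun t ht => by
    have := mul_nonneg he (hF0 t ht); linarith
  set G : ℝ → ℝ := fun t => F t / (1 + e * F t) * Real.exp (-(C * t)) with hG
  have hanti : AntitoneOn G (Icc 0 T) := by
    refine antitoneOn_of_hasDerivWithinAt_nonpos (convex_Icc 0 T)
      (f' := fun t => (C * q t / (1 + e * F t) ^ 2 - C * (F t / (1 + e * F t)))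
        * Real.exp (-(C * t))) ?_ ?_ ?_
    · exact (cF.div (by fun_prop) fun t ht => (hpos t ht).ne').mul (by fun_prop)
    · intro t ht
      rw [interior_Icc] at ht
      have hp := (hpos t (Ioo_subset_Icc_self ht)).ne'
      refine HasDerivAt.hasDerivWithinAt ?_
      refine (((hdF t ht).div (((hdF t ht).const_mul e).const_add 1) hp).mul
        ((((hasDerivAt_id t).const_mul C).neg).exp)).congr_deriv ?_
      simp only [Pi.neg_apply, Pi.div_apply, id, mul_one]
      field_simp
      ring
    · intro t ht
      rw [interior_Icc] at ht
      have htI := Ioo_subset_Icc_self ht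
      refine mul_nonpos_of_nonpos_of_nonneg ?_ (Real.exp_pos _).le
      have hp := hpos t htI
      have hqF : q t ≤ F t * (1 + e * F t) := by
        have := hEF t htI
        have h0 := hE0 t htI
        have h2 : e * E t ^ 2 ≤ e * F t ^ 2 := by gcongr
        simp only [hq]; nlinarith
      rw [sub_nonpos, div_le_iff₀ (by positivity)]
      calc C * q t ≤ C * (F t * (1 + e * F t)) := by gcongr
        _ = _ := by field_simp
  have h1 := hanti ⟨le_rfl, hT⟩ ht ht.1
  have hFt := hF0 t ht
  have hpt := hpos t ht
  have hG0 : G 0 ≤ A := by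
    simp only [hG, hF, intervalIntegral.integral_same, mul_zero, add_zero, neg_zero, Real.exp_zero,
      mul_one]
    exact div_le_self hA (by have := mul_nonneg he hA; linarith)
  have h2 : F t / (1 + e * F t) ≤ A * Real.exp (C * T) := by
    have h3 : F t / (1 + e * F t) * Real.exp (-(C * t)) ≤ A := h1.trans hG0
    rw [Real.exp_neg, ← div_eq_mul_inv, div_le_iff₀ (Real.exp_pos _)] at h3
    refine h3.trans ?_
    gcongr
    exact ht.2
  set D := A * Real.exp (C * T)
  rw [div_le_iff₀ hpt] at h2
  have h4 := hEF t ht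
  -- From `F ≤ D (1 + e F)` and `e D ≤ 1/2` one gets `F ≤ D + F/2`.
  nlinarith [mul_le_mul_of_nonneg_right hs hFt]

/-! ### The energy estimate for the remainder -/

/-- The mode equation is multiplied by `2 λ y'`. Four Young inequalities, for `λ y`, `P`, `G x₀` and
`H`, together use up one unit of `λ y'²`. The term `ε G x₁` is balanced against `ε λ² y'²` from `B`,
so `x₁` needs only the weight `λ²`. -/
lemma mode_inequality {ε l B S G y y' P x₀ x₁ H : ℝ} (hε : 0 ≤ ε) (hl : 0 ≤ l)
    (hB : 1 + ε * l ≤ B) (hG : |G| ≤ 3 * l)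
    (heq : B * y' = S * y + P + G * (x₀ + ε * x₁) + H) :
    l * y' ^ 2 + 2 * (l * (l - S) * (y * y'))
      ≤ 4 * (l ^ 3 * y ^ 2) + 4 * (l * P ^ 2) + 36 * (l ^ 3 * x₀ ^ 2)
        + 5 * ε * (l ^ 2 * x₁ ^ 2) + 4 * (l * H ^ 2) := by
  have young : ∀ a b : ℝ, l * (a * b) ≤ l * (a ^ 2 / 8 + 2 * b ^ 2) := fun a b =>
    mul_le_mul_of_nonneg_left (by nlinarith [sq_nonneg (a - 4 * b)]) hl
  have hG2 : G ^ 2 ≤ 9 * l ^ 2 := by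
    rw [← sq_abs]
    nlinarith [abs_nonneg G]
  have h1 := young y' (l * y)
  have h2 := young y' P
  have h3 := young y' (G * x₀)
  have h4 := young y' H
  -- Both factors are scaled by `λ`, with `ε` in front, to match the surplus `ε (λ y')²`.
  have h5 : ε * ((l * y') * (G * x₁)) ≤ ε * ((l * y') ^ 2 + (G * x₁) ^ 2 / 4) :=
    mul_le_mul_of_nonneg_left (by nlinarith [sq_nonneg (2 * (l * y') - G * x₁)]) hε
  have h6 : ε * (G ^ 2 * x₁ ^ 2) ≤ ε * (9 * l ^ 2 * x₁ ^ 2) := by gcongr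
  have h7 : l * (G ^ 2 * x₀ ^ 2) ≤ l * (9 * l ^ 2 * x₀ ^ 2) := by gcongr
  have h8 : l * y' ^ 2 * (1 + ε * l) ≤ l * y' ^ 2 * B := by gcongr
  have h9 : l * y' ^ 2 * B = l * y' * (S * y + P + G * (x₀ + ε * x₁) + H) := by
    rw [← heq]; ring
  have h10 : 0 ≤ ε * (l ^ 2 * x₁ ^ 2) := by positivity
  nlinarith

/-- The constant in the energy inequality. -/
noncomputable def energyConst (ℓ A : ℝ) : ℝ :=
  4 + 12 * (A ^ 2 * ℓ ^ 4 + A ^ 2 * ℓ ^ 2 + ℓ ^ 6)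
    + 100 * (A ^ 2 * ℓ ^ 4 + 4 * (A ^ 2 * ℓ ^ 2) + A ^ 2 + 2 * ℓ ^ 4)

lemma energyConst_nonneg {ℓ : ℝ} (A : ℝ) : 0 ≤ energyConst ℓ A := by
  unfold energyConst; positivity

section Remainder

variable {ℓ α ε T A : ℝ} {Φ₀ : ℝ → ℝ} {Φ ρ : ℝ → ℝ → ℝ}

/-- Summation of `mode_inequality`. The first summand on the right closes on the energy, with the
quadratic part carrying the factor `ε²`; the other two depend on `Φ` alone. The term `2 λ (λ - S) y
y'` on the left is an exact time derivative. -/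
lemma SolvesRemainder.energy_pointwise (hℓ : 0 < ℓ) (hT : 0 < T) (hε : 0 < ε) (hε' : ε ≤ 1)
    (hΦ : SolvesKS ℓ Φ₀ Φ) (hA : ∀ t ∈ Icc 0 T, ∀ η ∈ cell ℓ, ∀ j ≤ 4, |dEta ℓ j (Φ t) η| ≤ A)
    (hρ : MemY ℓ α T ρ) (hsol : SolvesRemainder ℓ ε T Φ ρ) {t : ℝ} (ht : t ∈ Ioo 0 T)
    (hs : Summable fun k => lam ℓ k ^ 3 * coef ℓ (dFst (Ici 0) Φ t) k ^ 2) (N : Finset ℤ) :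
    ∑ k ∈ N, (lam ℓ k * coef ℓ (dFst (Icc 0 T) ρ t) k ^ 2
      + 2 * (lam ℓ k * (lam ℓ k - symS ℓ ε k)
        * (coef ℓ (ρ t) k * coef ℓ (dFst (Icc 0 T) ρ t) k)))
      ≤ energyConst ℓ A * (thirdSq ℓ (ρ t) + ε ^ 2 * thirdSq ℓ (ρ t) ^ 2) + 2304 * A ^ 4
        + 200 * ∑ k ∈ N, (lam ℓ k ^ 5 * coef ℓ (Φ t) k ^ 2
          + lam ℓ k ^ 3 * coef ℓ (dFst (Ici 0) Φ t) k ^ 2) := by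
  have htI : t ∈ Icc 0 T := Ioo_subset_Icc_self ht
  have hρt := hρ.1.2.1 t htI
  have pρ := hρ.2.2 t htI
  have hΦt := hΦ.regular.2.1 t ht.1.le
  have pΦ := hΦ.periodic t ht.1.le
  have hH := (opH_coef hℓ hε hΦt pΦ
    ((hΦ.regular.contOnRect_dFst (Icc_subset_Ici_zero T)).slice htI) hs).2
  have hmode : ∀ k ∈ N, lam ℓ k * coef ℓ (dFst (Icc 0 T) ρ t) k ^ 2
      + 2 * (lam ℓ k * (lam ℓ k - symS ℓ ε k)
        * (coef ℓ (ρ t) k * coef ℓ (dFst (Icc 0 T) ρ t) k))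
      ≤ 4 * (lam ℓ k ^ 3 * coef ℓ (ρ t) k ^ 2)
        + 4 * (lam ℓ k * coef ℓ (convTerm ℓ ε (Φ t) (ρ t)) k ^ 2)
        + 36 * (lam ℓ k ^ 3 * slopeCoef ℓ (Φ t) k ^ 2)
        + 5 * (lam ℓ k ^ 2 * coef ℓ (crossTerm ℓ ε (Φ t) (ρ t)) k ^ 2)
        + 200 * (lam ℓ k ^ 5 * coef ℓ (Φ t) k ^ 2
          + lam ℓ k ^ 3 * coef ℓ (dFst (Ici 0) Φ t) k ^ 2) := fun k _ => by
    have heq := hsol.coef_equation hℓ hT hε hε' hΦ hρ ht hs k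
    rw [coef_slopeSq hℓ hΦt hρt] at heq
    have hl := lam_nonneg ℓ k
    have h1 := mode_inequality hε.le hl (symB_ge hε k) (abs_symG_le hε k) heq
    have h2 := mul_le_mul_of_nonneg_left (hH k) hl
    have h3 : 0 ≤ (1 - ε) * (lam ℓ k ^ 2 * coef ℓ (crossTerm ℓ ε (Φ t) (ρ t)) k ^ 2) :=
      mul_nonneg (by linarith) (by positivity)
    nlinarith
  refine (Finset.sum_le_sum hmode).trans ?_
  simp only [Finset.sum_add_distrib, ← Finset.mul_sum]
  have h3 := sum_le_hasSum N (fun k _ => mul_nonneg (pow_nonneg (lam_nonneg ℓ k) 3) (sq_nonneg _))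
    (hasSum_lam_pow_dEta hℓ (n := 4) hρt (by norm_num : 3 ≤ 4) fun i hi => pρ i (by omega))
  have hP := sum_lam_convTerm_le (ε := ε) hℓ hΦt pΦ (hA t htI) hρt pρ N
  have hX := sum_lam_crossTerm_le (ε := ε) hℓ hΦt pΦ (hA t htI) hρt pρ N
  have h0 : ∑ k ∈ N, lam ℓ k ^ 3 * slopeCoef ℓ (Φ t) k ^ 2 ≤ 64 * A ^ 4 := by
    refine (sum_le_hasSum N (fun k _ => mul_nonneg (pow_nonneg (lam_nonneg ℓ k) 3) (sq_nonneg _))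
      (hΦ.slope_hasSum hℓ ht.1.le)).trans (integral_sq_le hℓ ?_ fun η hη => ?_)
    · have c : ∀ j ≤ 4, ContinuousOn (dEta ℓ j (Φ t)) (cell ℓ) := fun j hj =>
        continuousOn_dEta hℓ (n := 4) hΦt hj
      exact (((c 2 (by norm_num)).const_mul 6).mul (c 3 (by norm_num))).add
        (((c 1 (by norm_num)).const_mul 2).mul (c 4 (by norm_num)))
    · have b := hA t htI η hη
      have hA0 : 0 ≤ A := (abs_nonneg _).trans (b 0 (by norm_num))
      have b1 : |dEta ℓ 2 (Φ t) η * dEta ℓ 3 (Φ t) η| ≤ A * A := by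
        rw [abs_mul]; exact mul_le_mul (b 2 (by norm_num)) (b 3 (by norm_num)) (abs_nonneg _) hA0
      have b2 : |dEta ℓ 1 (Φ t) η * dEta ℓ 4 (Φ t) η| ≤ A * A := by
        rw [abs_mul]; exact mul_le_mul (b 1 (by norm_num)) (b 4 (by norm_num)) (abs_nonneg _) hA0
      have b3 : |6 * dEta ℓ 2 (Φ t) η * dEta ℓ 3 (Φ t) η + 2 * dEta ℓ 1 (Φ t) η * dEta ℓ 4 (Φ t) η|
          ≤ 8 * (A * A) := by
        rw [abs_le] at b1 b2 ⊢
        constructor <;> linarith [b1.1, b1.2, b2.1, b2.2]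
      rw [← sq_abs]
      calc _ ≤ (8 * (A * A)) ^ 2 := by gcongr
        _ = _ := by ring
  change _ ≤ thirdSq ℓ (ρ t) at h3
  have hE := thirdSq_nonneg hℓ (ρ t)
  unfold energyConst
  set E := thirdSq ℓ (ρ t)
  have e1 : 0 ≤ A ^ 2 * ℓ ^ 4 * (ε ^ 2 * E ^ 2) := by positivity
  have e2 : 0 ≤ A ^ 2 * ℓ ^ 2 * (ε ^ 2 * E ^ 2) := by positivity
  have e3 : 0 ≤ A ^ 2 * (ε ^ 2 * E ^ 2) := by positivity
  have e4 : 0 ≤ ℓ ^ 6 * E := by positivity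
  have e5 : 0 ≤ ℓ ^ 4 * E := by positivity
  have e6 : 0 ≤ ε ^ 2 * E ^ 2 := by positivity
  linarith

lemma MemY.continuousOn_thirdSq (hℓ : 0 < ℓ) (hρ : MemY ℓ α T ρ) :
    ContinuousOn (fun t => thirdSq ℓ (ρ t)) (Icc 0 T) :=
  (((hρ.1.contOnRect_dEta (Subset.refl _) (by norm_num : 3 ≤ 4)).pow 2).continuousOn_integral
    hℓ).const_mul _

/-- The pointwise inequality holds at almost every time and is integrated over `[0, τ]`. The initial
energy vanishes, and `neg_symS_ge` makes the final one control `Σ λ³ y²`. -/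
lemma SolvesRemainder.energy (hℓ : 0 < ℓ) (hT : 0 < T) (hε : 0 < ε) (hε' : ε ≤ 1 / 2)
    (hΦ : SolvesKS ℓ Φ₀ Φ) (hA : ∀ t ∈ Icc 0 T, ∀ η ∈ cell ℓ, ∀ j ≤ 4, |dEta ℓ j (Φ t) η| ≤ A)
    {C : ℝ} (hC : ∀ N : Finset ℤ, ∫ t in (0 : ℝ)..T, ∑ k ∈ N, (lam ℓ k ^ 5 * coef ℓ (Φ t) k ^ 2
      + lam ℓ k ^ 3 * coef ℓ (dFst (Ici 0) Φ t) k ^ 2) ≤ C)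
    (hs : ∀ᵐ t ∂(volume.restrict (Ioc 0 T)),
      Summable fun k => lam ℓ k ^ 3 * coef ℓ (dFst (Ici 0) Φ t) k ^ 2)
    (hρ : MemY ℓ α T ρ) (hsol : SolvesRemainder ℓ ε T Φ ρ) (h0 : ∀ η ∈ cell ℓ, ρ 0 η = 0)
    {τ : ℝ} (hτ : τ ∈ Icc 0 T) (N : Finset ℤ) :
    (∫ t in (0 : ℝ)..τ, ∑ k ∈ N, lam ℓ k * coef ℓ (dFst (Icc 0 T) ρ t) k ^ 2)
      + ∑ k ∈ N, lam ℓ k ^ 3 * coef ℓ (ρ τ) k ^ 2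
      ≤ (2304 * A ^ 4 * T + 200 * C) + energyConst ℓ A
        * ∫ t in (0 : ℝ)..τ, (thirdSq ℓ (ρ t) + ε ^ 2 * thirdSq ℓ (ρ t) ^ 2) := by
  have hR := Subset.refl (Icc 0 T)
  have hJ := Icc_subset_Ici_zero T
  have hsub : Icc 0 τ ⊆ Icc 0 T := Icc_subset_Icc_right hτ.2
  have cy : ∀ k, ContinuousOn (fun t => coef ℓ (ρ t) k) (Icc 0 T) := fun k =>
    (hρ.1.contOnRect hR).continuousOn_coef hℓ k
  have cy' : ∀ k, ContinuousOn (fun t => coef ℓ (dFst (Icc 0 T) ρ t) k) (Icc 0 T) := fun k =>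
    (hρ.1.contOnRect_dFst hR).continuousOn_coef hℓ k
  have cf : ∀ k, ContinuousOn (fun t => coef ℓ (Φ t) k) (Icc 0 T) := fun k =>
    (hΦ.regular.contOnRect hJ).continuousOn_coef hℓ k
  have cf' : ∀ k, ContinuousOn (fun t => coef ℓ (dFst (Ici 0) Φ t) k) (Icc 0 T) := fun k =>
    (hΦ.regular.contOnRect_dFst hJ).continuousOn_coef hℓ k
  have cE := hρ.continuousOn_thirdSq hℓ
  have hint : ∀ {g : ℝ → ℝ}, ContinuousOn g (Icc 0 T) → IntervalIntegrable g volume 0 τ :=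
    fun hg => ContinuousOn.intervalIntegrable (by rw [uIcc_of_le hτ.1]; exact hg.mono hsub)
  set D : ℝ → ℝ := fun t => ∑ k ∈ N, lam ℓ k * coef ℓ (dFst (Icc 0 T) ρ t) k ^ 2 with hD
  set g' : ℝ → ℝ := fun t => ∑ k ∈ N, 2 * (lam ℓ k * (lam ℓ k - symS ℓ ε k)
        * (coef ℓ (ρ t) k * coef ℓ (dFst (Icc 0 T) ρ t) k)) with hg'
  set g : ℝ → ℝ := fun t => ∑ k ∈ N, lam ℓ k * (lam ℓ k - symS ℓ ε k) * coef ℓ (ρ t) k ^ 2 with hg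
  set S : ℝ → ℝ := fun t => ∑ k ∈ N, (lam ℓ k ^ 5 * coef ℓ (Φ t) k ^ 2
      + lam ℓ k ^ 3 * coef ℓ (dFst (Ici 0) Φ t) k ^ 2) with hS
  have cD : ContinuousOn D (Icc 0 T) :=
    continuousOn_finsetSum _ fun k _ => ((cy' k).pow 2).const_mul _
  have cg' : ContinuousOn g' (Icc 0 T) :=
    continuousOn_finsetSum _ fun k _ => (((cy k).mul (cy' k)).const_mul _).const_mul _
  have cg : ContinuousOn g (Icc 0 T) :=
    continuousOn_finsetSum _ fun k _ => ((cy k).pow 2).const_mul _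
  have cS : ContinuousOn S (Icc 0 T) :=
    continuousOn_finsetSum _ fun k _ => (((cf k).pow 2).const_mul _).add (((cf' k).pow 2).const_mul _)
  set q : ℝ → ℝ := fun t => thirdSq ℓ (ρ t) + ε ^ 2 * thirdSq ℓ (ρ t) ^ 2 with hq
  have cq : ContinuousOn q (Icc 0 T) := by fun_prop
  have hftc : ∫ t in (0 : ℝ)..τ, g' t = g τ - g 0 :=
    intervalIntegral.integral_eq_sub_of_hasDerivAt_of_le hτ.1 (cg.mono hsub)
      (fun t ht => by
        refine HasDerivAt.fun_sum fun k _ => ?_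
        exact (((hρ.hasDerivAt_coef hℓ ⟨ht.1, ht.2.trans_le hτ.2⟩ k).pow 2).const_mul
          _).congr_deriv (by norm_num; ring))
      (hint cg')
  have hg0 : g 0 = 0 := by
    have e : coef ℓ (ρ 0) = coef ℓ fun _ => 0 := coef_congr hℓ h0
    simp [hg, e, coef_zero_fun]
  have hgτ : ∑ k ∈ N, lam ℓ k ^ 3 * coef ℓ (ρ τ) k ^ 2 ≤ g τ :=
    Finset.sum_le_sum fun k _ => by
      have h1 := mul_le_mul_of_nonneg_left (neg_symS_ge (ℓ := ℓ) hε hε' k) (lam_nonneg ℓ k)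
      exact mul_le_mul_of_nonneg_right (le_trans (le_of_eq (by ring)) h1) (sq_nonneg _)
  have hae : ∀ᵐ t ∂(volume.restrict (Ioc 0 τ)),
      D t + g' t ≤ (energyConst ℓ A * q t + 2304 * A ^ 4) + 200 * S t := by
    have hs' := ae_mono (Measure.restrict_mono (Ioc_subset_Ioc_right hτ.2) le_rfl) hs
    -- The coefficient equation is available at interior times only, and `τ = T` is allowed; the end
    -- point is a null set.
    have hne : ∀ᵐ t ∂(volume.restrict (Ioc 0 τ)), t ≠ T :=
      ae_restrict_of_ae (Measure.ae_ne volume T)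
    filter_upwards [hs', hne, ae_restrict_mem measurableSet_Ioc] with t h1 h2 h3
    have := hsol.energy_pointwise hℓ hT hε (by linarith) hΦ hA hρ
      ⟨h3.1, lt_of_le_of_ne (h3.2.trans hτ.2) h2⟩ h1 N
    rw [Finset.sum_add_distrib] at this
    exact this
  have iD := hint cD
  have ig := hint cg'
  have iq := (hint cq).const_mul (energyConst ℓ A)
  have iS := (hint cS).const_mul 200
  have ic : IntervalIntegrable (fun _ : ℝ => 2304 * A ^ 4) volume 0 τ := by simp
  have hle : ∫ t in (0 : ℝ)..τ, (D t + g' t)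
      ≤ ∫ t in (0 : ℝ)..τ, ((energyConst ℓ A * q t + 2304 * A ^ 4) + 200 * S t) := by
    rw [intervalIntegral.integral_of_le hτ.1, intervalIntegral.integral_of_le hτ.1]
    exact setIntegral_mono_ae_restrict (iD.add ig).1 ((iq.add ic).add iS).1 hae
  rw [intervalIntegral.integral_add iD ig, intervalIntegral.integral_add (iq.add ic) iS,
    intervalIntegral.integral_add iq ic, intervalIntegral.integral_const_mul,
    intervalIntegral.integral_const_mul 200, intervalIntegral.integral_const, smul_eq_mul, hftc,
    hg0] at hle
  have hSle : ∫ t in (0 : ℝ)..τ, S t ≤ C := by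
    refine le_trans (intervalIntegral.integral_mono_interval le_rfl hτ.1 hτ.2
      (ae_of_all _ fun t => Finset.sum_nonneg fun k _ => add_nonneg
        (mul_nonneg (pow_nonneg (lam_nonneg ℓ k) _) (sq_nonneg _))
        (mul_nonneg (pow_nonneg (lam_nonneg ℓ k) _) (sq_nonneg _)))
      (ContinuousOn.intervalIntegrable (by rw [uIcc_of_le hT.le]; exact cS))) (hC N)
  have hA4 : 0 ≤ 2304 * A ^ 4 * (T - τ) := mul_nonneg (by positivity) (by linarith [hτ.2])
  linarith

end Remainder

/-! ### Consequences of the energy estimate -/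

section Remainder

variable {ℓ α ε T A : ℝ} {Φ₀ : ℝ → ℝ} {Φ ρ : ℝ → ℝ → ℝ}

/-- The mean of the time derivative of the remainder is governed by the convective terms. -/
lemma SolvesRemainder.coef_zero_sq_le (hℓ : 0 < ℓ) (hT : 0 < T) (hε : 0 < ε) (hε' : ε ≤ 1)
    (hΦ : SolvesKS ℓ Φ₀ Φ) (hρ : MemY ℓ α T ρ) (hsol : SolvesRemainder ℓ ε T Φ ρ) {t : ℝ}
    (ht : t ∈ Ioo 0 T) (hs : Summable fun k => lam ℓ k ^ 3 * coef ℓ (dFst (Ici 0) Φ t) k ^ 2) :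
    coef ℓ (dFst (Icc 0 T) ρ t) 0 ^ 2 ≤ coef ℓ (convTerm ℓ ε (Φ t) (ρ t)) 0 ^ 2 := by
  have heq := hsol.coef_equation hℓ hT hε hε' hΦ hρ ht hs 0
  have hH := (opH_coef hℓ hε (hΦ.regular.2.1 t ht.1.le) (hΦ.periodic t ht.1.le)
    ((hΦ.regular.contOnRect_dFst (Icc_subset_Ici_zero T)).slice (Ioo_subset_Icc_self ht)) hs).2 0
  -- At zero frequency diffusion, squared slope and forcing all disappear, and `symB ≥ 1`.
  have hS : symS ℓ ε 0 = 0 := by simp [symS, lam_zero]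
  have hG : symG ℓ ε 0 = 0 := by simp [symG, lam_zero]
  have hB := symB_ge (ℓ := ℓ) hε 0
  rw [lam_zero] at hH hB
  have hH0 : coef ℓ (opH ℓ ε (Φ t) (dFst (Ici 0) Φ t)) 0 = 0 := by
    refine pow_eq_zero_iff (n := 2) (by norm_num) |>.1 (le_antisymm (hH.trans (le_of_eq ?_))
      (sq_nonneg _))
    ring
  rw [hS, hG, hH0, zero_mul, zero_mul, zero_add, add_zero, add_zero] at heq
  rw [← heq, mul_pow]
  exact le_mul_of_one_le_left (sq_nonneg _) (one_le_pow₀ (by linarith))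

/-- Poincaré's inequality. -/
lemma mean_sq_le (hℓ : 0 < ℓ) {ψ : ℝ → ℝ} (hψ : ContDiffOn ℝ 2 ψ (cell ℓ))
    (hp : ψ (-(ℓ / 2)) = ψ (ℓ / 2)) :
    ℓ⁻¹ * ∫ η in (-(ℓ / 2))..(ℓ / 2), ψ η ^ 2
      ≤ coef ℓ ψ 0 ^ 2
        + (lam ℓ 1)⁻¹ * (ℓ⁻¹ * ∫ η in (-(ℓ / 2))..(ℓ / 2), dEta ℓ 1 ψ η ^ 2) := by
  have h1 := hasSum_lam_pow_dEta hℓ (n := 2) hψ (by norm_num : 1 ≤ 2) fun i hi => by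
    rwa [Nat.lt_one_iff.1 hi, dEta_zero]
  simp only [pow_one] at h1
  have h2 := (hasSum_ite_eq (0 : ℤ) (coef ℓ ψ 0 ^ 2)).add (h1.mul_left (lam ℓ 1)⁻¹)
  refine hasSum_le (fun k => ?_) (hasSum_coef_sq hℓ hψ.continuousOn) h2
  split_ifs with hk
  · subst hk; simp [lam_zero]
  · rw [zero_add, ← mul_assoc]
    refine le_mul_of_one_le_left (sq_nonneg _) ?_
    rw [inv_mul_eq_div, one_le_div (lam_one_pos hℓ)]
    exact lam_one_le hk

/-- The a priori bound, with constants that do not depend on the small parameter. -/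
lemma SolvesRemainder.bound (hℓ : 0 < ℓ) (hT : 0 < T) (hε : 0 < ε) (hε' : ε ≤ 1 / 2)
    (hΦ : SolvesKS ℓ Φ₀ Φ) (hA : ∀ t ∈ Icc 0 T, ∀ η ∈ cell ℓ, ∀ j ≤ 4, |dEta ℓ j (Φ t) η| ≤ A)
    {C : ℝ} (hC0 : 0 ≤ C)
    (hC : ∀ N : Finset ℤ, ∫ t in (0 : ℝ)..T, ∑ k ∈ N, (lam ℓ k ^ 5 * coef ℓ (Φ t) k ^ 2
      + lam ℓ k ^ 3 * coef ℓ (dFst (Ici 0) Φ t) k ^ 2) ≤ C)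
    (hs : ∀ᵐ t ∂(volume.restrict (Ioc 0 T)),
      Summable fun k => lam ℓ k ^ 3 * coef ℓ (dFst (Ici 0) Φ t) k ^ 2)
    (hρ : MemY ℓ α T ρ) (hsol : SolvesRemainder ℓ ε T Φ ρ) (h0 : ∀ η ∈ cell ℓ, ρ 0 η = 0)
    {M : ℝ} (hM : M = (2304 * A ^ 4 * T + 200 * C) * Real.exp (energyConst ℓ A * T))
    (hεM : ε ^ 2 * M ≤ 1 / 2) {K : ℝ}
    (hK : K = (2304 * A ^ 4 * T + 200 * C) + energyConst ℓ A * (T * (2 * M + (2 * M) ^ 2))) :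
    (∀ t ∈ Icc 0 T, thirdSq ℓ (ρ t) ≤ 2 * M) ∧
    (∫ t in (0 : ℝ)..T, ∫ η in (-(ℓ / 2))..(ℓ / 2), dEta ℓ 1 (dFst (Icc 0 T) ρ t) η ^ 2) ≤ ℓ * K ∧
    (∫ t in (0 : ℝ)..T, ∫ η in (-(ℓ / 2))..(ℓ / 2), dFst (Icc 0 T) ρ t η ^ 2)
      ≤ ℓ * (T * (2 * (A ^ 2 * (ℓ ^ 4 * (2 * M))) + (ℓ ^ 4 * (2 * M)) ^ 2) + (lam ℓ 1)⁻¹ * K) := by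
  have hR := Subset.refl (Icc 0 T)
  have hen : ∀ τ ∈ Icc 0 T, ∀ N, _ := fun τ hτ N =>
    hsol.energy hℓ hT hε hε' hΦ hA hC hs hρ h0 hτ N
  have cE := hρ.continuousOn_thirdSq hℓ
  have hE0 : ∀ t, 0 ≤ thirdSq ℓ (ρ t) := fun t => thirdSq_nonneg hℓ (ρ t)
  have hec := energyConst_nonneg (ℓ := ℓ) A
  have hE : ∀ t ∈ Icc 0 T, thirdSq ℓ (ρ t) ≤ 2 * M := by
    intro t ht
    rw [hM] at hεM ⊢
    refine gronwall_quadratic hec (by positivity) (sq_nonneg ε) cE (fun t _ => hE0 t)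
      (fun τ hτ => ?_) hεM ht
    refine hasSum_le_of_sum_le (hasSum_lam_pow_dEta hℓ (n := 4) (hρ.1.2.1 τ hτ)
      (by norm_num : 3 ≤ 4) fun i hi => hρ.2.2 τ hτ i (by omega)) fun N => ?_
    -- The dissipation of `ρ_τ` is dropped to obtain the bound on `E` and is recovered afterwards,
    -- once the right-hand side is known to be bounded.
    refine le_trans (le_add_of_nonneg_left ?_) (hen τ hτ N)
    exact intervalIntegral.integral_nonneg hτ.1 fun t _ => Finset.sum_nonneg fun k _ =>
      mul_nonneg (lam_nonneg ℓ k) (sq_nonneg _)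
  have hreg' := hρ.2.1.1
  have c1 := ((hreg'.contOnRect_dEta hR (by norm_num : 1 ≤ 2)).pow 2).continuousOn_integral hℓ
  have c0 := ((hreg'.contOnRect hR).pow 2).continuousOn_integral hℓ
  have hint : ∀ {g : ℝ → ℝ}, ContinuousOn g (Icc 0 T) → IntervalIntegrable g volume 0 T :=
    fun hg => ContinuousOn.intervalIntegrable (by rw [uIcc_of_le hT.le]; exact hg)
  have hTT : T ∈ Icc 0 T := ⟨hT.le, le_rfl⟩
  have h1 : ∫ t in (0 : ℝ)..T, ℓ⁻¹ * ∫ η in (-(ℓ / 2))..(ℓ / 2),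
      dEta ℓ 1 (dFst (Icc 0 T) ρ t) η ^ 2 ≤ K := by
    refine integral_hasSum_le hT.le
      (g := fun k t => lam ℓ k * coef ℓ (dFst (Icc 0 T) ρ t) k ^ 2)
      (fun k => (((hρ.1.contOnRect_dFst hR).continuousOn_coef hℓ k).pow 2).const_mul _)
      (fun k t => mul_nonneg (lam_nonneg ℓ k) (sq_nonneg _)) (c1.const_mul _)
      (fun t ht => ?_) fun N => ?_
    · simpa only [pow_one] using hasSum_lam_pow_dEta hℓ (n := 2) (hreg'.2.1 t ht)
        (by norm_num : 1 ≤ 2) fun i hi => hρ.periodic_dFst hℓ hT ht (by omega)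
    -- Now the energy at the final time is dropped and the dissipation kept, with `E ≤ 2 M` inserted
    -- on the right.
    · have h2 := hen T hTT N
      have h3 : 0 ≤ ∑ k ∈ N, lam ℓ k ^ 3 * coef ℓ (ρ T) k ^ 2 := Finset.sum_nonneg fun k _ =>
        mul_nonneg (pow_nonneg (lam_nonneg ℓ k) 3) (sq_nonneg _)
      have h4 : ∫ t in (0 : ℝ)..T, (thirdSq ℓ (ρ t) + ε ^ 2 * thirdSq ℓ (ρ t) ^ 2)
          ≤ ∫ t in (0 : ℝ)..T, (2 * M + (2 * M) ^ 2) := by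
        refine intervalIntegral.integral_mono_on hT.le (hint (by fun_prop)) (by simp)
          fun t ht => ?_
        have h5 := hE t ht
        have h6 := hE0 t
        have h7 : thirdSq ℓ (ρ t) ^ 2 ≤ (2 * M) ^ 2 := by gcongr
        have h8 : ε ^ 2 * thirdSq ℓ (ρ t) ^ 2 ≤ 1 * thirdSq ℓ (ρ t) ^ 2 := by
          gcongr; nlinarith
        linarith
      rw [intervalIntegral.integral_const, smul_eq_mul, sub_zero] at h4
      have h5 := mul_le_mul_of_nonneg_left h4 hec
      rw [hK]
      linarith
  refine ⟨hE, ?_, ?_⟩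
  · rw [intervalIntegral.integral_const_mul, inv_mul_le_iff₀ hℓ] at h1
    exact h1
  · rw [← inv_mul_le_iff₀ hℓ, ← intervalIntegral.integral_const_mul]
    set B := 2 * (A ^ 2 * (ℓ ^ 4 * (2 * M))) + (ℓ ^ 4 * (2 * M)) ^ 2 with hB
    have c1' := c1.const_mul ℓ⁻¹
    have hle : ∫ t in (0 : ℝ)..T, ℓ⁻¹ * ∫ η in (-(ℓ / 2))..(ℓ / 2), dFst (Icc 0 T) ρ t η ^ 2
        ≤ ∫ t in (0 : ℝ)..T, (B + (lam ℓ 1)⁻¹ * (ℓ⁻¹ * ∫ η in (-(ℓ / 2))..(ℓ / 2),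
          dEta ℓ 1 (dFst (Icc 0 T) ρ t) η ^ 2)) := by
      rw [intervalIntegral.integral_of_le hT.le, intervalIntegral.integral_of_le hT.le]
      refine setIntegral_mono_ae_restrict (hint (c0.const_mul _)).1
        (hint (continuousOn_const.add (c1'.const_mul _))).1 ?_
      have hne : ∀ᵐ t ∂(volume.restrict (Ioc 0 T)), t ≠ T :=
        ae_restrict_of_ae (Measure.ae_ne volume T)
      filter_upwards [hs, hne, ae_restrict_mem measurableSet_Ioc] with t h2 h3 h4
      have ht : t ∈ Ioo 0 T := ⟨h4.1, lt_of_le_of_ne h4.2 h3⟩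
      have htI := Ioo_subset_Icc_self ht
      have hP := hρ.periodic_dFst hℓ hT htI (j := 0) (by norm_num)
      rw [dEta_zero] at hP
      -- Poincaré's inequality splits `ρ_τ` into its space derivative, already controlled, and its
      -- mean, governed by the convective terms.
      refine (mean_sq_le hℓ (hreg'.2.1 t htI) hP).trans (add_le_add_left ?_ _)
      refine (hsol.coef_zero_sq_le hℓ hT hε (by linarith) hΦ hρ ht h2).trans ?_
      refine (coef_convTerm_sq_le hℓ (hΦ.regular.2.1 t ht.1.le) (hA t htI) (hρ.1.2.1 t htI)
        (hρ.2.2 t htI) 0).trans ?_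
      have h5 := hE t htI
      have h6 := hE0 t
      have h7 : ε ^ 2 * (ℓ ^ 4 * thirdSq ℓ (ρ t)) ^ 2 ≤ 1 * (ℓ ^ 4 * (2 * M)) ^ 2 := by
        gcongr; nlinarith
      have h8 : A ^ 2 * (ℓ ^ 4 * thirdSq ℓ (ρ t)) ≤ A ^ 2 * (ℓ ^ 4 * (2 * M)) := by gcongr
      linarith
    rw [intervalIntegral.integral_add (by simp) (hint (c1'.const_mul _)),
      intervalIntegral.integral_const, intervalIntegral.integral_const_mul (lam ℓ 1)⁻¹,
      smul_eq_mul, sub_zero] at hle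
    have h2 := mul_le_mul_of_nonneg_left h1 (inv_pos.2 (lam_one_pos hℓ)).le
    linarith

end Remainder

end FrontKS

/-! ### The uniform bound for the remainder -/

theorem mainTheorem2 (ℓ₀ : ℝ) (hℓ₀ : 0 < ℓ₀) (α : ℝ) (hα : α ∈ Set.Ioo (0 : ℝ) (1 / 2))
    (Φ₀ : ℝ → ℝ) (hΦ₀ : FrontKS.MemCSharp ℓ₀ 6 α Φ₀)
    (Φ : ℝ → ℝ → ℝ) (hΦ : FrontKS.SolvesKS ℓ₀ Φ₀ Φ) :
    ∀ T : ℝ, 0 < T → ∃ ε₀ ∈ Set.Ioo (0 : ℝ) (1 / 2), ∃ K : ℝ, 0 < K ∧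
      ∀ ε : ℝ, 0 < ε → ε ≤ ε₀ → ∀ ρ : ℝ → ℝ → ℝ,
        FrontKS.MemY ℓ₀ α T ρ →
        FrontKS.SolvesRemainder ℓ₀ ε T Φ ρ →
        (∀ η ∈ FrontKS.cell ℓ₀, ρ 0 η = 0) →
        -- the sum of the two suprema and the two integrals is at most `K`
        ∀ τ₁ ∈ Set.Ioc 0 T, ∀ η₁ ∈ FrontKS.cell ℓ₀, ∀ τ₂ ∈ Set.Ioc 0 T,
          |FrontKS.dEta ℓ₀ 1 (ρ τ₁) η₁|
            + (∫ η in (-(ℓ₀ / 2))..(ℓ₀ / 2), (FrontKS.dEta ℓ₀ 2 (ρ τ₂) η) ^ 2)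
            + (∫ τ in (0 : ℝ)..T, ∫ η in (-(ℓ₀ / 2))..(ℓ₀ / 2),
                (FrontKS.dFst (Set.Icc 0 T) ρ τ η) ^ 2)
            + (∫ τ in (0 : ℝ)..T, ∫ η in (-(ℓ₀ / 2))..(ℓ₀ / 2),
                (FrontKS.dEta ℓ₀ 1 (FrontKS.dFst (Set.Icc 0 T) ρ τ) η) ^ 2) ≤ K := by
  intro T hT
  obtain ⟨A, hA1, hA⟩ := hΦ.bounds T
  obtain ⟨C, hC0, hC⟩ := hΦ.energy hℓ₀ hΦ₀ hT
  have hs := hΦ.ae_summable hℓ₀ hΦ₀ hT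
  have hec := FrontKS.energyConst_nonneg (ℓ := ℓ₀) A
  have hl1 := FrontKS.lam_one_pos hℓ₀
  set M := (2304 * A ^ 4 * T + 200 * C) * Real.exp (FrontKS.energyConst ℓ₀ A * T) with hM
  have hM0 : 0 ≤ M := by positivity
  set K := (2304 * A ^ 4 * T + 200 * C) + FrontKS.energyConst ℓ₀ A * (T * (2 * M + (2 * M) ^ 2))
    with hK
  have hK0 : 0 ≤ K := by positivity
  set L := ℓ₀ * (T * (2 * (A ^ 2 * (ℓ₀ ^ 4 * (2 * M))) + (ℓ₀ ^ 4 * (2 * M)) ^ 2)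
    + (FrontKS.lam ℓ₀ 1)⁻¹ * K) with hL
  have hL0 : 0 ≤ L := by positivity
  -- From `ε (2 M + 4) ≤ 1` follow both `ε ≤ 1/2` and `ε² M ≤ 1/2`, the smallness required by the
  -- quadratic Gronwall inequality. Through `M` the threshold depends on `T` and `Φ`.
  refine ⟨1 / (2 * M + 4), ⟨by positivity, ?_⟩,
    (1 + ℓ₀ ^ 4 * (2 * M)) + ℓ₀ * (ℓ₀ ^ 2 * (2 * M)) + L + ℓ₀ * K, by positivity, ?_⟩
  · exact one_div_lt_one_div_of_lt (by norm_num) (by linarith)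
  intro ε hε hεε ρ hρ hsol h0 τ₁ hτ₁ η₁ hη₁ τ₂ hτ₂
  rw [le_div_iff₀ (by positivity)] at hεε
  have hε' : ε ≤ 1 / 2 := by nlinarith [mul_nonneg hε.le hM0]
  have hεM : ε ^ 2 * M ≤ 1 / 2 := by nlinarith [mul_nonneg hε.le hM0]
  obtain ⟨hE, h1, h2⟩ := hsol.bound hℓ₀ hT hε hε' hΦ hA hC0 hC hs hρ h0 hM hεM hK
  have hτ₁' := Set.Ioc_subset_Icc_self hτ₁
  have hτ₂' := Set.Ioc_subset_Icc_self hτ₂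
  have b1 : |FrontKS.dEta ℓ₀ 1 (ρ τ₁) η₁| ≤ 1 + ℓ₀ ^ 4 * (2 * M) := by
    have h3 := FrontKS.dEta_one_sq_le hℓ₀ (hρ.1.2.1 τ₁ hτ₁') (hρ.2.2 τ₁ hτ₁') hη₁
    have h4 := mul_le_mul_of_nonneg_left (hE τ₁ hτ₁') (by positivity : 0 ≤ ℓ₀ ^ 4)
    rw [← sq_abs] at h3
    -- The elementary bound `|x| ≤ 1 + x²` avoids a square root in the constant.
    nlinarith [sq_nonneg (|FrontKS.dEta ℓ₀ 1 (ρ τ₁) η₁| - 1)]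
  have b2 : ∫ η in (-(ℓ₀ / 2))..(ℓ₀ / 2), (FrontKS.dEta ℓ₀ 2 (ρ τ₂) η) ^ 2
      ≤ ℓ₀ * (ℓ₀ ^ 2 * (2 * M)) := by
    rw [← inv_mul_le_iff₀ hℓ₀]
    refine FrontKS.integral_sq_le hℓ₀
      (FrontKS.continuousOn_dEta hℓ₀ (n := 4) (hρ.1.2.1 τ₂ hτ₂') (by norm_num)) fun η hη => ?_
    exact (FrontKS.dEta_two_sq_le hℓ₀ (hρ.1.2.1 τ₂ hτ₂') (hρ.2.2 τ₂ hτ₂') hη).trans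
      (mul_le_mul_of_nonneg_left (hE τ₂ hτ₂') (by positivity))
  linarith
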